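/- In the broadcast congested clique model there are $n\ge 1$ fully connected nodes with distinct identifiers of $O(\log n)$ bits. Computation proceeds in synchronous rounds; in each round every node that is still running performs arbitrary local computations, broadcasts one message of $O(\log n)$ bits to all other nodes, and receives the messages of the other nodes, each together with the identifier of its sender; a node halts when it outputs. For single-source shortest paths the input is an undirected graph $G$ on the set of nodes with non-negative integer edge weights that are polynomially bounded in $n$, a source node $s$, and $0<\varepsilon\le 1$. Initially each node knows $n$, $\varepsilon$, its own identifier, its incident edges (given by the identifiers of their other endpoints) with their weights, and whether it is the source. For a node $v$ let $d(s,v)\in[0,\infty]$ denote its weighted distance to $s$ in $G$ ($\infty$ if $v$ is not reachable from $s$). Theorem. There are constants $a,b\in\mathbb N$ such that for every $c\in\mathbb N$ there are $\kappa\in\mathbb N$, $C>0$ and a deterministic algorithm for the broadcast congested clique with messages of at most $\kappa\lceil\log_2 n\rceil$ bits such that the following holds. For all $n\ge 1$, all $0<\varepsilon\le 1$, all distinct identifiers that are at most $n^c$, all undirected graphs $G$ on the $n$ nodes with edge weights in $\{0,1,\dots,n^c\}$ and every source $s$, within at most $C\,\varepsilon^{-a}\,(\log(n+1))^{b}$ rounds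 every node $v$ has halted with an output $y_v\in[0,\infty]$ such that $$\frac{d(s,v)}{1+\varepsilon}\le y_v\le d(s,v).$$ That is, a deterministic $(1+\varepsilon)$-approximation of every node's distance to the source is computed in $\tilde O(\varepsilon^{-O(1)})$ rounds. -/

import Mathlib

open scoped ENNReal

/-! The broadcast congested clique, and single-source shortest paths in it. -/

namespace BroadcastCongestedClique

/-- A deterministic algorithm for the broadcast congested clique. All nodes run the same
algorithm, and local computation is unrestricted, so `init`, `send`, `update`, `output` are
arbitrary functions. A node starts in state `init x`, where `x` is its local input. In every
round a running node broadcasts the bit string `send σ` (`σ` is its current state), receives the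
messages of the other nodes, and moves to the state `update σ inbox`. The inbox is the set of all
pairs (identifier of a sender, message of that sender). A node has halted as soon as its state
has an output, i.e. `output σ ≠ none`. -/
structure Algorithm (In Out : Type) where
  State : Type
  init : In → State
  send : State → List Bool
  update : State → Set (ℕ × List Bool) → State
  output : State → Option Out

namespace Algorithm

variable {In Out : Type} (A : Algorithm In Out)

/-- The messages that node `v` receives in a round at whose beginning the nodes are in the states
`σ`. Halted nodes are silent. -/
def inbox {n : ℕ} (ident : Fin n → ℕ) (σ : Fin n → A.State) (v : Fin n) :
    Set (ℕ × List Bool) :=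
  {p | ∃ u : Fin n, u ≠ v ∧ A.output (σ u) = none ∧ p = (ident u, A.send (σ u))}

/-- The states of all nodes after `t` rounds, if node `v` has the identifier `ident v` and the
local input `input v`. The state of a halted node does not change any more. -/
def stateAfter {n : ℕ} (ident : Fin n → ℕ) (input : Fin n → In) : ℕ → Fin n → A.State
  | 0 => fun v => A.init (input v)
  | t + 1 => fun v =>
      match A.output (stateAfter ident input t v) with
      | some _ => stateAfter ident input t v
      | none => A.update (stateAfter ident input t v)
          (A.inbox ident (stateAfter ident input t) v)

/-- In this execution, every message that is ever broadcast has at most `B` bits. -/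
def MessagesBounded {n : ℕ} (ident : Fin n → ℕ) (input : Fin n → In) (B : ℕ) : Prop :=
  ∀ (t : ℕ) (v : Fin n), A.output (A.stateAfter ident input t v) = none →
    (A.send (A.stateAfter ident input t v)).length ≤ B

end Algorithm

/-- What a node knows initially in the single-source shortest paths problem: the number `n` of
nodes, the accuracy `ε`, its own identifier, the set of its incident edges, each given as
(identifier of the other endpoint, weight), and whether it is the source. -/
structure SSSPInput where
  n : ℕ
  ε : ℝ
  ident : ℕ
  edges : Set (ℕ × ℕ)
  isSource : Prop

/-- The local input of node `v`, for the graph `G` with edge weights `w` and source `s`. -/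
def localInput {n : ℕ} (ε : ℝ) (ident : Fin n → ℕ) (G : SimpleGraph (Fin n))
    (w : Sym2 (Fin n) → ℕ) (s v : Fin n) : SSSPInput where
  n := n
  ε := ε
  ident := ident v
  edges := {p | ∃ u : Fin n, G.Adj v u ∧ p = (ident u, w s(v, u))}
  isSource := v = s

/-- The weighted distance from `s` to `v` in `G`: the least total weight of a walk from `s` to
`v`, and `∞` if there is no such walk. -/
noncomputable def weightedDist {V : Type*} (G : SimpleGraph V) (w : Sym2 V → ℕ) (s v : V) :
    ℝ≥0∞ :=
  ⨅ p : G.Walk s v, (((p.edges.map w).sum : ℕ) : ℝ≥0∞)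

/-- `y` is a `(1 + ε)`-approximation of the distance `d`, i.e. `d / (1 + ε) ≤ y ≤ d`. For
`d = ∞` this means `y = ∞`, and for `d = 0` it means `y = 0`. -/
def IsApprox (ε : ℝ) (d y : ℝ≥0∞) : Prop :=
  d / ENNReal.ofReal (1 + ε) ≤ y ∧ y ≤ d

end BroadcastCongestedClique

/-! Distances are treated through the dual linear program: the distance to `s` is the largest
function vanishing at `s` whose slope on every edge is at most 1. Weights are scaled, non-edges
become very long edges, and lengths are rounded up to powers of `1 + 1 / k`. This leaves a complete
graph with few classes of edges. Every node knows its own row, and a set of publicly known edges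
grows during the computation. The distance `u` in the known graph (`maxLip`) dominates the true one.
It remains to reveal few edges such that `u` is at most `1 + 1 / k` times a function that is
Lipschitz on all pairs.

Multiplicative weights reduce this to an averaged requirement. Each iteration puts on the arc `(a,
b)` the weight `exp (η * accumulated slope)`. It suffices to reveal edges such that every function
that is Lipschitz on the known edges has weighted average slope at most `1 + 1 / (3k)`. The mean of
the potentials `u` of all iterations then has all slopes at most `1 + 1 / k`
(`multiplicative_weights`). As the known graph only grows, the final `u` is at most this mean.

The edges to reveal are sampled with probability roughly proportional to weight (`sum_slope_le`,
`sum_cost_le`). A direct concentration argument would need too many samples, so slopes are first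
made bounded and separable. A deterministic clustering in the manner of Baswana and Sen
(`Clustering.valid_next`) places every pair in a group whose centre is within `D` times the pair's
length in the known graph, where `D` is logarithmic, and only polylogarithmically many groups meet
each node. Within a group the slope of an arc is the difference `h b - h a` of two numbers of size
at most `D`. The sampling error then splits into one error per group and node, for heads and for
tails, and a second moment bound suffices for each.

Second moments need only pairwise independence, so affine hashing over a field of polynomial size
provides the sample. Its seed has logarithmic length. A seed of at most average cost is found bit by
bit, since the cost is a sum of terms computable by the individual nodes (`Prot.run_search`,
`View.nodeCost_local`).

If `k` exceeds `8 * n`, broadcasting the whole graph in `n` rounds is already fast enough. The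
translation into the model (`compile_spec`) spends one extra round on the identifiers and the
source. -/

namespace BroadcastCongestedClique

/-! ### Protocols with public transcripts. -/

/-- A protocol in which `n` nodes with private inputs in `In` repeatedly broadcast one message in
`Msg` each; the continuation depends on the messages of all nodes only. -/
inductive Prot (In : Type) (n : ℕ) (Msg : Type) (α : Type) : Type
  | ret (a : α) : Prot In n Msg α
  | step (g : In → Msg) (k : (Fin n → Msg) → Prot In n Msg α) : Prot In n Msg α

namespace Prot

variable {In In' : Type} {n : ℕ} {Msg α β : Type}

/-- The result of a protocol on the private inputs `x`. -/
def run (x : Fin n → In) : Prot In n Msg α → α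
  | ret a => a
  | step g k => (k fun v => g (x v)).run x

/-- The protocol ends within the given number of rounds. -/
def Within : ℕ → Prot In n Msg α → Prop
  | _, ret _ => True
  | 0, step _ _ => False
  | R + 1, step _ k => ∀ m, Within R (k m)

/-- Sequential composition. -/
def bind (f : α → Prot In n Msg β) : Prot In n Msg α → Prot In n Msg β
  | ret a => f a
  | step g k => step g fun m => (k m).bind f

/-- Precomposition of the private inputs with a function. -/
def contramap (h : In' → In) : Prot In n Msg α → Prot In' n Msg α
  | ret a => ret a
  | step g k => step (fun x => g (h x)) fun m => (k m).contramap h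

/-- The part of the protocol that is left after `t` rounds on the private inputs `x`. -/
def residual (x : Fin n → In) : ℕ → Prot In n Msg α → Prot In n Msg α
  | _, ret a => ret a
  | 0, step g k => step g k
  | t + 1, step g k => residual x t (k fun v => g (x v))

@[simp] theorem run_ret (x : Fin n → In) (a : α) : (ret a : Prot In n Msg α).run x = a := rfl

theorem run_bind (x : Fin n → In) (f : α → Prot In n Msg β) (p : Prot In n Msg α) :
    (p.bind f).run x = (f (p.run x)).run x := by
  induction p with
  | ret a => rfl
  | step g k ih => exact ih _

theorem run_contramap (h : In' → In) (x : Fin n → In') (p : Prot In n Msg α) :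
    (p.contramap h).run x = p.run fun v => h (x v) := by
  induction p with
  | ret a => rfl
  | step g k ih => exact ih _

theorem within_ret (R : ℕ) (a : α) : (ret a : Prot In n Msg α).Within R := by
  cases R <;> trivial

theorem Within.mono {R R' : ℕ} {p : Prot In n Msg α} (hp : p.Within R) (h : R ≤ R') :
    p.Within R' := by
  induction p generalizing R R' with
  | ret a => exact within_ret _ _
  | step g k ih =>
    cases R with
    | zero => exact hp.elim
    | succ R =>
      obtain ⟨R'', rfl⟩ : ∃ R'', R' = R'' + 1 := ⟨R' - 1, by omega⟩
      exact fun m => ih m (hp m) (by omega)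

theorem Within.bind {R R' : ℕ} {p : Prot In n Msg α} {f : α → Prot In n Msg β}
    (hp : p.Within R) (hf : ∀ a, (f a).Within R') : (p.bind f).Within (R + R') := by
  induction p generalizing R with
  | ret a => exact (hf a).mono (by omega)
  | step g k ih =>
    cases R with
    | zero => exact hp.elim
    | succ R =>
      rw [Nat.add_right_comm]
      exact fun m => ih m (hp m)

theorem Within.contramap {R : ℕ} {p : Prot In n Msg α} (hp : p.Within R) (h : In' → In) :
    (p.contramap h).Within R := by
  induction p generalizing R with
  | ret a => exact within_ret _ _
  | step g k ih =>
    cases R with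
    | zero => exact hp.elim
    | succ R => exact fun m => ih m (hp m)

theorem residual_succ (x : Fin n → In) (t : ℕ) (p : Prot In n Msg α) :
    residual x (t + 1) p = residual x 1 (residual x t p) := by
  induction p generalizing t with
  | ret a => cases t <;> rfl
  | step g k ih =>
    cases t with
    | zero => rfl
    | succ t => exact ih _ t

theorem residual_of_within (x : Fin n → In) {R : ℕ} {p : Prot In n Msg α} (hp : p.Within R) :
    residual x R p = ret (p.run x) := by
  induction p generalizing R with
  | ret a => cases R <;> rfl
  | step g k ih =>
    cases R with
    | zero => exact hp.elim
    | succ R => exact ih _ (hp _)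

end Prot

/-! ### Execution of protocols in the broadcast congested clique. -/

/-- The list of the lowest `B` binary digits of `m`. -/
def encodeBits (B m : ℕ) : List Bool := List.ofFn fun i : Fin B => m.testBit i

theorem length_encodeBits (B m : ℕ) : (encodeBits B m).length = B := List.length_ofFn

theorem encodeBits_injective {B : ℕ} {m m' : ℕ} (hm : m < 2 ^ B) (hm' : m' < 2 ^ B)
    (h : encodeBits B m = encodeBits B m') : m = m' := by
  have h2 := List.ofFn_injective h
  refine Nat.eq_of_testBit_eq fun i => ?_
  by_cases hi : i < B
  · exact congrFun h2 ⟨i, hi⟩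
  · have hle : 2 ^ B ≤ 2 ^ i := Nat.pow_le_pow_right (by norm_num) (by omega)
    rw [Nat.testBit_lt_two_pow (hm.trans_le hle), Nat.testBit_lt_two_pow (hm'.trans_le hle)]

/-- A protocol on graphs: node `v` knows its own number and, for every other node, the weight of
the edge to that node, if there is one. -/
abbrev GraphProt (κ n : ℕ) : Type :=
  Prot (Fin n × (Fin n → Option ℕ)) n (Fin (2 ^ (κ * Nat.clog 2 n))) (Fin n → ℝ≥0∞)

/-- The row of node `v` in the weighted adjacency matrix. -/
noncomputable def weightRow {n : ℕ} (G : SimpleGraph (Fin n)) (w : Sym2 (Fin n) → ℕ)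
    (v u : Fin n) : Option ℕ :=
  open Classical in if G.Adj v u then some (w s(v, u)) else none

theorem weightRow_isSome {n : ℕ} {G : SimpleGraph (Fin n)} {w : Sym2 (Fin n) → ℕ} {v u : Fin n} :
    (weightRow G w v u).isSome ↔ G.Adj v u := by
  unfold weightRow
  split_ifs with h <;> simp [h]

/-- States of the nodes when a family of graph protocols is executed. -/
inductive NodeState (κ : ℕ) : Type
  | start (x : SSSPInput) : NodeState κ
  | active (n : ℕ) (ids : Fin n → ℕ) (me : Fin n × (Fin n → Option ℕ)) (p : GraphProt κ n) :
      NodeState κ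

namespace NodeState

variable {κ : ℕ}

open Classical in
/-- The message of a node. -/
noncomputable def send : NodeState κ → List Bool
  | start x => [decide x.isSource]
  | active n _ me (.step g _) => encodeBits (κ * Nat.clog 2 n) (g me)
  | active _ _ _ (.ret _) => []

/-- The output of a node. -/
noncomputable def output : NodeState κ → Option ℝ≥0∞
  | start x => if x.n ≤ 1 then some 0 else none
  | active _ _ _ (.step _ _) => none
  | active _ _ me (.ret y) => some (y me.1)

open Classical in
/-- The message of the `j`-th node, read off from the set of all messages. -/
noncomputable def decode {n : ℕ} (B : ℕ) (ids : Fin n → ℕ) (S : Set (ℕ × List Bool)) (j : Fin n) :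
    Fin (2 ^ B) :=
  if h : ∃ m : Fin (2 ^ B), (ids j, encodeBits B m) ∈ S then h.choose else ⟨0, by positivity⟩

open Classical in
/-- The edges of a node, indexed by the ranks of the identifiers. -/
noncomputable def localRow {n : ℕ} (e : Fin n → ℕ) (edges : Set (ℕ × ℕ)) (j : Fin n) :
    Option ℕ :=
  if h : ∃ w, (e j, w) ∈ edges then some h.choose else none

open Classical in
/-- State after the first round, in which the identifiers and the source become known. -/
noncomputable def launch (P : (n : ℕ) → ℝ → Fin n → GraphProt κ n) (x : SSSPInput)
    (S : Set (ℕ × List Bool)) : NodeState κ :=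
  if h : ∃ q : (Fin x.n → ℕ) × Fin x.n × Fin x.n, StrictMono q.1 ∧ Set.range q.1 = Prod.fst '' S ∧
      q.1 q.2.1 = x.ident ∧ (q.1 q.2.2, [true]) ∈ S then
    active x.n h.choose.1 (h.choose.2.1, localRow h.choose.1 x.edges)
      (P x.n x.ε h.choose.2.2)
  else start x

/-- The next state of a node. -/
noncomputable def update (P : (n : ℕ) → ℝ → Fin n → GraphProt κ n) :
    NodeState κ → Set (ℕ × List Bool) → NodeState κ
  | start x, inbox => launch P x (insert (x.ident, (start x : NodeState κ).send) inbox)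
  | active n ids me (.step g k), inbox =>
      active n ids me (k (decode (κ * Nat.clog 2 n) ids
        (insert (ids me.1, encodeBits (κ * Nat.clog 2 n) (g me)) inbox)))
  | active n ids me (.ret y), _ => active n ids me (.ret y)

end NodeState

/-- The algorithm for the broadcast congested clique that executes a family of graph
protocols. -/
noncomputable def compile {κ : ℕ} (P : (n : ℕ) → ℝ → Fin n → GraphProt κ n) :
    Algorithm SSSPInput ℝ≥0∞ where
  State := NodeState κ
  init := NodeState.start
  send := NodeState.send
  update := NodeState.update P
  output := NodeState.output

theorem exists_strictMono_enumeration {n : ℕ} (ident : Fin n → ℕ) (h : Function.Injective ident) :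
    ∃ (e : Fin n → ℕ) (σ : Fin n ≃ Fin n), StrictMono e ∧ ∀ v, e (σ v) = ident v := by
  have hc : (Finset.univ.image ident).card = n := by
    rw [Finset.card_image_of_injective _ h]; simp
  have hr := Finset.range_orderEmbOfFin _ hc
  have hex : ∀ v, ∃ i, (Finset.univ.image ident).orderEmbOfFin hc i = ident v := fun v => by
    have : ident v ∈ Set.range ((Finset.univ.image ident).orderEmbOfFin hc) := by
      rw [hr]; simp
    exact this
  choose f hf using hex
  have hinj : Function.Injective f := fun a b hab => h (by rw [← hf, ← hf, hab])
  exact ⟨_, Equiv.ofBijective f (Finite.injective_iff_bijective.1 hinj),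
    ((Finset.univ.image ident).orderEmbOfFin hc).strictMono, hf⟩

theorem strictMono_eq_of_range_eq {n : ℕ} {e e' : Fin n → ℕ} (h : StrictMono e)
    (h' : StrictMono e') (hr : Set.range e = Set.range e') : e = e' := by
  exact StrictMono.range_inj h h' |>.1 hr

section Compile

variable {κ n : ℕ} {ε : ℝ} {ident : Fin n → ℕ} {G : SimpleGraph (Fin n)}
  {w : Sym2 (Fin n) → ℕ} {s : Fin n} {e : Fin n → ℕ} {σ : Fin n ≃ Fin n}

theorem localRow_eq (hid : Function.Injective ident) (hσ : ∀ v, e (σ v) = ident v) (v : Fin n) :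
    NodeState.localRow e (localInput ε ident G w s v).edges =
      fun j => weightRow G w v (σ.symm j) := by
  funext j
  have hj : e j = ident (σ.symm j) := by rw [← hσ]; simp
  have key : ∀ c, (e j, c) ∈ (localInput ε ident G w s v).edges ↔
      G.Adj v (σ.symm j) ∧ c = w s(v, σ.symm j) := by
    intro c
    simp only [localInput, Set.mem_ofPred_eq, Prod.mk.injEq, hj]
    constructor
    · rintro ⟨u, hu, h1, h2⟩
      obtain rfl := hid h1
      exact ⟨hu, h2⟩
    · rintro ⟨h1, h2⟩
      exact ⟨_, h1, rfl, h2⟩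
  unfold NodeState.localRow weightRow
  by_cases hadj : G.Adj v (σ.symm j)
  · have hex : ∃ c, (e j, c) ∈ (localInput ε ident G w s v).edges := ⟨_, (key _).2 ⟨hadj, rfl⟩⟩
    rw [dif_pos hex, if_pos hadj, ((key _).1 hex.choose_spec).2]
  · rw [dif_neg, if_neg hadj]
    rintro ⟨c, hc⟩
    exact hadj ((key c).1 hc).1

theorem insert_inbox (A : Algorithm SSSPInput ℝ≥0∞) (st : Fin n → A.State)
    (hst : ∀ u, A.output (st u) = none) (v : Fin n) :
    insert (ident v, A.send (st v)) (A.inbox ident st v) =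
      Set.range fun u => (ident u, A.send (st u)) := by
  ext p
  simp only [Algorithm.inbox, Set.mem_insert_iff, Set.mem_ofPred_eq, Set.mem_range]
  constructor
  · rintro (rfl | ⟨u, -, -, rfl⟩)
    exacts [⟨v, rfl⟩, ⟨u, rfl⟩]
  · rintro ⟨u, rfl⟩
    by_cases h : u = v
    · subst h; exact Or.inl rfl
    · exact Or.inr ⟨u, h, hst u, rfl⟩

/-- The choice in `launch` is forced: a strictly monotone enumeration is determined by its range,
and only the source sends `[true]`. All nodes therefore agree on the ranks and on the source. -/
theorem launch_eq (P : (n : ℕ) → ℝ → Fin n → GraphProt κ n) (hid : Function.Injective ident)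
    (he : StrictMono e) (hσ : ∀ v, e (σ v) = ident v) (v : Fin n) :
    NodeState.launch P (localInput ε ident G w s v)
      (Set.range fun u => (ident u, (NodeState.start (localInput ε ident G w s u) :
        NodeState κ).send)) =
      .active n e (σ v, fun j => weightRow G w v (σ.symm j)) (P n ε (σ s)) := by
  set S := Set.range fun u => (ident u, (NodeState.start (localInput ε ident G w s u) :
        NodeState κ).send) with hS
  have hfst : Set.range e = Prod.fst '' S := by
    ext i
    simp only [hS, Set.mem_range, Set.mem_image]
    constructor
    · rintro ⟨j, rfl⟩
      exact ⟨_, ⟨σ.symm j, rfl⟩, by simp [← hσ]⟩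
    · rintro ⟨_, ⟨u, rfl⟩, rfl⟩
      exact ⟨σ u, hσ u⟩
  have hsrc : ∀ i, (i, [true]) ∈ S ↔ i = e (σ s) := by
    intro i
    simp only [hS, Set.mem_range, NodeState.send, localInput, Prod.mk.injEq, hσ,
      List.cons.injEq, and_true]
    constructor
    · rintro ⟨u, rfl, h⟩
      rw [@of_decide_eq_true _ (_) h]
    · rintro rfl
      exact ⟨s, rfl, @decide_eq_true _ (_) rfl⟩
  have hex : ∃ q : (Fin n → ℕ) × Fin n × Fin n, StrictMono q.1 ∧ Set.range q.1 = Prod.fst '' S ∧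
      q.1 q.2.1 = ident v ∧ (q.1 q.2.2, [true]) ∈ S :=
    ⟨(e, σ v, σ s), he, hfst, hσ v, (hsrc _).2 rfl⟩
  have h2 : hex.choose = (e, σ v, σ s) := by
    obtain ⟨h1, h2, h3, h4⟩ := hex.choose_spec
    have hee : hex.choose.1 = e := strictMono_eq_of_range_eq h1 he (h2.trans hfst.symm)
    rw [hee] at h3 h4
    have h5 := he.injective ((hsrc _).1 h4)
    have h6 := he.injective (h3.trans (hσ v).symm)
    exact Prod.ext hee (Prod.ext h6 h5)
  have h3 : NodeState.launch P (localInput ε ident G w s v) S =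
      .active n hex.choose.1 (hex.choose.2.1,
        NodeState.localRow hex.choose.1 (localInput ε ident G w s v).edges)
      (P n ε hex.choose.2.2) := by
    unfold NodeState.launch
    exact dif_pos hex
  rw [h3, h2, localRow_eq hid hσ]

theorem decode_eq {B : ℕ} (hid : Function.Injective ident)
    (hσ : ∀ v, e (σ v) = ident v) (m : Fin n → Fin (2 ^ B)) :
    NodeState.decode B e (Set.range fun u => (ident u, encodeBits B (m (σ u)))) = m := by
  funext j
  have hj : e j = ident (σ.symm j) := by rw [← hσ]; simp
  have hex : ∃ a : Fin (2 ^ B), (e j, encodeBits B a) ∈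
      (Set.range fun u => (ident u, encodeBits B (m (σ u)))) :=
    ⟨m j, σ.symm j, by simp [hj]⟩
  have key : ∀ a : Fin (2 ^ B), (e j, encodeBits B a) ∈
      (Set.range fun u => (ident u, encodeBits B (m (σ u)))) → a = m j := by
    rintro a ⟨u, hu⟩
    simp only [Prod.mk.injEq, hj] at hu
    obtain rfl := hid hu.1
    have := encodeBits_injective (m (σ (σ.symm j))).2 a.2 hu.2
    simp only [Equiv.apply_symm_apply] at this
    exact (Fin.ext this).symm
  unfold NodeState.decode
  rw [dif_pos hex]
  exact key _ hex.choose_spec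

theorem stateAfter_succ_of_none {In Out : Type} (A : Algorithm In Out) (input : Fin n → In)
    (t : ℕ) (v : Fin n) (h : A.output (A.stateAfter ident input t v) = none) :
    A.stateAfter ident input (t + 1) v = A.update (A.stateAfter ident input t v)
      (A.inbox ident (A.stateAfter ident input t) v) := by
  simp only [Algorithm.stateAfter, h]

theorem stateAfter_succ_of_some {In Out : Type} (A : Algorithm In Out) (input : Fin n → In)
    (t : ℕ) (v : Fin n) {y : Out} (h : A.output (A.stateAfter ident input t v) = some y) :
    A.stateAfter ident input (t + 1) v = A.stateAfter ident input t v := by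
  simp only [Algorithm.stateAfter, h]

/-- All nodes hold the same residual protocol, because continuations depend only on the messages of
all nodes and each node adds its own message to its inbox. The shift `t + 1` accounts for the
initial round. -/
theorem stateAfter_compile (P : (n : ℕ) → ℝ → Fin n → GraphProt κ n) (hn : 2 ≤ n)
    (hid : Function.Injective ident) (he : StrictMono e) (hσ : ∀ v, e (σ v) = ident v)
    (t : ℕ) (v : Fin n) :
    (compile P).stateAfter ident (localInput ε ident G w s) (t + 1) v =
      NodeState.active n e (σ v, fun j => weightRow G w v (σ.symm j))
        (Prot.residual (fun i => (i, fun j => weightRow G w (σ.symm i) (σ.symm j))) t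
          (P n ε (σ s))) := by
  induction t generalizing v with
  | zero =>
    have hst : ∀ u, (compile P).output
        ((compile P).stateAfter ident (localInput ε ident G w s) 0 u) = none := fun u => by
      have : ¬ n ≤ 1 := by omega
      simp [compile, Algorithm.stateAfter, NodeState.output, localInput, this]
    have h0 : Prot.residual (fun i => (i, fun j => weightRow G w (σ.symm i) (σ.symm j))) 0
          (P n ε (σ s)) = P n ε (σ s) := by
      cases P n ε (σ s) <;> rfl
    rw [h0]
    refine (stateAfter_succ_of_none _ _ _ _ (hst v)).trans ?_
    change NodeState.launch P _ (insert (ident v, _) _) = _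
    rw [← launch_eq P hid he hσ v]
    congr 1
    exact insert_inbox (compile P) _ hst v
  | succ t ih =>
    rw [Prot.residual_succ]
    have ih' := funext ih
    revert ih'
    cases hp : Prot.residual (fun i => (i, fun j => weightRow G w (σ.symm i) (σ.symm j))) t
          (P n ε (σ s)) with
    | ret y =>
      intro ih'
      refine (stateAfter_succ_of_some (y := y (σ v)) _ _ _ _ ?_).trans ?_
      · rw [ih']; rfl
      · rw [ih']; rfl
    | step g k =>
      intro ih'
      refine (stateAfter_succ_of_none _ _ _ _ ?_).trans ?_
      · rw [ih']; rfl
      rw [ih']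
      change NodeState.active n e _ (k (NodeState.decode _ e (insert (e (σ v), _) _))) =
        NodeState.active n e _ (Prot.residual _ 0 (k _))
      have h0 : ∀ (x) (q : GraphProt κ n), Prot.residual x 0 q = q := fun x q => by
        cases q <;> rfl
      rw [h0, hσ]
      congr 2
      have := insert_inbox (ident := ident) (compile P) (fun v => NodeState.active n e
        (σ v, fun j => weightRow G w v (σ.symm j)) (.step g k)) (fun u => rfl) v
      refine (congrArg (NodeState.decode _ e) this).trans ?_
      refine Eq.trans ?_ (decode_eq hid hσ _)
      simp [compile, NodeState.send]

theorem compile_spec (P : (n : ℕ) → ℝ → Fin n → GraphProt κ n) (hκ : 1 ≤ κ) (hn : 2 ≤ n)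
    (hid : Function.Injective ident) :
    ∃ σ : Fin n ≃ Fin n, (compile P).MessagesBounded ident (localInput ε ident G w s)
        (κ * Nat.clog 2 n) ∧
      ∀ R, (P n ε (σ s)).Within R → ∀ v,
        (compile P).output ((compile P).stateAfter ident (localInput ε ident G w s) (R + 1) v) =
        some ((P n ε (σ s)).run
          (fun i => (i, fun j => weightRow G w (σ.symm i) (σ.symm j))) (σ v)) := by
  obtain ⟨e, σ, he, hσ⟩ := exists_strictMono_enumeration ident hid
  refine ⟨σ, ?_, ?_⟩
  · intro t v hv
    cases t with
    | zero =>
      -- The initial message is a single bit, which fits since `κ` and `Nat.clog 2 n` are positive.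
      have h1 : 1 ≤ Nat.clog 2 n := Nat.clog_pos (by norm_num) hn
      exact Nat.one_le_iff_ne_zero.2 (by positivity)
    | succ t =>
      rw [stateAfter_compile P hn hid he hσ] at hv ⊢
      revert hv
      cases Prot.residual (fun i => (i, fun j => weightRow G w (σ.symm i) (σ.symm j))) t
          (P n ε (σ s)) with
      | ret y => intro hv; cases hv
      | step g k => intro _; exact (length_encodeBits _ _).le
  · intro R hR v
    rw [stateAfter_compile P hn hid he hσ, Prot.residual_of_within _ hR]
    rfl

theorem output_compile_of_le_one (P : (n : ℕ) → ℝ → Fin n → GraphProt κ n) (hn : n ≤ 1) (t : ℕ)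
    (v : Fin n) : (compile P).output ((compile P).stateAfter ident (localInput ε ident G w s) t v) =
      some 0 := by
  induction t with
  | zero => simp [compile, Algorithm.stateAfter, NodeState.output, localInput, hn]
  | succ t ih => rw [stateAfter_succ_of_some _ _ _ _ ih, ih]

theorem weightedDist_map_le {V V' : Type*} (f : V → V') {G : SimpleGraph V} {G' : SimpleGraph V'}
    (hf : ∀ a b, G.Adj a b → G'.Adj (f a) (f b)) (w : Sym2 V → ℕ) (w' : Sym2 V' → ℕ)
    (hw : ∀ a b, w' s(f a, f b) = w s(a, b)) (a b : V) :
    weightedDist G' w' (f a) (f b) ≤ weightedDist G w a b := by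
  refine le_iInf fun p => ?_
  refine (iInf_le _ (p.map (⟨f, fun {a b} h => hf a b h⟩ : G →g G'))).trans_eq ?_
  congr 2
  rw [SimpleGraph.Walk.edges_map, List.map_map]
  congr 1
  funext x
  induction x using Sym2.ind with
  | _ a b => exact hw a b

/-- Protocols run on the ranks of the identifiers; this carries their guarantee back to the original
nodes. -/
theorem weightedDist_relabel {V : Type*} (σ : V ≃ V) (G : SimpleGraph V) (w : Sym2 V → ℕ)
    (a b : V) :
    weightedDist (G.comap σ.symm) (fun x => w (x.map σ.symm)) (σ a) (σ b) =
      weightedDist G w a b := by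
  apply le_antisymm
  · exact weightedDist_map_le σ (by simp) _ _ (by simp) a b
  · simpa using weightedDist_map_le σ.symm (G := G.comap σ.symm) (G' := G) (fun a b h => h)
      (fun x => w (x.map σ.symm)) w (by simp) (σ a) (σ b)

end Compile

end BroadcastCongestedClique

/-! ### Elementary protocols and the method of conditional expectations. -/

namespace BroadcastCongestedClique

namespace Prot

variable {In : Type} {n M : ℕ} {α β σ Ω : Type}

/-- Every node broadcasts an element of a finite type. -/
noncomputable def ask [Fintype β] [Nonempty β] (h : Fintype.card β ≤ M) (g : In → β) :
    Prot In n (Fin M) (Fin n → β) :=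
  step (fun x => Fin.castLE h (Fintype.equivFin β (g x)))
    fun m => ret fun v => Function.invFun (fun b => Fin.castLE h (Fintype.equivFin β b)) (m v)

theorem run_ask [Fintype β] [Nonempty β] (h : Fintype.card β ≤ M) (g : In → β) (x : Fin n → In) :
    (ask h g : Prot In n (Fin M) (Fin n → β)).run x = fun v => g (x v) := by
  have hinj : Function.Injective fun b : β => Fin.castLE h (Fintype.equivFin β b) :=
    (Fin.castLE_injective h).comp (Fintype.equivFin β).injective
  funext v
  exact Function.leftInverse_invFun hinj (g (x v))

theorem within_ask [Fintype β] [Nonempty β] (h : Fintype.card β ≤ M) (g : In → β) :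
    (ask h g : Prot In n (Fin M) (Fin n → β)).Within 1 :=
  fun _ => trivial

/-- Every node broadcasts `B` elements of a finite type. -/
noncomputable def askFun [Fintype β] [Nonempty β] (h : Fintype.card β ≤ M) :
    (B : ℕ) → (In → Fin B → β) → Prot In n (Fin M) (Fin n → Fin B → β)
  | 0, _ => ret fun _ => Fin.elim0
  | B + 1, g => (ask h fun x => g x 0).bind fun a =>
      (askFun h B fun x i => g x i.succ).bind fun b => ret fun v => Fin.cons (a v) (b v)

theorem run_askFun [Fintype β] [Nonempty β] (h : Fintype.card β ≤ M) (B : ℕ)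
    (g : In → Fin B → β) (x : Fin n → In) :
    (askFun h B g : Prot In n (Fin M) _).run x = fun v => g (x v) := by
  induction B with
  | zero => funext v i; exact i.elim0
  | succ B ih =>
    simp only [askFun, run_bind, run_ask, ih, run_ret]
    funext v i
    refine Fin.cases ?_ (fun i => ?_) i <;> simp

theorem within_askFun [Fintype β] [Nonempty β] (h : Fintype.card β ≤ M) (B : ℕ)
    (g : In → Fin B → β) : (askFun h B g : Prot In n (Fin M) _).Within B := by
  induction B with
  | zero => trivial
  | succ B ih =>
    refine Within.mono (R := 1 + (B + 0)) ?_ (by omega)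
    exact (within_ask h _).bind fun a => (ih _).bind fun b => within_ret _ _

open Classical in
/-- Every node broadcasts a set with at most `B` elements. -/
noncomputable def askSet [Fintype β] (h : Fintype.card (Option β) ≤ M) (B : ℕ)
    (g : In → Finset β) : Prot In n (Fin M) (Fin n → Finset β) :=
  (askFun h B fun x i => (g x).toList[i.1]?).bind fun f =>
    ret fun v => Finset.univ.filter fun b => ∃ i, f v i = some b

/-- Sets with fewer than `B` elements are padded by `none`, hence the alphabet `Option β`. -/
theorem run_askSet [Fintype β] (h : Fintype.card (Option β) ≤ M) (B : ℕ)
    (g : In → Finset β) (x : Fin n → In) (hB : ∀ v, (g (x v)).card ≤ B) :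
    (askSet h B g : Prot In n (Fin M) _).run x = fun v => g (x v) := by
  rw [askSet, run_bind, run_askFun, run_ret]
  funext v
  ext b
  simp only [Finset.mem_filter, Finset.mem_univ, true_and]
  rw [← Finset.mem_toList, List.mem_iff_getElem?]
  constructor
  · rintro ⟨i, hi⟩
    exact ⟨i, hi⟩
  · rintro ⟨i, hi⟩
    obtain ⟨hlt, -⟩ := List.getElem?_eq_some_iff.1 hi
    rw [Finset.length_toList] at hlt
    exact ⟨⟨i, hlt.trans_le (hB v)⟩, hi⟩

theorem within_askSet [Fintype β] (h : Fintype.card (Option β) ≤ M) (B : ℕ)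
    (g : In → Finset β) : (askSet h B g : Prot In n (Fin M) _).Within B :=
  (within_askFun h B _).bind (R' := 0) fun _ => trivial

/-- Iteration of a protocol that updates a public state. -/
def iter {Msg : Type} (f : ℕ → σ → Prot In n Msg σ) : ℕ → σ → Prot In n Msg σ
  | 0, a => ret a
  | t + 1, a => (iter f t a).bind (f t)

theorem within_iter {Msg : Type} {f : ℕ → σ → Prot In n Msg σ} {R : ℕ}
    (hf : ∀ t a, (f t a).Within R) (t : ℕ) (a : σ) : (iter f t a).Within (t * R) := by
  induction t with
  | zero => exact within_ret _ _
  | succ t ih =>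
    rw [Nat.add_mul, one_mul]
    exact ih.bind (hf t)

theorem run_iter_induction {Msg : Type} {f : ℕ → σ → Prot In n Msg σ} (x : Fin n → In)
    (I : ℕ → σ → Prop) {a : σ} (h0 : I 0 a) {T : ℕ}
    (hs : ∀ t < T, ∀ b, I t b → I (t + 1) ((f t b).run x)) :
    ∀ t ≤ T, I t ((iter f t a).run x) := by
  intro t ht
  induction t with
  | zero => exact h0
  | succ t ih =>
    simp only [iter, run_bind]
    exact hs t (by omega) _ (ih (by omega))

open Classical in
/-- Half of the elements of a finite set. -/
noncomputable def half (k : ℕ) (S : Finset Ω) : Finset Ω :=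
  if h : ∃ A ⊆ S, A.card = 2 ^ k then h.choose else S

theorem half_subset (k : ℕ) (S : Finset Ω) : half k S ⊆ S := by
  unfold half
  split_ifs with h
  exacts [h.choose_spec.1, subset_rfl]

theorem card_half {k : ℕ} {S : Finset Ω} (hS : S.card = 2 ^ (k + 1)) :
    (half k S).card = 2 ^ k := by
  have h : ∃ A ⊆ S, A.card = 2 ^ k :=
    Finset.exists_subset_card_eq (by rw [hS, pow_succ]; omega)
  unfold half
  rw [dif_pos h]
  exact h.choose_spec.2

open Classical in
/-- Search for an element of a set with `2 ^ k` elements whose total cost, summed over all nodes,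
is at most the average. -/
noncomputable def search [Nonempty Ω] {Bd : ℕ} (h : Fintype.card (Fin (Bd + 1)) ≤ M)
    (F : In → Ω → ℕ) : ℕ → Finset Ω → Prot In n (Fin M) Ω
  | 0, S => ret (if hS : S.Nonempty then hS.choose else Classical.arbitrary Ω)
  | k + 1, S =>
    (ask h fun x => Fin.ofNat (Bd + 1) (∑ ω ∈ half k S, F x ω)).bind fun a =>
    (ask h fun x => Fin.ofNat (Bd + 1) (∑ ω ∈ S \ half k S, F x ω)).bind fun b =>
    if ∑ v, (a v : ℕ) ≤ ∑ v, (b v : ℕ) then search h F k (half k S)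
      else search h F k (S \ half k S)

theorem within_search [Nonempty Ω] {Bd : ℕ} (h : Fintype.card (Fin (Bd + 1)) ≤ M)
    (F : In → Ω → ℕ) (k : ℕ) (S : Finset Ω) :
    (search h F k S : Prot In n (Fin M) Ω).Within (2 * k) := by
  induction k generalizing S with
  | zero => trivial
  | succ k ih =>
    have : 2 * (k + 1) = 1 + (1 + 2 * k) := by omega
    rw [this]
    refine (within_ask h _).bind fun a => (within_ask h _).bind fun b => ?_
    split_ifs
    exacts [ih _, ih _]

-- Conditional expectations: the costs of the two halves add up to the cost of `S`, so the cheaper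
-- half costs at most half as much. The bound `Bd` ensures that the announced residues modulo `Bd +
-- 1` are the true sums.
open Classical in
theorem run_search [Nonempty Ω] {Bd : ℕ} (h : Fintype.card (Fin (Bd + 1)) ≤ M)
    (F : In → Ω → ℕ) (x : Fin n → In) (k : ℕ) (S : Finset Ω) (hS : S.card = 2 ^ k)
    (hBd : ∀ v, ∑ ω ∈ S, F (x v) ω ≤ Bd) :
    2 ^ k * ∑ v, F (x v) ((search h F k S : Prot In n (Fin M) Ω).run x) ≤
      ∑ ω ∈ S, ∑ v, F (x v) ω := by
  induction k generalizing S with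
  | zero =>
    obtain ⟨ω, rfl⟩ := Finset.card_eq_one.1 hS
    have hne : ({ω} : Finset Ω).Nonempty := ⟨ω, by simp⟩
    have h1 : hne.choose = ω := by simpa using hne.choose_spec
    simp [search, h1]
  | succ k ih =>
    have hsub := half_subset k S
    have hA := card_half hS
    have hB : (S \ half k S).card = 2 ^ k := by
      rw [Finset.card_sdiff_of_subset hsub, hA, hS, pow_succ]; omega
    have hle : ∀ v, ∀ A ⊆ S, ∑ ω ∈ A, F (x v) ω ≤ Bd := fun v A hAS =>
      (Finset.sum_le_sum_of_subset hAS).trans (hBd v)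
    have hmod : ∀ v, ∀ A ⊆ S, (∑ ω ∈ A, F (x v) ω) % (Bd + 1) = ∑ ω ∈ A, F (x v) ω :=
      fun v A hAS => Nat.mod_eq_of_lt (Nat.lt_succ_of_le (hle v A hAS))
    have hsum := Finset.sum_sdiff (f := fun ω => ∑ v, F (x v) ω) hsub
    have iA := ih (half k S) hA fun v => hle v _ hsub
    have iB := ih (S \ half k S) hB fun v => hle v _ Finset.sdiff_subset
    simp only [search, run_bind, run_ask, Fin.val_ofNat, hmod _ _ hsub,
      hmod _ _ Finset.sdiff_subset]
    rw [Finset.sum_comm (t := half k S), Finset.sum_comm (t := S \ half k S)]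
    rw [pow_succ]
    split_ifs with hc
    · nlinarith
    · nlinarith

end Prot

end BroadcastCongestedClique

/-! ### Deterministic clustering into groups of small diameter. -/

namespace BroadcastCongestedClique

/-- Counting: a subset of `S` missing `A j` lies in `S \ A j`, so for each `j` at most a fraction `2
^ (-K)` of all subsets is bad. By `hK` fewer than half are bad in total. Hence for some `T` both `T`
and `S \ T` hit everything, and the smaller of the two is taken. -/
theorem exists_small_hitting_set {ι V : Type*} [Fintype ι] [DecidableEq V] (S : Finset V)
    (p : ι → Prop) (A : ι → Finset V) {K : ℕ} (hK : 2 * Fintype.card ι < 2 ^ K)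
    (hA : ∀ j, p j → A j ⊆ S) (hc : ∀ j, p j → K ≤ (A j).card) :
    ∃ T ⊆ S, 2 * T.card ≤ S.card ∧ ∀ j, p j → ∃ c ∈ A j, c ∈ T := by
  classical
  let bad : Finset (Finset V) := (Finset.univ.filter p).biUnion fun j => (S \ A j).powerset
  have hbad : bad.card * 2 ^ K ≤ Fintype.card ι * 2 ^ S.card := by
    have h1 : bad.card ≤ ∑ j ∈ Finset.univ.filter p, (S \ A j).powerset.card :=
      Finset.card_biUnion_le
    have h2 : ∀ j ∈ Finset.univ.filter p, (S \ A j).powerset.card * 2 ^ K ≤ 2 ^ S.card := by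
      intro j hj
      have hj : p j := by simpa using hj
      rw [Finset.card_powerset, ← pow_add]
      refine Nat.pow_le_pow_right (by norm_num) ?_
      have := Finset.card_sdiff_add_card_eq_card (hA j hj)
      have := hc j hj
      omega
    calc bad.card * 2 ^ K ≤ (∑ j ∈ Finset.univ.filter p, (S \ A j).powerset.card) * 2 ^ K :=
          Nat.mul_le_mul_right _ h1
      _ = ∑ j ∈ Finset.univ.filter p, (S \ A j).powerset.card * 2 ^ K := Finset.sum_mul ..
      _ ≤ ∑ j ∈ Finset.univ.filter p, 2 ^ S.card := Finset.sum_le_sum h2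
      _ ≤ Fintype.card ι * 2 ^ S.card := by
          rw [Finset.sum_const, smul_eq_mul]
          exact Nat.mul_le_mul_right _ (Finset.card_le_univ _)
  -- Sets that are bad themselves or have a bad complement still do not exhaust the power set.
  have hlt : (bad ∪ bad.image fun T => S \ T).card < S.powerset.card := by
    rw [Finset.card_powerset]
    have h1 : (bad ∪ bad.image fun T => S \ T).card ≤ bad.card + bad.card :=
      (Finset.card_union_le _ _).trans (Nat.add_le_add_left Finset.card_image_le _)
    have h2 : 0 < 2 ^ S.card := by positivity
    by_contra hcon
    push Not at hcon
    nlinarith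
  obtain ⟨T, hT, hTn⟩ := Finset.exists_mem_notMem_of_card_lt_card hlt
  rw [Finset.mem_powerset] at hT
  rw [Finset.mem_union, not_or] at hTn
  have hhit : ∀ j, p j → ∃ c ∈ A j, c ∈ T := by
    intro j hj
    by_contra! hcon
    refine hTn.1 (Finset.mem_biUnion.2 ⟨j, by simpa using hj, ?_⟩)
    rw [Finset.mem_powerset]
    exact fun c hcT => Finset.mem_sdiff.2 ⟨hT hcT, fun h => hcon c h hcT⟩
  have hhit' : ∀ j, p j → ∃ c ∈ A j, c ∈ S \ T := by
    intro j hj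
    by_contra! hcon
    refine hTn.2 (Finset.mem_image.2 ⟨S \ T, Finset.mem_biUnion.2 ⟨j, by simpa using hj, ?_⟩, ?_⟩)
    · rw [Finset.mem_powerset]
      exact fun c hcT => Finset.mem_sdiff.2 ⟨(Finset.mem_sdiff.1 hcT).1, fun h => hcon c h hcT⟩
    · exact Finset.sdiff_sdiff_eq_self hT
  have hcard := Finset.card_sdiff_add_card_eq_card hT
  by_cases h : 2 * T.card ≤ S.card
  · exact ⟨T, hT, h, hhit⟩
  · exact ⟨S \ T, Finset.sdiff_subset, by omega, hhit'⟩

/-- A set of at most `K` elements of `A` on which `f` is injective, and which meets all fibres of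
`f` in `A` unless it has `K` elements. -/
theorem exists_representatives {V V' : Type*} [DecidableEq V'] (A : Finset V) (f : V → V')
    (K : ℕ) :
    ∃ P ⊆ A, Set.InjOn f P ∧ P.card ≤ K ∧ (P.card < K → ∀ u ∈ A, ∃ u' ∈ P, f u' = f u) := by
  classical
  obtain ⟨T, hTA, hT, hinj⟩ : ∃ T ⊆ A, T.image f = A.image f ∧ Set.InjOn f T := by
    have hs : Set.SurjOn f A (A.image f) := fun y hy => by simpa using hy
    obtain ⟨T, h1, h2, h3⟩ := Finset.exists_subset_injOn_image_eq_of_surjOn (A : Set V) (A.image f) hs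
    exact ⟨T, by exact_mod_cast h1, h3, h2⟩
  by_cases h : T.card ≤ K
  · refine ⟨T, hTA, hinj, h, fun _ u hu => ?_⟩
    have : f u ∈ T.image f := hT ▸ Finset.mem_image_of_mem f hu
    simpa using this
  · obtain ⟨P, hP, hc⟩ := Finset.exists_subset_card_eq (s := T) (n := K) (by omega)
    exact ⟨P, hP.trans hTA, hinj.mono (by exact_mod_cast hP), hc.le, fun h => by omega⟩

/-- The private input of node `v`: its number and its row in the matrix of edge classes. -/
abbrev RowInput (n L : ℕ) : Type := Fin n × (Fin n → Fin L)

/-- `z` is Lipschitz with respect to a set of edges; an edge of class `i` has length `W i`. -/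
def LipOn {n L : ℕ} (W : Fin L → ℝ) (E : Set (Fin n × Fin n × Fin L)) (z : Fin n → ℝ) : Prop :=
  ∀ a b i, (a, b, i) ∈ E → |z b - z a| ≤ W i

theorem LipOn.mono {n L : ℕ} {W : Fin L → ℝ} {E E' : Set (Fin n × Fin n × Fin L)}
    {z : Fin n → ℝ} (h : LipOn W E' z) (hE : E ⊆ E') : LipOn W E z :=
  fun a b i hab => h a b i (hE hab)

/-- A partition of all pairs into groups of small diameter: the pair `(u, v)` of class `i` belongs
to the group `(i, g i u v)`, and is close to the node `g i u v` with respect to the edges `E`. -/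
structure IsDecomposition {n L : ℕ} (cls : Fin n → Fin n → Fin L) (W : Fin L → ℝ) (D B : ℕ)
    (E : Set (Fin n × Fin n × Fin L)) (g : Fin L → Fin n → Fin n → Fin n) : Prop where
  cls_eq : ∀ a b i, (a, b, i) ∈ E → cls a b = i
  symm : ∀ u v, g (cls u v) u v = g (cls u v) v u
  dist_le : ∀ z, LipOn W E z → ∀ u v, |z u - z (g (cls u v) u v)| ≤ D * W (cls u v)
  card_le : ∀ v i, ((Finset.univ.filter fun u => cls v u = i).image (g i v)).card ≤ B

/-- Public state of the clustering procedure: cluster centres of the nodes, the possible centres,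
the known edges and the groups. -/
structure Clustering (n L : ℕ) where
  C : Fin L → Fin n → Option (Fin n)
  S : Fin L → Finset (Fin n)
  E : Set (Fin n × Fin n × Fin L)
  g : Fin L → Fin n → Fin n → Option (Fin n)

namespace Clustering

variable {n L : ℕ}

/-- Every node is a cluster. -/
def initial (n L : ℕ) : Clustering n L where
  C := fun _ v => some v
  S := fun _ => Finset.univ
  E := ∅
  g := fun _ _ _ => none

open Classical in
/-- The clustered neighbours of a node in class `i`. -/
noncomputable def clusteredNeighbors (st : Clustering n L) (row : Fin n → Fin L) (i : Fin L) :
    Finset (Fin n) :=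
  Finset.univ.filter fun u => row u = i ∧ st.C i u ≠ none

/-- The representatives of adjacent clusters that a node announces. -/
noncomputable def pick (K : ℕ) (st : Clustering n L) (row : Fin n → Fin L) (i : Fin L) :
    Finset (Fin n) :=
  (exists_representatives (st.clusteredNeighbors row i) (st.C i) K).choose

theorem pick_spec (K : ℕ) (st : Clustering n L) (row : Fin n → Fin L) (i : Fin L) :
    (∀ u ∈ st.pick K row i, row u = i ∧ st.C i u ≠ none) ∧ Set.InjOn (st.C i) (st.pick K row i) ∧
      (st.pick K row i).card ≤ K ∧ ((st.pick K row i).card < K →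
        ∀ u, row u = i → st.C i u ≠ none → ∃ u' ∈ st.pick K row i, st.C i u' = st.C i u) := by
  obtain ⟨h1, h2, h3, h4⟩ :=
    (exists_representatives (st.clusteredNeighbors row i) (st.C i) K).choose_spec
  refine ⟨fun u hu => by simpa [clusteredNeighbors] using h1 hu, h2, h3, fun h u hu hu' => ?_⟩
  exact h4 h u (by simp [clusteredNeighbors, hu, hu'])

open Classical in
/-- The announcement of a node. -/
noncomputable def announce (K : ℕ) (st : Clustering n L) (x : RowInput n L) :
    Finset (Fin n × Fin L) :=
  Finset.univ.filter fun p => p.1 ∈ st.pick K x.2 p.2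

theorem card_announce_le (K : ℕ) (st : Clustering n L) (x : RowInput n L) :
    (st.announce K x).card ≤ L * K := by
  classical
  have : st.announce K x ⊆ (Finset.univ : Finset (Fin L)).biUnion fun i =>
      (st.pick K x.2 i).image fun u => (u, i) := by
    rintro ⟨u, i⟩ h
    simp only [announce, Finset.mem_filter, Finset.mem_univ, true_and] at h
    simp only [Finset.mem_biUnion, Finset.mem_univ, true_and, Finset.mem_image]
    exact ⟨i, u, h, rfl⟩
  refine (Finset.card_le_card this).trans (Finset.card_biUnion_le.trans ?_)
  refine (Finset.sum_le_card_nsmul _ _ K fun i _ => ?_).trans (by simp)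
  exact Finset.card_image_le.trans (st.pick_spec K x.2 i).2.2.1

section Step

open Classical

variable (K : ℕ) (st : Clustering n L) (R : Fin n → Finset (Fin n × Fin L))

/-- The representatives announced by `v` in class `i`. -/
noncomputable def announced (i : Fin L) (v : Fin n) : Finset (Fin n) :=
  Finset.univ.filter fun u => (u, i) ∈ R v

/-- The centres of the clusters announced by `v` in class `i`. -/
noncomputable def announcedCenters (i : Fin L) (v : Fin n) : Finset (Fin n) :=
  Finset.univ.filter fun c => ∃ u, (u, i) ∈ R v ∧ st.C i u = some c

/-- The node stays clustered. -/
def Survives (i : Fin L) (v : Fin n) : Prop :=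
  st.C i v ≠ none ∧ K ≤ (announced R i v).card

/-- The remaining centres. -/
noncomputable def nextCenters (i : Fin L) : Finset (Fin n) :=
  if h : ∃ T ⊆ st.S i, 2 * T.card ≤ (st.S i).card ∧
      ∀ v, st.Survives K R i v → ∃ c ∈ st.announcedCenters R i v, c ∈ T
  then h.choose else ∅

/-- The public state after all nodes have announced their representatives. -/
noncomputable def next : Clustering n L where
  C := fun i v =>
    if h : st.Survives K R i v ∧ ∃ c ∈ st.announcedCenters R i v, c ∈ st.nextCenters K R i then
      some h.2.choose else none
  S := st.nextCenters K R
  E := st.E ∪ {p | (p.2.1, p.2.2) ∈ R p.1}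
  g := fun i u v =>
    if st.C i u = none ∨ st.C i v = none ∨ (st.Survives K R i u ∧ st.Survives K R i v) then
      st.g i u v
    else if ¬ st.Survives K R i v ∧ (st.Survives K R i u ∨ v ≤ u) then st.C i u
    else st.C i v

end Step

/-- The centres of the groups of class `i` at `v`. -/
noncomputable def groupsAt (st : Clustering n L) (cls : Fin n → Fin n → Fin L) (i : Fin L)
    (v : Fin n) : Finset (Fin n) :=
  open Classical in Finset.univ.filter fun c => ∃ u, cls v u = i ∧ st.g i v u = some c

theorem mem_groupsAt {st : Clustering n L} {cls : Fin n → Fin n → Fin L} {i : Fin L}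
    {v c : Fin n} : c ∈ st.groupsAt cls i v ↔ ∃ u, cls v u = i ∧ st.g i v u = some c := by
  simp [groupsAt]

/-- The invariant of the clustering procedure after `ℓ` steps. -/
structure Valid (cls : Fin n → Fin n → Fin L) (W : Fin L → ℝ) (K ℓ : ℕ) (st : Clustering n L) :
    Prop where
  cls_eq : ∀ a b i, (a, b, i) ∈ st.E → cls a b = i
  card_S : ∀ i, 2 ^ ℓ * (st.S i).card ≤ n
  mem_S : ∀ i v c, st.C i v = some c → c ∈ st.S i
  dist_C : ∀ i v c, st.C i v = some c → ∀ z, LipOn W st.E z → |z v - z c| ≤ ℓ * W i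
  group : ∀ u v, (st.C (cls u v) u = none ∨ st.C (cls u v) v = none) →
    ∃ c, st.g (cls u v) u v = some c ∧ ∀ z, LipOn W st.E z →
      |z u - z c| ≤ ℓ * W (cls u v) ∧ |z v - z c| ≤ ℓ * W (cls u v)
  symm : ∀ i u v, st.g i u v = st.g i v u
  card_g : ∀ i v, (st.groupsAt cls i v).card ≤ (K + 1) * ℓ

theorem valid_initial (cls : Fin n → Fin n → Fin L) (W : Fin L → ℝ) (K : ℕ) :
    (initial n L).Valid cls W K 0 where
  cls_eq := fun _ _ _ h => h.elim
  card_S := fun i => by simp [initial]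
  mem_S := fun i v c _ => by simp [initial]
  dist_C := fun i v c h z _ => by
    obtain rfl : v = c := by simpa [initial] using h
    simp
  group := fun u v h => by simp [initial] at h
  symm := fun _ _ _ => rfl
  card_g := fun i v => by simp [groupsAt, initial]

section Step

variable {cls : Fin n → Fin n → Fin L} {W : Fin L → ℝ} {K ℓ : ℕ} {st : Clustering n L}
  {R : Fin n → Finset (Fin n × Fin L)}

theorem mem_announce (v u : Fin n) (i : Fin L) :
    (u, i) ∈ st.announce K (v, cls v) ↔ u ∈ st.pick K (cls v) i := by
  simp [announce]

/-- Representatives announced by one node lie in distinct clusters, so a surviving node sees at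
least `K` centres and `exists_small_hitting_set` applies. All nodes compute the same set from public
data. -/
theorem nextCenters_spec (hst : st.Valid cls W K ℓ) (hK : 2 * n < 2 ^ K)
    (hR : ∀ v, R v = st.announce K (v, cls v)) (i : Fin L) :
    st.nextCenters K R i ⊆ st.S i ∧ 2 * (st.nextCenters K R i).card ≤ (st.S i).card ∧
      ∀ v, st.Survives K R i v → ∃ c ∈ st.announcedCenters R i v, c ∈ st.nextCenters K R i := by
  classical
  have h : ∃ T ⊆ st.S i, 2 * T.card ≤ (st.S i).card ∧
      ∀ v, st.Survives K R i v → ∃ c ∈ st.announcedCenters R i v, c ∈ T := by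
    refine exists_small_hitting_set (K := K) (st.S i) _ _ (by simpa using hK) ?_ ?_
    · intro v _ c hc
      simp only [announcedCenters, Finset.mem_filter, Finset.mem_univ, true_and] at hc
      obtain ⟨u, -, hu⟩ := hc
      exact hst.mem_S i u c hu
    · intro v hv
      refine hv.2.trans ?_
      have hann : announced R i v = st.pick K (cls v) i := by
        ext u; simp [announced, hR, mem_announce]
      obtain ⟨h1, h2, -, -⟩ := st.pick_spec K (cls v) i
      rw [← hann] at h1 h2
      rw [← Finset.card_image_of_injOn h2,
        ← Finset.card_image_of_injective (st.announcedCenters R i v) (Option.some_injective _)]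
      refine Finset.card_le_card fun o ho => ?_
      obtain ⟨u, hu, rfl⟩ := Finset.mem_image.1 ho
      obtain ⟨c, hc⟩ := Option.ne_none_iff_exists'.1 (h1 u hu).2
      simp only [announced, Finset.mem_filter, Finset.mem_univ, true_and] at hu
      refine Finset.mem_image.2 ⟨c, ?_, hc.symm⟩
      simp only [announcedCenters, Finset.mem_filter, Finset.mem_univ, true_and]
      exact ⟨u, hu, hc⟩
  unfold nextCenters
  rw [dif_pos h]
  exact h.choose_spec

theorem next_C_spec {i : Fin L} {v c : Fin n} (h : (st.next K R).C i v = some c) :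
    (∃ u, (u, i) ∈ R v ∧ st.C i u = some c) ∧ c ∈ st.nextCenters K R i ∧
      st.Survives K R i v := by
  classical
  simp only [next] at h
  split_ifs at h with h1
  obtain rfl := Option.some.inj h
  have := h1.2.choose_spec
  refine ⟨?_, this.2, h1.1⟩
  simpa [announcedCenters] using this.1

theorem not_survives_of_next_C (hst : st.Valid cls W K ℓ) (hK : 2 * n < 2 ^ K)
    (hR : ∀ v, R v = st.announce K (v, cls v)) {i : Fin L} {v : Fin n}
    (h : (st.next K R).C i v = none) : ¬ st.Survives K R i v := by
  classical
  intro hs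
  simp only [next] at h
  rw [dif_pos ⟨hs, (nextCenters_spec hst hK hR i).2.2 v hs⟩] at h
  cases h

/-- A node leaving the clustering has announced fewer than `K` representatives, so its list of
adjacent clusters is complete. This is what allows all its remaining pairs to be grouped at once. -/
theorem exists_announced_of_not_survives (hR : ∀ v, R v = st.announce K (v, cls v)) {i : Fin L}
    {v : Fin n} (hv : st.C i v ≠ none) (h : ¬ st.Survives K R i v) :
    (announced R i v).card < K ∧
      ∀ u, cls v u = i → st.C i u ≠ none → ∃ u' ∈ announced R i v, st.C i u' = st.C i u := by
  classical
  have hlt : (announced R i v).card < K := by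
    by_contra hc
    exact h ⟨hv, not_lt.1 hc⟩
  have hann : announced R i v = st.pick K (cls v) i := by
    ext u; simp [announced, hR, mem_announce]
  refine ⟨hlt, ?_⟩
  rw [hann] at hlt ⊢
  exact (st.pick_spec K (cls v) i).2.2.2 hlt

theorem next_E_subset : st.E ⊆ (st.next K R).E := Set.subset_union_left

theorem lipOn_next {z : Fin n → ℝ} (hz : LipOn W (st.next K R).E z) {u v : Fin n} {i : Fin L}
    (h : (u, i) ∈ R v) : |z u - z v| ≤ W i :=
  hz v u i (Or.inr h)

/-- The leaving node `v` has announced an edge to some `u'` in the cluster of `u`. One edge and one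
cluster radius lead from `v` to the centre, whence `ℓ + 1`. -/
theorem dist_of_not_survives (hst : st.Valid cls W K ℓ)
    (hR : ∀ v, R v = st.announce K (v, cls v)) {u v : Fin n} {i : Fin L} (hi : cls v u = i)
    (hW : 0 ≤ W i) (hv : st.C i v ≠ none) (hu : st.C i u ≠ none)
    (h : ¬ st.Survives K R i v) :
    ∃ c, st.C i u = some c ∧ ∀ z, LipOn W (st.next K R).E z →
      |z u - z c| ≤ (ℓ + 1 : ℕ) * W i ∧ |z v - z c| ≤ (ℓ + 1 : ℕ) * W i := by
  obtain ⟨c, hc⟩ := Option.ne_none_iff_exists'.1 hu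
  refine ⟨c, hc, fun z hz => ?_⟩
  obtain ⟨u', hu', hu'c⟩ := (exists_announced_of_not_survives hR hv h).2 u hi hu
  simp only [announced, Finset.mem_filter, Finset.mem_univ, true_and] at hu'
  have h1 := hst.dist_C i u c hc z (hz.mono next_E_subset)
  have h2 := hst.dist_C i u' c (hu'c.trans hc) z (hz.mono next_E_subset)
  have h3 := lipOn_next hz hu'
  push_cast
  rw [abs_le] at h1 h2 h3
  constructor <;> rw [abs_le] <;> constructor <;>
    linarith [h1.1, h1.2, h2.1, h2.2, h3.1, h3.2]

theorem valid_next (hst : st.Valid cls W K ℓ) (hW : ∀ i, 0 ≤ W i)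
    (hcls : ∀ u v, cls u v = cls v u) (hK : 2 * n < 2 ^ K)
    (hR : ∀ v, R v = st.announce K (v, cls v)) : (st.next K R).Valid cls W K (ℓ + 1) := by
  classical
  refine ⟨?_, ?_, ?_, ?_, ?_, ?_, ?_⟩
  · rintro a b i (h | h)
    · exact hst.cls_eq a b i h
    · change (b, i) ∈ R a at h
      rw [hR, mem_announce] at h
      exact ((st.pick_spec K (cls a) i).1 b h).1
  · intro i
    have h1 := (nextCenters_spec hst hK hR i).2.1
    have h2 := hst.card_S i
    calc 2 ^ (ℓ + 1) * (st.nextCenters K R i).card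
        = 2 ^ ℓ * (2 * (st.nextCenters K R i).card) := by ring
      _ ≤ 2 ^ ℓ * (st.S i).card := Nat.mul_le_mul_left _ h1
      _ ≤ n := h2
  · intro i v c h
    exact (next_C_spec h).2.1
  -- A surviving node joins a remaining cluster through an announced edge, which increases the
  -- radius by one edge.
  · intro i v c h z hz
    obtain ⟨⟨u, hu, huc⟩, -, -⟩ := next_C_spec h
    have h1 := hst.dist_C i u c huc z (hz.mono next_E_subset)
    have h2 := lipOn_next hz hu
    push_cast
    rw [abs_le] at *
    constructor <;> linarith [h1.1, h1.2, h2.1, h2.2]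
  -- A pair is grouped in the step in which its first endpoint leaves; the group centre is the
  -- cluster centre of the other endpoint. If both leave at once, the order of the nodes decides.
  · intro u v h
    set i := cls u v with hi
    by_cases hold : st.C i u = none ∨ st.C i v = none
    · obtain ⟨c, hc, hd⟩ := hst.group u v hold
      refine ⟨c, ?_, fun z hz => ?_⟩
      · simp only [next]
        rw [if_pos (by tauto)]
        exact hc
      · have := hd z (hz.mono next_E_subset)
        have := hW i
        push_cast
        constructor <;> linarith
    · push Not at hold
      have hns : ¬ (st.Survives K R i u ∧ st.Survives K R i v) := by
        rintro ⟨h1, h2⟩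
        rcases h with h | h
        · exact not_survives_of_next_C hst hK hR h h1
        · exact not_survives_of_next_C hst hK hR h h2
      simp only [next]
      rw [if_neg (by tauto)]
      by_cases hc : ¬ st.Survives K R i v ∧ (st.Survives K R i u ∨ v ≤ u)
      · rw [if_pos hc]
        exact dist_of_not_survives hst hR ((hcls v u).trans hi.symm) (hW i) hold.2 hold.1 hc.1
      · rw [if_neg hc]
        have hu : ¬ st.Survives K R i u := by
          intro hu
          exact hns ⟨hu, by tauto⟩
        obtain ⟨c, h1, h2⟩ := dist_of_not_survives hst hR hi.symm (hW i) hold.1 hold.2 hu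
        exact ⟨c, h1, fun z hz => (h2 z hz).symm⟩
  · intro i u v
    simp only [next, hst.symm i u v]
    by_cases huv : u = v
    · subst huv; rfl
    · have : v ≤ u ↔ ¬ u ≤ v := by
        rw [not_le]; exact ⟨fun h => lt_of_le_of_ne h (Ne.symm huv), le_of_lt⟩
      grind
  · intro i v
    -- New groups at `v` are centred at its own cluster (the other endpoint leaves) or, if `v`
    -- leaves, at one of the fewer than `K` announced clusters. This is the summand `K + 1` per
    -- step.
    have hsub : (st.next K R).groupsAt cls i v ⊆ st.groupsAt cls i v ∪
        ((Finset.univ.filter fun c => st.C i v = some c) ∪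
          (Finset.univ.filter fun c => (st.C i v ≠ none ∧ ¬ st.Survives K R i v) ∧
            ∃ u ∈ announced R i v, st.C i u = some c)) := by
      intro c hc
      simp only [mem_groupsAt, next] at hc
      obtain ⟨u, hu, hc⟩ := hc
      simp only [mem_groupsAt, Finset.mem_union, Finset.mem_filter, Finset.mem_univ, true_and]
      split_ifs at hc with h1 h2
      · exact Or.inl ⟨u, hu, hc⟩
      · exact Or.inr (Or.inl hc)
      · have h3 : ¬ st.Survives K R i v := by tauto
        push Not at h1
        obtain ⟨u', hu', hu'c⟩ := (exists_announced_of_not_survives hR h1.1 h3).2 u hu h1.2.1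
        exact Or.inr (Or.inr ⟨⟨h1.1, h3⟩, u', hu', hu'c.trans hc⟩)
    have h1 : (Finset.univ.filter fun c => st.C i v = some c).card ≤ 1 := by
      rw [Finset.card_le_one]
      intro a ha b hb
      simp only [Finset.mem_filter, Finset.mem_univ, true_and] at ha hb
      exact Option.some.inj (ha.symm.trans hb)
    have h2 : (Finset.univ.filter fun c => (st.C i v ≠ none ∧ ¬ st.Survives K R i v) ∧
            ∃ u ∈ announced R i v, st.C i u = some c).card ≤ K := by
      by_cases h : st.C i v ≠ none ∧ ¬ st.Survives K R i v
      · refine le_trans ?_ (exists_announced_of_not_survives hR h.1 h.2).1.le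
        rw [← Finset.card_image_of_injective _ (Option.some_injective (Fin n))]
        refine (Finset.card_le_card ?_).trans (Finset.card_image_le (f := st.C i))
        intro o ho
        simp only [Finset.mem_image, Finset.mem_filter, Finset.mem_univ, true_and] at ho ⊢
        obtain ⟨c, ⟨-, u, hu, huc⟩, rfl⟩ := ho
        exact ⟨u, hu, huc⟩
      · rw [Finset.filter_false_of_mem fun c _ hc => h hc.1]
        simp
    have h3 := hst.card_g i v
    have h4 := Finset.card_le_card hsub
    have h5 := Finset.card_union_le (st.groupsAt cls i v)
      ((Finset.univ.filter fun c => st.C i v = some c) ∪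
          (Finset.univ.filter fun c => (st.C i v ≠ none ∧ ¬ st.Survives K R i v) ∧
            ∃ u ∈ announced R i v, st.C i u = some c))
    have h6 := Finset.card_union_le (Finset.univ.filter fun c => st.C i v = some c)
          (Finset.univ.filter fun c => (st.C i v ≠ none ∧ ¬ st.Survives K R i v) ∧
            ∃ u ∈ announced R i v, st.C i u = some c)
    rw [Nat.mul_succ]
    omega

end Step

/-- The clustering procedure with `T` steps. -/
noncomputable def protocol {M : ℕ} (h : Fintype.card (Option (Fin n × Fin L)) ≤ M) (K T : ℕ) :
    Prot (RowInput n L) n (Fin M) (Clustering n L) :=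
  Prot.iter (fun _ st => (Prot.askSet h (L * K) (st.announce K)).bind fun R =>
    Prot.ret (st.next K R)) T (initial n L)

theorem within_protocol {M : ℕ} (h : Fintype.card (Option (Fin n × Fin L)) ≤ M) (K T : ℕ) :
    (protocol h K T).Within (T * (L * K)) :=
  Prot.within_iter (R := L * K + 0) (fun _ st =>
    (Prot.within_askSet h (L * K) (announce K st)).bind fun _ => Prot.within_ret _ _) T _

theorem valid_run_protocol {M : ℕ} (h : Fintype.card (Option (Fin n × Fin L)) ≤ M) (K T : ℕ)
    {cls : Fin n → Fin n → Fin L} {W : Fin L → ℝ} (hW : ∀ i, 0 ≤ W i)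
    (hcls : ∀ u v, cls u v = cls v u) (hK : 2 * n < 2 ^ K) :
    ((protocol h K T).run fun v => (v, cls v)).Valid cls W K T := by
  refine Prot.run_iter_induction (fun v => (v, cls v)) (fun t st => Valid cls W K t st)
    (valid_initial cls W K) (fun t _ st hst => ?_) T le_rfl
  rw [Prot.run_bind, Prot.run_askSet h (L * K) (st.announce K) _
    fun v => card_announce_le K st _]
  exact valid_next hst hW hcls hK fun v => rfl

/-- The centres are halved in every step, so none is left once `n < 2 ^ ℓ`. Then no node is
clustered and every pair has received a group. -/
theorem Valid.isDecomposition {cls : Fin n → Fin n → Fin L} {W : Fin L → ℝ} {K ℓ : ℕ}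
    {st : Clustering n L} (hst : st.Valid cls W K ℓ)
    (hℓ : n < 2 ^ ℓ) :
    IsDecomposition cls W ℓ ((K + 1) * ℓ) st.E fun i u v => (st.g i u v).getD u := by
  have hS : ∀ i, st.S i = ∅ := by
    intro i
    rw [← Finset.card_eq_zero]
    have := hst.card_S i
    by_contra hne
    have : 2 ^ ℓ * 1 ≤ 2 ^ ℓ * (st.S i).card := Nat.mul_le_mul_left _ (by omega)
    omega
  have hC : ∀ i v, st.C i v = none := by
    intro i v
    rw [Option.eq_none_iff_forall_not_mem]
    intro c hc
    have := hst.mem_S i v c hc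
    simp [hS] at this
  have hg : ∀ u v, ∃ c, st.g (cls u v) u v = some c ∧ ∀ z, LipOn W st.E z →
      |z u - z c| ≤ ℓ * W (cls u v) ∧ |z v - z c| ≤ ℓ * W (cls u v) :=
    fun u v => hst.group u v (Or.inl (hC _ _))
  refine ⟨hst.cls_eq, ?_, ?_, ?_⟩
  · intro u v
    obtain ⟨c, hc, -⟩ := hg u v
    have hc' := hc
    rw [hst.symm] at hc'
    simp only [hc, hc', Option.getD_some]
  · intro z hz u v
    obtain ⟨c, hc, hd⟩ := hg u v
    simp only [hc, Option.getD_some]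
    exact (hd z hz).1
  · intro v i
    refine le_trans (Finset.card_le_card fun c hc => ?_) (hst.card_g i v)
    simp only [Finset.mem_image, Finset.mem_filter, Finset.mem_univ, true_and] at hc
    obtain ⟨u, rfl, rfl⟩ := hc
    obtain ⟨c, hc, -⟩ := hg v u
    simp only [groupsAt, Finset.mem_filter, Finset.mem_univ, true_and]
    exact ⟨u, rfl, by simp [hc]⟩

end Clustering

end BroadcastCongestedClique

/-! ### Second moments of pairwise independent samples. -/

namespace BroadcastCongestedClique

/-- The random variables `ζ e`, on the uniform probability space `Ω`, are pairwise independent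
and equal to `1` with probability `p e`, otherwise `0`. -/
structure PairwiseSample {Ω A : Type*} [Fintype Ω] (ζ : Ω → A → ℝ) (p : A → ℝ) : Prop where
  zero_or_one : ∀ ω e, ζ ω e = 0 ∨ ζ ω e = 1
  mean : ∀ e, ∑ ω, ζ ω e = Fintype.card Ω * p e
  pair : ∀ e e', e ≠ e' → ∑ ω, ζ ω e * ζ ω e' = Fintype.card Ω * (p e * p e')

namespace PairwiseSample

variable {Ω A : Type*} [Fintype Ω] {ζ : Ω → A → ℝ} {p : A → ℝ}

theorem nonneg (h : PairwiseSample ζ p) (ω : Ω) (e : A) : 0 ≤ ζ ω e := by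
  rcases h.zero_or_one ω e with h | h <;> simp [h]

/-- Variance of a weighted sum: mixed terms vanish by pairwise independence. -/
theorem sum_sq (h : PairwiseSample ζ p) (S : Finset A) (c : A → ℝ) :
    ∑ ω, (∑ e ∈ S, c e * (ζ ω e - p e)) ^ 2 =
      Fintype.card Ω * ∑ e ∈ S, c e ^ 2 * (p e * (1 - p e)) := by
  classical
  have h1 : ∀ ω, (∑ e ∈ S, c e * (ζ ω e - p e)) ^ 2 =
      ∑ e ∈ S, ∑ e' ∈ S, c e * c e' * ((ζ ω e - p e) * (ζ ω e' - p e')) := by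
    intro ω
    rw [sq, Finset.sum_mul_sum]
    exact Finset.sum_congr rfl fun e _ => Finset.sum_congr rfl fun e' _ => by ring
  have h2 : ∀ e e', ∑ ω, (ζ ω e - p e) * (ζ ω e' - p e') =
      if e = e' then Fintype.card Ω * (p e * (1 - p e)) else 0 := by
    intro e e'
    have h3 : ∑ ω, (ζ ω e - p e) * (ζ ω e' - p e') =
        ∑ ω, ζ ω e * ζ ω e' - p e' * ∑ ω, ζ ω e - p e * ∑ ω, ζ ω e' +
          Fintype.card Ω * (p e * p e') := by
      rw [Finset.mul_sum, Finset.mul_sum, ← Finset.sum_sub_distrib, ← Finset.sum_sub_distrib,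
        ← nsmul_eq_mul, ← Finset.card_univ, ← Finset.sum_const, ← Finset.sum_add_distrib]
      exact Finset.sum_congr rfl fun ω _ => by ring
    rw [h3, h.mean, h.mean]
    split_ifs with hee
    · subst hee
      have h4 : ∑ ω, ζ ω e * ζ ω e = ∑ ω, ζ ω e := Finset.sum_congr rfl fun ω _ => by
        rcases h.zero_or_one ω e with h | h <;> simp [h]
      rw [h4, h.mean]; ring
    · rw [h.pair e e' hee]; ring
  simp only [h1]
  rw [Finset.sum_comm, Finset.mul_sum]
  refine Finset.sum_congr rfl fun e he => ?_
  rw [Finset.sum_comm]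
  simp only [← Finset.mul_sum, h2, mul_ite, mul_zero, Finset.sum_ite_eq, he, if_true]
  ring

/-- An element with `p e < 1` has estimate at most `2 * m / r` when sampled, so the variance is at
most `2 * m ^ 2 / r`. Elements with `p e = 1` contribute no error. The condition on `r * θ ^ 2`
makes the standard deviation at most `θ * m`. -/
theorem sum_abs_le (h : PairwiseSample ζ p) (S : Finset A) {x : A → ℝ} {m r θ : ℝ}
    (hm : 0 < m) (hr : 0 < r) (hθ : 0 < θ) (hrθ : 2 ≤ r * θ ^ 2) (hp : ∀ e ∈ S, 0 < p e)
    (hx : ∀ e ∈ S, 0 ≤ x e) (hxm : ∑ e ∈ S, x e ≤ m)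
    (hxp : ∀ e ∈ S, p e = 1 ∨ x e ≤ p e * (2 * m / r)) :
    ∑ ω, |∑ e ∈ S, (x e / p e * ζ ω e - x e)| ≤ Fintype.card Ω * (θ * m) := by
  have h1 : ∀ ω, ∑ e ∈ S, (x e / p e * ζ ω e - x e) = ∑ e ∈ S, x e / p e * (ζ ω e - p e) :=
    fun ω => Finset.sum_congr rfl fun e he => by have := hp e he; field_simp
  have h2 : ∀ e ∈ S, (x e / p e) ^ 2 * (p e * (1 - p e)) ≤ x e * (2 * m / r) := by
    intro e he
    have h0 := hp e he
    have hx0 := hx e he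
    have hb : 0 ≤ 2 * m / r := by positivity
    rcases hxp e he with h | h
    · rw [h]; simp; positivity
    · have h3 : x e / p e ≤ 2 * m / r := by rwa [div_le_iff₀ h0, mul_comm]
      have h4 : (x e / p e) ^ 2 * (p e * (1 - p e)) = x e * (x e / p e) * (1 - p e) := by
        field_simp
      rw [h4]
      have h5 : 0 ≤ x e / p e := by positivity
      calc x e * (x e / p e) * (1 - p e) ≤ x e * (x e / p e) * 1 := by
            apply mul_le_mul_of_nonneg_left (by linarith) (by positivity)
        _ ≤ x e * (2 * m / r) := by rw [mul_one]; exact mul_le_mul_of_nonneg_left h3 hx0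
  have h3 : ∑ ω, (∑ e ∈ S, x e / p e * (ζ ω e - p e)) ^ 2 ≤
      Fintype.card Ω * (m * (2 * m / r)) := by
    rw [h.sum_sq]
    refine mul_le_mul_of_nonneg_left ?_ (by positivity)
    refine (Finset.sum_le_sum h2).trans ?_
    rw [← Finset.sum_mul]
    exact mul_le_mul_of_nonneg_right hxm (by positivity)
  -- The inequality of arithmetic and geometric means replaces Cauchy–Schwarz and keeps the bound
  -- linear in the second moment.
  have h4 : ∀ t : ℝ, |t| ≤ θ * m / 2 + 1 / (2 * θ * m) * t ^ 2 := by
    intro t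
    have h5 : θ * m / 2 + 1 / (2 * θ * m) * t ^ 2 - |t| =
        1 / (2 * θ * m) * (|t| - θ * m) ^ 2 := by
      rw [← sq_abs t]; field_simp; ring
    have h6 : 0 ≤ 1 / (2 * θ * m) * (|t| - θ * m) ^ 2 := by positivity
    linarith
  calc ∑ ω, |∑ e ∈ S, (x e / p e * ζ ω e - x e)|
      ≤ ∑ ω, (θ * m / 2 + 1 / (2 * θ * m) * (∑ e ∈ S, x e / p e * (ζ ω e - p e)) ^ 2) :=
        Finset.sum_le_sum fun ω _ => by rw [h1]; exact h4 _
    _ = Fintype.card Ω * (θ * m / 2) +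
          1 / (2 * θ * m) * ∑ ω, (∑ e ∈ S, x e / p e * (ζ ω e - p e)) ^ 2 := by
        rw [Finset.sum_add_distrib, ← Finset.mul_sum, Finset.sum_const, Finset.card_univ,
          nsmul_eq_mul]
    _ ≤ Fintype.card Ω * (θ * m / 2) +
          1 / (2 * θ * m) * (Fintype.card Ω * (m * (2 * m / r))) := by gcongr
    _ = Fintype.card Ω * (θ * m / 2 + m / (r * θ)) := by field_simp
    _ ≤ Fintype.card Ω * (θ * m) := by
        refine mul_le_mul_of_nonneg_left ?_ (by positivity)
        have : m / (r * θ) ≤ θ * m / 2 := by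
          rw [div_le_iff₀ (by positivity)]
          nlinarith
        linarith

-- Overflow means that the number `c` of sampled elements exceeds twice the bound `r + 1` on its
-- mean `lam`. Then `c` is at most `2 / (r + 1) * (c - lam) ^ 2`. The lost amount is bounded by a
-- multiple of `c`, hence by the variance of the count.
open Classical in
theorem sum_overflow_le (h : PairwiseSample ζ p) (S : Finset A) {x : A → ℝ} {m r : ℝ}
    (hm : 0 < m) (hr : 0 < r) (hp : ∀ e ∈ S, 0 < p e)
    (hx : ∀ e ∈ S, 0 ≤ x e) (hxm : ∑ e ∈ S, x e ≤ m)
    (hxp : ∀ e ∈ S, p e = 1 ∨ x e ≤ p e * (2 * m / r)) (hsum : ∑ e ∈ S, p e ≤ r + 1) :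
    ∑ ω, (if 2 * (r + 1) < ∑ e ∈ S, ζ ω e then ∑ e ∈ S, x e / p e * ζ ω e else 0) ≤
      Fintype.card Ω * (5 * m / r) := by
  have hb : 0 ≤ 2 * m / r := by positivity
  have h1 : ∀ ω, ∑ e ∈ S, x e / p e * ζ ω e ≤ m + 2 * m / r * ∑ e ∈ S, ζ ω e := by
    intro ω
    have : ∀ e ∈ S, x e / p e * ζ ω e ≤ x e + 2 * m / r * ζ ω e := by
      intro e he
      have h0 := h.nonneg ω e
      have hx0 := hx e he
      rcases hxp e he with h' | h'
      · rw [h', div_one]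
        have : 0 ≤ 2 * m / r * ζ ω e := by positivity
        have h2 : x e * ζ ω e ≤ x e := by
          rcases h.zero_or_one ω e with h | h <;> rw [h] <;> linarith
        linarith
      · have h3 : x e / p e ≤ 2 * m / r := by rwa [div_le_iff₀ (hp e he), mul_comm]
        have := mul_le_mul_of_nonneg_right h3 h0
        linarith
    refine (Finset.sum_le_sum this).trans ?_
    rw [Finset.sum_add_distrib, ← Finset.mul_sum]
    linarith
  set lam := ∑ e ∈ S, p e with hlam
  have hlam0 : 0 ≤ lam := Finset.sum_nonneg fun e he => (hp e he).le
  have h2 : ∀ ω, (if 2 * (r + 1) < ∑ e ∈ S, ζ ω e then ∑ e ∈ S, x e / p e * ζ ω e else 0) ≤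
      (m / (2 * (r + 1)) + 2 * m / r) * (2 / (r + 1)) * (∑ e ∈ S, ζ ω e - lam) ^ 2 := by
    intro ω
    split_ifs with hc
    · set c := ∑ e ∈ S, ζ ω e
      have h3 : c ≤ 2 / (r + 1) * (c - lam) ^ 2 := by
        rw [div_mul_eq_mul_div, le_div_iff₀ (by positivity)]
        nlinarith
      have h4 : m ≤ m / (2 * (r + 1)) * c := by
        rw [div_mul_eq_mul_div, le_div_iff₀ (by positivity)]
        nlinarith
      calc ∑ e ∈ S, x e / p e * ζ ω e ≤ m + 2 * m / r * c := h1 ω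
        _ ≤ (m / (2 * (r + 1)) + 2 * m / r) * c := by rw [add_mul]; linarith
        _ ≤ (m / (2 * (r + 1)) + 2 * m / r) * (2 / (r + 1) * (c - lam) ^ 2) :=
            mul_le_mul_of_nonneg_left h3 (by positivity)
        _ = _ := by ring
    · positivity
  have h3 : ∑ ω, (∑ e ∈ S, ζ ω e - lam) ^ 2 ≤ Fintype.card Ω * (r + 1) := by
    have h4 := h.sum_sq S fun _ => 1
    simp only [one_mul, one_pow, Finset.sum_sub_distrib] at h4
    rw [h4]
    refine mul_le_mul_of_nonneg_left ?_ (by positivity)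
    refine le_trans (Finset.sum_le_sum fun e he => ?_) hsum
    have := hp e he
    nlinarith
  calc _ ≤ ∑ ω, (m / (2 * (r + 1)) + 2 * m / r) * (2 / (r + 1)) * (∑ e ∈ S, ζ ω e - lam) ^ 2 :=
        Finset.sum_le_sum fun ω _ => h2 ω
    _ = (m / (2 * (r + 1)) + 2 * m / r) * (2 / (r + 1)) *
          ∑ ω, (∑ e ∈ S, ζ ω e - lam) ^ 2 := by rw [Finset.mul_sum]
    _ ≤ (m / (2 * (r + 1)) + 2 * m / r) * (2 / (r + 1)) * (Fintype.card Ω * (r + 1)) :=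
        mul_le_mul_of_nonneg_left h3 (by positivity)
    _ = Fintype.card Ω * (m / (r + 1) + 4 * m / r) := by field_simp; ring
    _ ≤ Fintype.card Ω * (5 * m / r) := by
        refine mul_le_mul_of_nonneg_left ?_ (by positivity)
        have : m / (r + 1) ≤ m / r := div_le_div_of_nonneg_left hm.le hr (by linarith)
        calc m / (r + 1) + 4 * m / r ≤ m / r + 4 * m / r := by linarith
          _ = 5 * m / r := by ring

end PairwiseSample

/-! ### Pairwise independence by affine hashing. -/

section Hash

theorem card_filter_equivFin_lt (F : Type*) [Fintype F] {t : ℕ} (ht : t ≤ Fintype.card F) :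
    (Finset.univ.filter fun y : F => (Fintype.equivFin F y : ℕ) < t).card = t := by
  classical
  rw [Finset.card_equiv (t := Finset.univ.filter fun i : Fin (Fintype.card F) => (i : ℕ) < t)
    (Fintype.equivFin F) (by simp), Fin.card_filter_val_lt, min_eq_right ht]

variable {F A : Type*} [Field F] [Fintype F]

open Classical in
/-- Indicator of the event that the hash value of `e` is below the threshold `τ e`. -/
noncomputable def hashSample (ι : A → F) (τ : A → ℕ) (ω : F × F) (e : A) : ℝ :=
  if (Fintype.equivFin F (ω.1 * ι e + ω.2) : ℕ) < τ e then 1 else 0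

/-- For distinct keys the seed `(a, b)` corresponds bijectively to the pair of hash values, since a
line is determined by its values at two points. So two hash values are independent and uniform. -/
theorem pairwiseSample_hash {ι : A → F} (hι : Function.Injective ι) {τ : A → ℕ}
    (hτ : ∀ e, τ e ≤ Fintype.card F) :
    PairwiseSample (hashSample ι τ) fun e => (τ e : ℝ) / Fintype.card F := by
  classical
  have hq : (Fintype.card F : ℝ) ≠ 0 := by simp [Fintype.card_ne_zero]
  have hcount : ∀ e, ∑ y : F, (if (Fintype.equivFin F y : ℕ) < τ e then (1 : ℝ) else 0) = τ e := by
    intro e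
    rw [Finset.sum_boole]
    exact_mod_cast card_filter_equivFin_lt F (hτ e)
  refine ⟨fun ω e => ?_, fun e => ?_, fun e e' he => ?_⟩
  · unfold hashSample
    split_ifs <;> simp
  · rw [Fintype.sum_prod_type]
    have : ∀ a : F, ∑ b : F, hashSample ι τ (a, b) e = τ e := by
      intro a
      rw [← hcount e]
      exact Fintype.sum_equiv (Equiv.addLeft (a * ι e)) _ _ fun b => rfl
    simp only [this, Finset.sum_const, Finset.card_univ, Fintype.card_prod, nsmul_eq_mul]
    push_cast
    field_simp
  · have hne : ι e - ι e' ≠ 0 := sub_ne_zero.2 fun h => he (hι h)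
    let f : F × F → F × F := fun ω => (ω.1 * ι e + ω.2, ω.1 * ι e' + ω.2)
    have hf : Function.Injective f := by
      rintro ⟨a, b⟩ ⟨a', b'⟩ h
      simp only [f, Prod.mk.injEq] at h
      have h1 : (a - a') * (ι e - ι e') = 0 := by linear_combination h.1 - h.2
      have h2 : a = a' := by
        rcases mul_eq_zero.1 h1 with h | h
        · exact sub_eq_zero.1 h
        · exact absurd h hne
      subst h2
      simpa using h.1
    have hs : ∑ ω : F × F, hashSample ι τ ω e * hashSample ι τ ω e' =
        ∑ y : F × F, (if (Fintype.equivFin F y.1 : ℕ) < τ e then (1 : ℝ) else 0) *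
          (if (Fintype.equivFin F y.2 : ℕ) < τ e' then (1 : ℝ) else 0) :=
      Fintype.sum_equiv (Equiv.ofBijective f (Finite.injective_iff_bijective.1 hf)) _ _
        fun ω => rfl
    rw [hs, Fintype.sum_prod_type]
    refine (Finset.sum_mul_sum Finset.univ Finset.univ
      (fun y : F => if (Fintype.equivFin F y : ℕ) < τ e then (1 : ℝ) else 0)
      (fun y : F => if (Fintype.equivFin F y : ℕ) < τ e' then (1 : ℝ) else 0)).symm.trans ?_
    rw [hcount, hcount, Fintype.card_prod]
    push_cast
    field_simp

end Hash

end BroadcastCongestedClique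

/-! ### Sampling error of weighted arcs, split by groups and nodes. -/

namespace BroadcastCongestedClique

set_option linter.unusedSectionVars false
set_option linter.unusedVariables false

theorem PairwiseSample.comp {Ω A A' : Type*} [Fintype Ω] {ζ : Ω → A → ℝ} {p : A → ℝ}
    (h : PairwiseSample ζ p) {f : A' → A} (hf : Function.Injective f) :
    PairwiseSample (fun ω a => ζ ω (f a)) fun a => p (f a) :=
  ⟨fun ω e => h.zero_or_one ω _, fun e => h.mean _, fun e e' he => h.pair _ _ (hf.ne he)⟩

section FlowSampling

variable {V Γ : Type*} [Fintype V] [DecidableEq V] [Fintype Γ] [DecidableEq Γ]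

/-- Error of the sampled amounts `xt` on the arcs of group `γ` with head `v`. -/
def errHead (grp : V → V → Γ) (x xt : V → V → ℝ) (γ : Γ) (v : V) : ℝ :=
  ∑ a with grp a v = γ, (xt a v - x a v)

/-- Error of the sampled amounts `xt` on the arcs of group `γ` with tail `v`. -/
def errTail (grp : V → V → Γ) (x xt : V → V → ℝ) (γ : Γ) (v : V) : ℝ :=
  ∑ b with grp v b = γ, (xt v b - x v b)

/-- The arcs of group `γ` that node `u` has to announce if they are sampled. -/
def owned (grp : V → V → Γ) (own : V → V → V) (γ : Γ) (u : V) : Finset (V × V) :=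
  Finset.univ.filter fun e => (e.1 = u ∨ e.2 = u) ∧ grp e.1 e.2 = γ ∧ own e.1 e.2 = u

/-- The sampled amount that is lost since too many arcs are sampled. -/
noncomputable def penalty (grp : V → V → Γ) (own : V → V → V) (ζ : V × V → ℝ) (xt : V → V → ℝ)
    (lim : ℝ) (γ : Γ) (u : V) : ℝ :=
  if lim < ∑ e ∈ owned grp own γ u, ζ e then ∑ e ∈ owned grp own γ u, xt e.1 e.2 else 0

/-- The total amount of flow of group `γ` at node `v`. -/
def mass (grp : V → V → Γ) (x : V → V → ℝ) (γ : Γ) (v : V) : ℝ :=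
  ∑ u with grp v u = γ, (x v u + x u v)

/-- The unbiased estimate of the amount `x`, for arcs sampled with probabilities `p`. -/
noncomputable def estimate (x p : V → V → ℝ) (ζ : V × V → ℝ) (a b : V) : ℝ :=
  x a b / p a b * ζ (a, b)

/-- The sampling cost at node `v`. -/
noncomputable def cost (grp : V → V → Γ) (own : V → V → V) (x p : V → V → ℝ) (ζ : V × V → ℝ)
    (lim : ℝ) (v : V) : ℝ :=
  ∑ γ, (|errHead grp x (estimate x p ζ) γ v| + |errTail grp x (estimate x p ζ) γ v| +
    penalty grp own ζ (estimate x p ζ) lim γ v)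

variable {grp : V → V → Γ} {own : V → V → V} {x p : V → V → ℝ}

theorem mass_nonneg (hx : ∀ a b, 0 ≤ x a b) (γ : Γ) (v : V) : 0 ≤ mass grp x γ v :=
  Finset.sum_nonneg fun u _ => add_nonneg (hx _ _) (hx _ _)

theorem sum_mass (x : V → V → ℝ) : ∑ v, ∑ γ, mass grp x γ v = 2 * ∑ a, ∑ b, x a b := by
  simp only [mass, Finset.sum_fiberwise, Finset.sum_add_distrib]
  rw [Finset.sum_comm (f := fun v u => x u v)]
  ring

/-- Arcs in both directions occur, so a pair is counted twice; a loop is counted twice on the right,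
which does no harm as `f` is nonnegative. -/
theorem sum_owned_le (hgrp : ∀ a b, grp a b = grp b a) {f : V × V → ℝ} (hf : ∀ e, 0 ≤ f e)
    (γ : Γ) (u : V) :
    ∑ e ∈ owned grp own γ u, f e ≤ ∑ b with grp u b = γ, (f (u, b) + f (b, u)) := by
  rw [Finset.sum_add_distrib]
  have hsub : owned grp own γ u ⊆ ((Finset.univ.filter fun b => grp u b = γ).image fun b => (u, b)) ∪
      ((Finset.univ.filter fun b => grp u b = γ).image fun b => (b, u)) := by
    rintro ⟨a, b⟩ he
    simp only [owned, Finset.mem_filter, Finset.mem_univ, true_and] at he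
    simp only [Finset.mem_union, Finset.mem_image, Finset.mem_filter, Finset.mem_univ, true_and]
    rcases he with ⟨rfl | rfl, h, -⟩
    · exact Or.inl ⟨b, h, rfl⟩
    · exact Or.inr ⟨a, (hgrp _ _).trans h, rfl⟩
  refine (Finset.sum_le_sum_of_subset_of_nonneg hsub fun e _ _ => hf e).trans ?_
  refine (Finset.sum_union_inter (f := f) ▸ le_add_of_nonneg_right
    (Finset.sum_nonneg fun e _ => hf e)).trans ?_
  rw [Finset.sum_image (by simp), Finset.sum_image (by simp)]

theorem penalty_nonneg (ζ : V × V → ℝ) {xt : V → V → ℝ} (hxt : ∀ a b, 0 ≤ xt a b) (lim : ℝ)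
    (γ : Γ) (u : V) : 0 ≤ penalty grp own ζ xt lim γ u := by
  unfold penalty
  split_ifs
  exacts [Finset.sum_nonneg fun e _ => hxt _ _, le_rfl]

theorem estimate_nonneg (hx : ∀ a b, 0 ≤ x a b) (hp : ∀ a b, 0 < p a b) {ζ : V × V → ℝ}
    (hζ : ∀ e, 0 ≤ ζ e) (a b : V) : 0 ≤ estimate x p ζ a b :=
  mul_nonneg (div_nonneg (hx a b) (hp a b).le) (hζ _)

theorem cost_nonneg (hx : ∀ a b, 0 ≤ x a b) (hp : ∀ a b, 0 < p a b) {ζ : V × V → ℝ}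
    (hζ : ∀ e, 0 ≤ ζ e) (lim : ℝ) (v : V) : 0 ≤ cost grp own x p ζ lim v :=
  Finset.sum_nonneg fun γ _ => add_nonneg (add_nonneg (abs_nonneg _) (abs_nonneg _))
    (penalty_nonneg ζ (estimate_nonneg hx hp hζ) lim γ v)

/-- The expected total sampling cost. -/
theorem sum_cost_le {Ω : Type*} [Fintype Ω] {ζ : Ω → V × V → ℝ}
    (hζ : PairwiseSample ζ fun e => p e.1 e.2)
    (hgrp : ∀ a b, grp a b = grp b a) (hx : ∀ a b, 0 < x a b)
    (hp : ∀ a b, 0 < p a b) {r θ : ℝ} (hr : 0 < r) (hθ : 0 < θ)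
    (hrθ : 2 ≤ r * θ ^ 2)
    (hpx : ∀ a b, p a b = 1 ∨ x a b ≤ p a b * (2 * mass grp x (grp a b) a / r))
    (hpx' : ∀ a b, p a b = 1 ∨ x a b ≤ p a b * (2 * mass grp x (grp a b) b / r))
    (hown : ∀ γ u, ∑ e ∈ owned grp own γ u, p e.1 e.2 ≤ r + 1) :
    ∑ ω, ∑ v, cost grp own x p (ζ ω) (2 * (r + 1)) v ≤
      Fintype.card Ω * ((2 * θ + 5 / r) * (2 * ∑ a, ∑ b, x a b)) := by
  have key : ∀ v γ, ∑ ω, (|errHead grp x (estimate x p (ζ ω)) γ v| +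
      |errTail grp x (estimate x p (ζ ω)) γ v| +
      penalty grp own (ζ ω) (estimate x p (ζ ω)) (2 * (r + 1)) γ v) ≤
      Fintype.card Ω * ((2 * θ + 5 / r) * mass grp x γ v) := by
    intro v γ
    -- For a group absent at `v` the mass is zero and the moment bounds, which require `0 < m`, are
    -- not available; all terms vanish.
    rcases Finset.eq_empty_or_nonempty (Finset.univ.filter fun u => grp v u = γ) with he | hne
    · have he' : (Finset.univ.filter fun u => grp u v = γ) = ∅ := by
        rw [← he]; ext u; simp [hgrp u v]
      have ho : owned grp own γ v = ∅ := by
        rw [Finset.eq_empty_iff_forall_notMem]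
        rintro ⟨a, b⟩ hab
        simp only [owned, Finset.mem_filter, Finset.mem_univ, true_and] at hab
        rw [Finset.eq_empty_iff_forall_notMem] at he he'
        rcases hab with ⟨rfl | rfl, h, -⟩
        · exact he b (by simpa using h)
        · exact he' a (by simpa using h)
      simp [errHead, errTail, penalty, mass, he, he', ho]
    · have hm : 0 < mass grp x γ v := Finset.sum_pos (fun u _ => add_pos (hx _ _) (hx _ _)) hne
      have hH : ∑ ω, |errHead grp x (estimate x p (ζ ω)) γ v| ≤
          Fintype.card Ω * (θ * mass grp x γ v) := by
        refine (hζ.comp (f := fun a => (a, v)) (fun a b h => (Prod.mk.inj h).1)).sum_abs_le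
          (Finset.univ.filter fun a => grp a v = γ) (x := fun a => x a v) hm hr hθ hrθ
          (fun e _ => hp _ _) (fun e _ => (hx _ _).le) ?_ ?_
        · rw [mass]
          refine (le_of_eq ?_).trans (Finset.sum_le_sum (f := fun u => x u v)
            fun u _ => le_add_of_nonneg_left (hx _ _).le)
          exact Finset.sum_congr (by ext u; simp [hgrp u v]) fun _ _ => rfl
        · intro a ha
          obtain rfl : grp a v = γ := by simpa using ha
          exact hpx' a v
      have hT : ∑ ω, |errTail grp x (estimate x p (ζ ω)) γ v| ≤
          Fintype.card Ω * (θ * mass grp x γ v) := by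
        refine (hζ.comp (f := fun b => (v, b)) (fun a b h => (Prod.mk.inj h).2)).sum_abs_le
          (Finset.univ.filter fun b => grp v b = γ) (x := fun b => x v b) hm hr hθ hrθ
          (fun e _ => hp _ _) (fun e _ => (hx _ _).le) ?_ ?_
        · exact Finset.sum_le_sum fun u _ => le_add_of_nonneg_right (hx _ _).le
        · intro b hb
          obtain rfl : grp v b = γ := by simpa using hb
          exact hpx v b
      have hP : ∑ ω, penalty grp own (ζ ω) (estimate x p (ζ ω)) (2 * (r + 1)) γ v ≤
          Fintype.card Ω * (5 * mass grp x γ v / r) := by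
        have := hζ.sum_overflow_le (owned grp own γ v) (x := fun e => x e.1 e.2) hm hr
          (fun e _ => hp _ _) (fun e _ => (hx _ _).le) (sum_owned_le hgrp (fun e => (hx _ _).le) γ v)
          ?_ (hown γ v)
        · refine le_trans (le_of_eq ?_) this
          refine Finset.sum_congr rfl fun ω _ => ?_
          unfold penalty estimate
          congr 1
        · rintro ⟨a, b⟩ he
          simp only [owned, Finset.mem_filter, Finset.mem_univ, true_and] at he
          rcases he with ⟨rfl | rfl, rfl, -⟩
          · exact hpx a b
          · exact hpx' a b
      rw [Finset.sum_add_distrib, Finset.sum_add_distrib]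
      calc _ ≤ Fintype.card Ω * (θ * mass grp x γ v) + Fintype.card Ω * (θ * mass grp x γ v) +
            Fintype.card Ω * (5 * mass grp x γ v / r) := add_le_add (add_le_add hH hT) hP
        _ = _ := by ring
  simp only [cost]
  rw [Finset.sum_comm]
  calc ∑ v, ∑ ω, ∑ γ, _ = ∑ v, ∑ γ, ∑ ω, _ := Finset.sum_congr rfl fun v _ => Finset.sum_comm
    _ ≤ ∑ v, ∑ γ, Fintype.card Ω * ((2 * θ + 5 / r) * mass grp x γ v) :=
        Finset.sum_le_sum fun v _ => Finset.sum_le_sum fun γ _ => key v γ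
    _ = Fintype.card Ω * ((2 * θ + 5 / r) * (2 * ∑ a, ∑ b, x a b)) := by
        simp only [← Finset.mul_sum, sum_mass]

/-- As the factor `h` depends only on the group and the head, the errors of all arcs sharing these
may cancel before absolute values are taken. -/
theorem sum_heads (grp : V → V → Γ) (f : V → V → ℝ) (h : Γ → V → ℝ) :
    ∑ a, ∑ b, f a b * h (grp a b) b = ∑ v, ∑ γ, h γ v * ∑ a with grp a v = γ, f a v := by
  rw [Finset.sum_comm]
  refine Finset.sum_congr rfl fun v _ => ?_
  rw [← Finset.sum_fiberwise Finset.univ fun a => grp a v]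
  refine Finset.sum_congr rfl fun γ _ => ?_
  rw [Finset.mul_sum]
  refine Finset.sum_congr rfl fun a ha => ?_
  obtain rfl : grp a v = γ := by simpa using ha
  ring

theorem sum_tails (grp : V → V → Γ) (f : V → V → ℝ) (h : Γ → V → ℝ) :
    ∑ a, ∑ b, f a b * h (grp a b) a = ∑ v, ∑ γ, h γ v * ∑ b with grp v b = γ, f v b := by
  refine Finset.sum_congr rfl fun v _ => ?_
  rw [← Finset.sum_fiberwise Finset.univ fun a => grp v a]
  refine Finset.sum_congr rfl fun γ _ => ?_
  rw [Finset.mul_sum]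
  refine Finset.sum_congr rfl fun a ha => ?_
  obtain rfl : grp v a = γ := by simpa using ha
  ring

/-- The sets `owned grp own γ u` partition the arcs. -/
theorem sum_penalty (hown : ∀ a b, own a b = a ∨ own a b = b) (ζ : V × V → ℝ) (xt : V → V → ℝ)
    (lim : ℝ) :
    ∑ a, ∑ b, (if lim < ∑ e ∈ owned grp own (grp a b) (own a b), ζ e then xt a b else 0) =
      ∑ v, ∑ γ, penalty grp own ζ xt lim γ v := by
  rw [← Fintype.sum_prod_type', ← Fintype.sum_prod_type' (f := fun v γ => penalty grp own ζ xt lim γ v),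
    ← Finset.sum_fiberwise Finset.univ fun e : V × V => (own e.1 e.2, grp e.1 e.2)]
  refine Finset.sum_congr rfl fun κ _ => ?_
  have ho : (Finset.univ.filter fun e : V × V => (own e.1 e.2, grp e.1 e.2) = κ) =
      owned grp own κ.2 κ.1 := by
    ext e
    simp only [owned, Finset.mem_filter, Finset.mem_univ, true_and, Prod.ext_iff]
    constructor
    · rintro ⟨h1, h2⟩
      refine ⟨?_, h2, h1⟩
      rcases hown e.1 e.2 with h | h
      · exact Or.inl (h.symm.trans h1)
      · exact Or.inr (h.symm.trans h1)
    · rintro ⟨-, h2, h1⟩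
      exact ⟨h1, h2⟩
  rw [ho, penalty]
  split_ifs with hc
  · refine Finset.sum_congr rfl fun e he => ?_
    rw [← ho] at he
    obtain rfl : (own e.1 e.2, grp e.1 e.2) = κ := by simpa using he
    simp only at hc ⊢
    rw [if_pos hc]
  · refine Finset.sum_eq_zero fun e he => ?_
    rw [← ho] at he
    obtain rfl : (own e.1 e.2, grp e.1 e.2) = κ := by simpa using he
    simp only at hc ⊢
    rw [if_neg hc]

/-- If the announced arcs have slope at most `1`, the average slope with weights `x` is bounded in
terms of the sampling cost. -/
theorem sum_slope_le {ζ : V × V → ℝ} {len : Γ → ℝ} {ctr : Γ → V} {y : V → ℝ} {D : ℝ} {lim : ℝ}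
    (hgrp : ∀ a b, grp a b = grp b a) (hown : ∀ a b, own a b = a ∨ own a b = b)
    (hx : ∀ a b, 0 ≤ x a b) (hp : ∀ a b, 0 < p a b) (hζ : ∀ e, ζ e = 0 ∨ ζ e = 1)
    (hlen : ∀ γ, 0 < len γ) (hD : 1 ≤ D)
    (hy : ∀ a b, |y a - y (ctr (grp a b))| ≤ D * len (grp a b))
    (hann : ∀ a b, ζ (a, b) = 1 → ∑ e ∈ owned grp own (grp a b) (own a b), ζ e ≤ lim →
      y b - y a ≤ len (grp a b)) :
    ∑ a, ∑ b, x a b * ((y b - y a) / len (grp a b)) ≤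
      ∑ a, ∑ b, x a b + 3 * D * ∑ v, cost grp own x p ζ lim v := by
  have hζ0 : ∀ e, 0 ≤ ζ e := fun e => by rcases hζ e with h | h <;> simp [h]
  set xt := estimate x p ζ with hxt
  have hxt0 : ∀ a b, 0 ≤ xt a b := estimate_nonneg hx hp hζ0
  -- Potentials normalised at the group centre: slopes are differences of `h`, and `h` is bounded by
  -- `D` on the nodes that meet the group.
  let h : Γ → V → ℝ := fun γ v => (y v - y (ctr γ)) / len γ
  let lost : V → V → ℝ := fun a b =>
    if lim < ∑ e ∈ owned grp own (grp a b) (own a b), ζ e then xt a b else 0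
  have hyb : ∀ a b, |h (grp a b) a| ≤ D := by
    intro a b
    simp only [h, abs_div, abs_of_pos (hlen _)]
    rw [div_le_iff₀ (hlen _)]
    exact hy a b
  have hslope : ∀ a b, (y b - y a) / len (grp a b) = h (grp a b) b - h (grp a b) a := by
    intro a b
    simp only [h]; ring
  have hslope2 : ∀ a b, (y b - y a) / len (grp a b) ≤ 2 * D := by
    intro a b
    rw [hslope]
    have h1 := abs_le.1 (hyb a b)
    have h2 := abs_le.1 (hyb b a)
    rw [hgrp b a] at h2
    linarith [h1.1, h1.2, h2.1, h2.2]
  have hterm : ∀ a b, x a b * ((y b - y a) / len (grp a b)) ≤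
      x a b + (xt a b - x a b) - ((xt a b - x a b) * h (grp a b) b) +
        ((xt a b - x a b) * h (grp a b) a) + 2 * D * lost a b := by
    intro a b
    -- An announced arc has slope at most 1. Arcs lost through overflow only have the trivial bound
    -- `2 * D`.
    have hkey : xt a b * ((y b - y a) / len (grp a b)) ≤ xt a b + 2 * D * lost a b := by
      simp only [lost]
      split_ifs with hc
      · nlinarith [hslope2 a b, hxt0 a b, mul_le_mul_of_nonneg_left (hslope2 a b) (hxt0 a b)]
      · rcases hζ (a, b) with hz | hz
        · have : xt a b = 0 := by simp [hxt, estimate, hz]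
          simp [this]
        · have h1 : (y b - y a) / len (grp a b) ≤ 1 := by
            rw [div_le_one (hlen _)]
            exact hann a b hz (not_lt.1 hc)
          have := mul_le_mul_of_nonneg_left h1 (hxt0 a b)
          linarith
    rw [hslope] at hkey ⊢
    nlinarith
  have hsum : ∑ a, ∑ b, x a b * ((y b - y a) / len (grp a b)) ≤
      ∑ a, ∑ b, x a b + ∑ a, ∑ b, (xt a b - x a b) * 1 -
        ∑ a, ∑ b, (xt a b - x a b) * h (grp a b) b + ∑ a, ∑ b, (xt a b - x a b) * h (grp a b) a +
        2 * D * ∑ a, ∑ b, lost a b := by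
    simp only [mul_one, Finset.mul_sum, ← Finset.sum_add_distrib, ← Finset.sum_sub_distrib]
    exact Finset.sum_le_sum fun a _ => Finset.sum_le_sum fun b _ => hterm a b
  refine hsum.trans ?_
  rw [sum_heads grp (fun a b => xt a b - x a b) h, sum_tails grp (fun a b => xt a b - x a b) h,
    sum_heads grp (fun a b => xt a b - x a b) (fun _ _ => 1), sum_penalty hown]
  simp only [cost, ← hxt]
  rw [add_sub_assoc, add_assoc, add_assoc]
  gcongr
  -- The coefficients are at most `1 + D ≤ 2 * D` for heads, `D` for tails and `2 * D` for the
  -- penalty, all below `3 * D`.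
  have hpt : ∀ v γ, 1 * errHead grp x xt γ v - h γ v * errHead grp x xt γ v +
      (h γ v * errTail grp x xt γ v + 2 * D * penalty grp own ζ xt lim γ v) ≤
      3 * D * (|errHead grp x xt γ v| + |errTail grp x xt γ v| +
        penalty grp own ζ xt lim γ v) := by
    intro v γ
    have hP := penalty_nonneg (grp := grp) (own := own) ζ hxt0 lim γ v
    rcases Finset.eq_empty_or_nonempty (Finset.univ.filter fun u => grp v u = γ) with he | hne
    · have he' : (Finset.univ.filter fun u => grp u v = γ) = ∅ := by
        rw [← he]; ext u; simp [hgrp u v]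
      simp only [errHead, errTail, he, he', Finset.sum_empty]
      simp only [mul_zero, abs_zero]
      nlinarith
    · obtain ⟨u, hu⟩ := hne
      obtain rfl : grp v u = γ := by simpa using hu
      have h1 := abs_le.1 (hyb v u)
      generalize errHead grp x xt (grp v u) v = eH
      generalize errTail grp x xt (grp v u) v = eT
      have h2 : (1 - h (grp v u) v) * eH ≤ 2 * D * |eH| := by
        refine (le_abs_self _).trans ?_
        rw [abs_mul]
        refine mul_le_mul_of_nonneg_right ?_ (abs_nonneg _)
        rw [abs_le]; constructor <;> linarith [h1.1, h1.2]
      have h3 : h (grp v u) v * eT ≤ D * |eT| := by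
        refine (le_abs_self _).trans ?_
        rw [abs_mul]
        exact mul_le_mul_of_nonneg_right (hyb v u) (abs_nonneg _)
      nlinarith [abs_nonneg eH, abs_nonneg eT]
  have hfin := Finset.sum_le_sum fun v (_ : v ∈ Finset.univ) =>
    Finset.sum_le_sum fun γ (_ : γ ∈ Finset.univ) => hpt v γ
  simp only [Finset.sum_add_distrib, Finset.sum_sub_distrib, ← Finset.mul_sum] at hfin
  rw [one_mul] at hfin
  simp only [one_mul]
  simp only [Finset.sum_add_distrib]
  exact hfin

end FlowSampling

end BroadcastCongestedClique

/-! ### Locality and a crude bound of the sampling cost. -/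

namespace BroadcastCongestedClique

set_option linter.unusedSectionVars false

section FlowSampling

variable {V Γ : Type*} [Fintype V] [DecidableEq V] [Fintype Γ] [DecidableEq Γ]
  {grp grp' : V → V → Γ} {own own' : V → V → V} {x x' p p' : V → V → ℝ}

theorem mass_congr {v : V} (hg : ∀ u, grp v u = grp' v u) (hx : ∀ u, x v u = x' v u)
    (hx' : ∀ u, x u v = x' u v) (γ : Γ) : mass grp x γ v = mass grp' x' γ v := by
  simp only [mass, hg, hx, hx']

theorem owned_congr {v : V} (hg : ∀ u, grp v u = grp' v u) (hg' : ∀ u, grp u v = grp' u v)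
    (ho : ∀ u, own v u = own' v u) (ho' : ∀ u, own u v = own' u v) (γ : Γ) :
    owned grp own γ v = owned grp' own' γ v := by
  ext ⟨a, b⟩
  simp only [owned, Finset.mem_filter, Finset.mem_univ, true_and]
  constructor
  · rintro ⟨rfl | rfl, h1, h2⟩
    · exact ⟨Or.inl rfl, by rw [← hg, h1], by rw [← ho, h2]⟩
    · exact ⟨Or.inr rfl, by rw [← hg', h1], by rw [← ho', h2]⟩
  · rintro ⟨rfl | rfl, h1, h2⟩
    · exact ⟨Or.inl rfl, by rw [hg, h1], by rw [ho, h2]⟩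
    · exact ⟨Or.inr rfl, by rw [hg', h1], by rw [ho', h2]⟩

theorem sum_owned_congr {v : V} {f f' : V × V → ℝ} (hf : ∀ u, f (v, u) = f' (v, u))
    (hf' : ∀ u, f (u, v) = f' (u, v)) (γ : Γ) :
    ∑ e ∈ owned grp own γ v, f e = ∑ e ∈ owned grp own γ v, f' e := by
  refine Finset.sum_congr rfl ?_
  rintro ⟨a, b⟩ he
  simp only [owned, Finset.mem_filter, Finset.mem_univ, true_and] at he
  rcases he with ⟨rfl | rfl, -, -⟩
  exacts [hf b, hf' a]

/-- Only arcs at `v` enter the cost of `v`, so each node can evaluate its own cost for every seed.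
-/
theorem cost_congr {v : V} (hg : ∀ u, grp v u = grp' v u) (hg' : ∀ u, grp u v = grp' u v)
    (ho : ∀ u, own v u = own' v u) (ho' : ∀ u, own u v = own' u v)
    (hx : ∀ u, x v u = x' v u) (hx' : ∀ u, x u v = x' u v)
    (hp : ∀ u, p v u = p' v u) (hp' : ∀ u, p u v = p' u v) {ζ ζ' : V × V → ℝ}
    (hζ : ∀ u, ζ (v, u) = ζ' (v, u)) (hζ' : ∀ u, ζ (u, v) = ζ' (u, v)) (lim : ℝ) :
    cost grp own x p ζ lim v = cost grp' own' x' p' ζ' lim v := by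
  have h1 : ∀ u, estimate x p ζ v u = estimate x' p' ζ' v u := fun u => by
    rw [estimate, estimate, hx, hp, hζ]
  have h2 : ∀ u, estimate x p ζ u v = estimate x' p' ζ' u v := fun u => by
    rw [estimate, estimate, hx', hp', hζ']
  unfold cost
  refine Finset.sum_congr rfl fun γ _ => ?_
  congr 1
  · simp only [errHead, errTail, hg, hg', hx, hx', h1, h2]
  · rw [penalty, penalty, owned_congr hg hg' ho ho', sum_owned_congr hζ hζ',
      sum_owned_congr (f := fun e => estimate x p ζ e.1 e.2)
        (f' := fun e => estimate x' p' ζ' e.1 e.2) h1 h2]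

/-- A worst case bound valid for every seed. It is polynomial relative to the total weight, so the
sums in the seed search fit into messages. -/
theorem cost_le {q : ℝ} (hq : 1 ≤ q) (hgrp : ∀ a b, grp a b = grp b a) (hx : ∀ a b, 0 ≤ x a b)
    (hp : ∀ a b, 1 / q ≤ p a b) {ζ : V × V → ℝ} (hζ : ∀ e, ζ e = 0 ∨ ζ e = 1) (lim : ℝ) (v : V) :
    cost grp own x p ζ lim v ≤ 3 * q * (2 * ∑ a, ∑ b, x a b) := by
  have hq0 : 0 < q := by linarith
  have hp0 : ∀ a b, 0 < p a b := fun a b => lt_of_lt_of_le (by positivity) (hp a b)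
  have hζ0 : ∀ e, 0 ≤ ζ e := fun e => by rcases hζ e with h | h <;> simp [h]
  set xt := estimate x p ζ with hxt
  have hxt0 : ∀ a b, 0 ≤ xt a b := estimate_nonneg hx hp0 hζ0
  have hxtq : ∀ a b, xt a b ≤ q * x a b := by
    intro a b
    rcases hζ (a, b) with h | h
    · have : xt a b = 0 := by simp [hxt, estimate, h]
      rw [this]
      exact mul_nonneg hq0.le (hx a b)
    · have : xt a b = x a b / p a b := by simp [hxt, estimate, h]
      rw [this, div_le_iff₀ (hp0 a b)]
      have h1 : 1 ≤ q * p a b := by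
        have := mul_le_mul_of_nonneg_left (hp a b) hq0.le
        rwa [mul_one_div_cancel hq0.ne'] at this
      nlinarith [hx a b, mul_le_mul_of_nonneg_left h1 (hx a b)]
  have habs : ∀ a b, |xt a b - x a b| ≤ q * x a b := by
    intro a b
    rw [abs_le]
    constructor <;> nlinarith [hxt0 a b, hxtq a b, hx a b]
  have key : ∀ γ, |errHead grp x xt γ v| + |errTail grp x xt γ v| +
      penalty grp own ζ xt lim γ v ≤ 3 * q * mass grp x γ v := by
    intro γ
    have hm : mass grp x γ v = ∑ u with grp v u = γ, x v u + ∑ u with grp v u = γ, x u v :=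
      Finset.sum_add_distrib
    have h1 : |errHead grp x xt γ v| ≤ q * ∑ u with grp v u = γ, x u v := by
      rw [errHead]
      have : (Finset.univ.filter fun a => grp a v = γ) = Finset.univ.filter fun u => grp v u = γ := by
        ext u; simp [hgrp u v]
      rw [this, Finset.mul_sum]
      exact (Finset.abs_sum_le_sum_abs _ _).trans (Finset.sum_le_sum fun u _ => habs _ _)
    have h2 : |errTail grp x xt γ v| ≤ q * ∑ u with grp v u = γ, x v u := by
      rw [errTail, Finset.mul_sum]
      exact (Finset.abs_sum_le_sum_abs _ _).trans (Finset.sum_le_sum fun u _ => habs _ _)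
    have h3 : penalty grp own ζ xt lim γ v ≤ q * mass grp x γ v := by
      have h4 : ∑ e ∈ owned grp own γ v, xt e.1 e.2 ≤ q * mass grp x γ v := by
        refine (sum_owned_le hgrp (fun e => hxt0 _ _) γ v).trans ?_
        rw [mass, Finset.mul_sum]
        exact Finset.sum_le_sum fun u _ => by linarith [hxtq v u, hxtq u v]
      unfold penalty
      split_ifs
      exacts [h4, mul_nonneg hq0.le (mass_nonneg hx _ _)]
    have h5 := mass_nonneg (grp := grp) hx γ v
    nlinarith
  calc cost grp own x p ζ lim v ≤ ∑ γ, 3 * q * mass grp x γ v :=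
        Finset.sum_le_sum fun γ _ => key γ
    _ = 3 * q * ∑ γ, mass grp x γ v := by rw [Finset.mul_sum]
    _ ≤ 3 * q * ∑ v, ∑ γ, mass grp x γ v := by
        refine mul_le_mul_of_nonneg_left ?_ (by positivity)
        exact Finset.single_le_sum (f := fun v => ∑ γ, mass grp x γ v)
          (fun v _ => Finset.sum_nonneg fun γ _ => mass_nonneg hx _ _) (Finset.mem_univ v)
    _ = 3 * q * (2 * ∑ a, ∑ b, x a b) := by rw [sum_mass]

end FlowSampling

/-! ### The multiplicative weights method. -/

/-- The multiplicative weights update method: if in every step the average gain is at most `c`,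
no accumulated gain is much larger than `c T`. -/
theorem multiplicative_weights {A : Type*} [Fintype A] [Nonempty A] {s : ℕ → A → ℝ}
    {α η c : ℝ} {T : ℕ} (hη : 0 < η) (hηα : η * α ≤ 1)
    (hs : ∀ t < T, ∀ e, |s t e| ≤ α)
    (h : ∀ t < T, ∑ e, Real.exp (η * ∑ i ∈ Finset.range t, s i e) * s t e ≤
      c * ∑ e, Real.exp (η * ∑ i ∈ Finset.range t, s i e)) (e : A) :
    ∑ i ∈ Finset.range T, s i e ≤ T * (c + η * α ^ 2) + Real.log (Fintype.card A) / η := by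
  -- The total weight grows per step by a factor of at most `exp (η * c + η ^ 2 * α ^ 2)`, by `exp x
  -- ≤ 1 + x + x ^ 2` for `|x| ≤ 1`. Each single weight is below the total.
  have hpot : ∀ t ≤ T, ∑ e, Real.exp (η * ∑ i ∈ Finset.range t, s i e) ≤
      Fintype.card A * Real.exp (t * (η * c + η ^ 2 * α ^ 2)) := by
    intro t ht
    induction t with
    | zero => simp
    | succ t ih =>
      have ih := ih (by omega)
      set Φ := ∑ e, Real.exp (η * ∑ i ∈ Finset.range t, s i e) with hΦ
      have hΦ0 : 0 ≤ Φ := Finset.sum_nonneg fun e _ => (Real.exp_pos _).le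
      have hstep : ∀ e, Real.exp (η * ∑ i ∈ Finset.range (t + 1), s i e) ≤
          Real.exp (η * ∑ i ∈ Finset.range t, s i e) * (1 + η ^ 2 * α ^ 2) +
          η * (Real.exp (η * ∑ i ∈ Finset.range t, s i e) * s t e) := by
        intro e
        have hse := hs t (by omega) e
        have h1 : |η * s t e| ≤ 1 := by
          rw [abs_mul, abs_of_pos hη]
          exact (mul_le_mul_of_nonneg_left hse hη.le).trans hηα
        have h2 := (abs_le.1 (Real.abs_exp_sub_one_sub_id_le h1)).2
        have h3 : (η * s t e) ^ 2 ≤ η ^ 2 * α ^ 2 := by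
          rw [mul_pow]
          refine mul_le_mul_of_nonneg_left ?_ (by positivity)
          rw [← sq_abs]
          exact pow_le_pow_left₀ (abs_nonneg _) hse 2
        rw [Finset.sum_range_succ, mul_add, Real.exp_add]
        have h4 := Real.exp_pos (η * ∑ i ∈ Finset.range t, s i e)
        have h5 : Real.exp (η * s t e) ≤ 1 + η ^ 2 * α ^ 2 + η * s t e := by linarith
        calc _ ≤ _ := mul_le_mul_of_nonneg_left h5 h4.le
          _ = _ := by ring
      calc ∑ e, Real.exp (η * ∑ i ∈ Finset.range (t + 1), s i e) ≤ _ :=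
            Finset.sum_le_sum fun e _ => hstep e
        _ = Φ * (1 + η ^ 2 * α ^ 2) +
            η * ∑ e, Real.exp (η * ∑ i ∈ Finset.range t, s i e) * s t e := by
            rw [Finset.sum_add_distrib, ← Finset.sum_mul, ← Finset.mul_sum]
        _ ≤ Φ * (1 + η ^ 2 * α ^ 2) + η * (c * Φ) := by
            have := mul_le_mul_of_nonneg_left (h t (by omega)) hη.le
            linarith
        _ = Φ * (η * c + η ^ 2 * α ^ 2 + 1) := by ring
        _ ≤ Φ * Real.exp (η * c + η ^ 2 * α ^ 2) :=
            mul_le_mul_of_nonneg_left (Real.add_one_le_exp _) hΦ0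
        _ ≤ Fintype.card A * Real.exp (t * (η * c + η ^ 2 * α ^ 2)) *
            Real.exp (η * c + η ^ 2 * α ^ 2) :=
            mul_le_mul_of_nonneg_right ih (Real.exp_pos _).le
        _ = _ := by
            rw [mul_assoc, ← Real.exp_add]
            push_cast
            ring_nf
  have h1 : Real.exp (η * ∑ i ∈ Finset.range T, s i e) ≤
      Fintype.card A * Real.exp (T * (η * c + η ^ 2 * α ^ 2)) :=
    (Finset.single_le_sum (f := fun e => Real.exp (η * ∑ i ∈ Finset.range T, s i e))
      (fun e _ => (Real.exp_pos _).le) (Finset.mem_univ e)).trans (hpot T le_rfl)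
  have hA : (0 : ℝ) < Fintype.card A := by exact_mod_cast Fintype.card_pos
  have h2 := Real.log_le_log (Real.exp_pos _) h1
  rw [Real.log_exp, Real.log_mul hA.ne' (Real.exp_pos _).ne', Real.log_exp] at h2
  have h3 : T * (c + η * α ^ 2) + Real.log (Fintype.card A) / η =
      (Real.log (Fintype.card A) + T * (η * c + η ^ 2 * α ^ 2)) / η := by
    field_simp; ring
  rw [h3, le_div_iff₀ hη]
  linarith

/-! ### Distances as largest Lipschitz functions. -/

section MaxLip

variable {n L : ℕ} {W : Fin L → ℝ} {E E' : Set (Fin n × Fin n × Fin L)} {s : Fin n}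

/-- The largest Lipschitz function that vanishes at `s`: the distance to `s` in the graph with
edges `E`. -/
noncomputable def maxLip (W : Fin L → ℝ) (E : Set (Fin n × Fin n × Fin L)) (s v : Fin n) : ℝ :=
  sSup {t | ∃ z, LipOn W E z ∧ z s = 0 ∧ z v = t}

/-- The hypothesis `hb` expresses that the known graph is connected; without a bound the supremum
would have a meaningless default value. -/
theorem le_maxLip (hb : ∃ b, ∀ z, LipOn W E z → ∀ u v, |z u - z v| ≤ b) {z : Fin n → ℝ}
    (hz : LipOn W E z) (hs : z s = 0) (v : Fin n) : z v ≤ maxLip W E s v := by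
  obtain ⟨b, hb⟩ := hb
  refine le_csSup ⟨b, ?_⟩ ⟨z, hz, hs, rfl⟩
  rintro _ ⟨z', hz', hs', rfl⟩
  have := hb z' hz' v s
  rw [hs', sub_zero] at this
  exact (le_abs_self _).trans this

theorem maxLip_le (hW : ∀ i, 0 ≤ W i) {v : Fin n} {t : ℝ}
    (h : ∀ z, LipOn W E z → z s = 0 → z v ≤ t) : maxLip W E s v ≤ t := by
  refine csSup_le ⟨0, 0, fun a b i _ => by simpa using hW i, rfl, rfl⟩ ?_
  rintro _ ⟨z, hz, hs, rfl⟩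
  exact h z hz hs

theorem lipOn_maxLip (hW : ∀ i, 0 ≤ W i)
    (hb : ∃ b, ∀ z, LipOn W E z → ∀ u v, |z u - z v| ≤ b) : LipOn W E (maxLip W E s) := by
  intro a b i hab
  rw [abs_le]
  constructor
  · suffices maxLip W E s a ≤ maxLip W E s b + W i by linarith
    refine maxLip_le hW fun z hz hs => ?_
    have h1 := le_maxLip hb hz hs b
    have h2 := (abs_le.1 (hz a b i hab)).1
    linarith
  · suffices maxLip W E s b ≤ maxLip W E s a + W i by linarith
    refine maxLip_le hW fun z hz hs => ?_
    have h1 := le_maxLip hb hz hs a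
    have h2 := (abs_le.1 (hz a b i hab)).2
    linarith

theorem maxLip_self (hW : ∀ i, 0 ≤ W i)
    (hb : ∃ b, ∀ z, LipOn W E z → ∀ u v, |z u - z v| ≤ b) : maxLip W E s s = 0 := by
  apply le_antisymm
  · exact maxLip_le hW fun z _ hs => hs.le
  · exact le_maxLip hb (z := 0) (fun a b i _ => by simpa using hW i) rfl s

theorem maxLip_anti (hW : ∀ i, 0 ≤ W i)
    (hb : ∃ b, ∀ z, LipOn W E z → ∀ u v, |z u - z v| ≤ b) (h : E ⊆ E') (v : Fin n) :
    maxLip W E' s v ≤ maxLip W E s v :=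
  maxLip_le hW fun _ hz hs => le_maxLip hb (hz.mono h) hs v

end MaxLip

end BroadcastCongestedClique

/-! ### The sampling scheme, computed from public data and one's own row. -/

namespace BroadcastCongestedClique

set_option linter.unusedSectionVars false

/-- The class matrix as far as it is known to a node. -/
def localClasses {n L : ℕ} (x : RowInput n L) (a b : Fin n) : Fin L :=
  if a = x.1 then x.2 b else x.2 a

theorem localClasses_row {n L : ℕ} (cls : Fin n → Fin n → Fin L) (v u : Fin n) :
    localClasses (v, cls v) v u = cls v u := by
  simp [localClasses]

theorem localClasses_col {n L : ℕ} {cls : Fin n → Fin n → Fin L} (hcls : ∀ u v, cls u v = cls v u)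
    (v u : Fin n) : localClasses (v, cls v) u v = cls u v := by
  unfold localClasses
  split_ifs with h
  · subst h; rfl
  · exact hcls v u

/-- Public data at the beginning of an iteration: lengths of the edge classes, centres of the
groups, learning rate, accumulated potentials, and parameters of the precision. -/
structure View (n L : ℕ) where
  W : Fin L → ℝ
  g : Fin L → Fin n → Fin n → Fin n
  η : ℝ
  Y : Fin n → ℝ
  X : ℕ
  r : ℕ
  Q : ℕ

namespace View

variable {n L : ℕ} (P : View n L) {F : Type} [Field F] [Fintype F] (ι : Fin n × Fin n → F)

/-- The group of a pair. -/
def grp (cls : Fin n → Fin n → Fin L) (a b : Fin n) : Fin L × Fin n :=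
  (cls a b, P.g (cls a b) a b)

/-- The weight of an arc in the multiplicative weights update method. -/
noncomputable def weight (cls : Fin n → Fin n → Fin L) (a b : Fin n) : ℝ :=
  Real.exp (P.η * ((P.Y b - P.Y a) / P.W (cls a b)))

/-- An approximate binary logarithm. -/
noncomputable def exponent (m : ℝ) : Fin (2 * P.X + 1) :=
  open Classical in
  if h : ∃ j : Fin (2 * P.X + 1), m ≤ 2 ^ ((j : ℤ) - P.X) ∧ 2 ^ ((j : ℤ) - P.X) ≤ 2 * m then
    h.choose else 0

/-- The groups of the pairs that contain `v`. -/
def touched (cls : Fin n → Fin n → Fin L) (v : Fin n) : Finset (Fin L × Fin n) :=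
  Finset.univ.image (P.grp cls v)

/-- A node announces the approximate masses of its groups. -/
noncomputable def announceMass (x : RowInput n L) :
    Finset ((Fin L × Fin n) × Fin (2 * P.X + 1)) :=
  (P.touched (localClasses x) x.1).image fun γ =>
    (γ, P.exponent (mass (P.grp (localClasses x)) (P.weight (localClasses x)) γ x.1))

variable (ann : Fin n → Finset ((Fin L × Fin n) × Fin (2 * P.X + 1)))

/-- The announced mass. -/
noncomputable def estMass (γ : Fin L × Fin n) (v : Fin n) : ℝ :=
  open Classical in if h : ∃ j, (γ, j) ∈ ann v then 2 ^ ((h.choose : ℤ) - P.X) else 1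

/-- The sum of the announced masses. -/
noncomputable def estTotal : ℝ :=
  ∑ v, ∑ κ ∈ ann v, (2 : ℝ) ^ ((κ.2 : ℤ) - P.X)

/-- The endpoint of an arc that is responsible for it. -/
noncomputable def owner (cls : Fin n → Fin n → Fin L) (a b : Fin n) : Fin n :=
  open Classical in
  if P.estMass ann (P.grp cls a b) a ≤ P.estMass ann (P.grp cls a b) b then a else b

/-- The sampling probability of an arc, in units of `1 / q`. -/
noncomputable def threshold (q : ℕ) (cls : Fin n → Fin n → Fin L) (a b : Fin n) : ℕ :=
  ⌈q * min 1 (P.r * P.weight cls a b /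
    min (P.estMass ann (P.grp cls a b) a) (P.estMass ann (P.grp cls a b) b))⌉₊

/-- The indicator of the sampled arcs. -/
noncomputable def sample (cls : Fin n → Fin n → Fin L) (ω : F × F) : Fin n × Fin n → ℝ :=
  hashSample ι (fun e => P.threshold ann (Fintype.card F) cls e.1 e.2) ω

/-- The sampling cost of a node. -/
noncomputable def nodeCost (cls : Fin n → Fin n → Fin L) (ω : F × F) (v : Fin n) : ℝ :=
  cost (P.grp cls) (P.owner ann cls) (P.weight cls)
    (fun a b => (P.threshold ann (Fintype.card F) cls a b : ℝ) / Fintype.card F)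
    (P.sample ι ann cls ω) (2 * (P.r + 1)) v

/-- The sampling cost of a node as a multiple of a unit. -/
noncomputable def natCost (x : RowInput n L) (ω : F × F) : ℕ :=
  ⌊P.nodeCost ι ann (localClasses x) ω x.1 / (P.estTotal ann / (n * P.Q))⌋₊

/-- The edges that a node announces: the sampled arcs that it is responsible for, except in groups
with too many of them. -/
noncomputable def reveal (ω : F × F) (x : RowInput n L) : Finset (Fin n × Fin L) :=
  open Classical in
  Finset.univ.filter fun p => p.2 = x.2 p.1 ∧
    ∑ e ∈ owned (P.grp (localClasses x)) (P.owner ann (localClasses x))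
      (P.grp (localClasses x) x.1 p.1) x.1, P.sample ι ann (localClasses x) ω e ≤ 2 * (P.r + 1) ∧
    ∃ e ∈ owned (P.grp (localClasses x)) (P.owner ann (localClasses x))
      (P.grp (localClasses x) x.1 p.1) x.1, P.sample ι ann (localClasses x) ω e = 1 ∧
      (e = (x.1, p.1) ∨ e = (p.1, x.1))

section Local

variable {P ann} {cls cls' : Fin n → Fin n → Fin L}

theorem grp_congr {a b : Fin n} (h : cls a b = cls' a b) : P.grp cls a b = P.grp cls' a b := by
  rw [grp, grp, h]

theorem weight_congr {a b : Fin n} (h : cls a b = cls' a b) :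
    P.weight cls a b = P.weight cls' a b := by
  rw [weight, weight, h]

theorem owner_congr {a b : Fin n} (h : cls a b = cls' a b) :
    P.owner ann cls a b = P.owner ann cls' a b := by
  rw [owner, owner, grp_congr h]

theorem threshold_congr {a b : Fin n} (h : cls a b = cls' a b) (q : ℕ) :
    P.threshold ann q cls a b = P.threshold ann q cls' a b := by
  rw [threshold, threshold, grp_congr h, weight_congr h]

theorem sample_congr {a b : Fin n} (h : cls a b = cls' a b) (ω : F × F) :
    P.sample ι ann cls ω (a, b) = P.sample ι ann cls' ω (a, b) := by
  simp only [sample, hashSample, threshold_congr h]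

variable (hcls : ∀ u v, cls u v = cls v u)
include hcls

theorem touched_local (v : Fin n) : P.touched (localClasses (v, cls v)) v = P.touched cls v :=
  Finset.image_congr fun u _ => grp_congr (localClasses_row cls v u)

theorem mass_local (γ : Fin L × Fin n) (v : Fin n) :
    mass (P.grp (localClasses (v, cls v))) (P.weight (localClasses (v, cls v))) γ v =
      mass (P.grp cls) (P.weight cls) γ v :=
  mass_congr (fun u => grp_congr (localClasses_row cls v u))
    (fun u => weight_congr (localClasses_row cls v u))
    (fun u => weight_congr (localClasses_col hcls v u)) γ

/-- A node only knows its own row, which by symmetry of `cls` determines all arcs incident to it. -/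
theorem nodeCost_local (ω : F × F) (v : Fin n) :
    P.nodeCost ι ann (localClasses (v, cls v)) ω v = P.nodeCost ι ann cls ω v := by
  have h1 := localClasses_row cls v
  have h2 := localClasses_col hcls v
  exact cost_congr (fun u => grp_congr (h1 u)) (fun u => grp_congr (h2 u))
    (fun u => owner_congr (h1 u)) (fun u => owner_congr (h2 u))
    (fun u => weight_congr (h1 u)) (fun u => weight_congr (h2 u))
    (fun u => by rw [threshold_congr (h1 u)]) (fun u => by rw [threshold_congr (h2 u)])
    (fun u => sample_congr ι (h1 u) ω) (fun u => sample_congr ι (h2 u) ω) _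

theorem owned_local (γ : Fin L × Fin n) (v : Fin n) :
    owned (P.grp (localClasses (v, cls v))) (P.owner ann (localClasses (v, cls v))) γ v =
      owned (P.grp cls) (P.owner ann cls) γ v :=
  owned_congr (fun u => grp_congr (localClasses_row cls v u))
    (fun u => grp_congr (localClasses_col hcls v u))
    (fun u => owner_congr (localClasses_row cls v u))
    (fun u => owner_congr (localClasses_col hcls v u)) γ

theorem mem_reveal {ω : F × F} {v u : Fin n} {i : Fin L} :
    (u, i) ∈ P.reveal ι ann ω (v, cls v) ↔ i = cls v u ∧
      ∑ e ∈ owned (P.grp cls) (P.owner ann cls) (P.grp cls v u) v, P.sample ι ann cls ω e ≤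
        2 * (P.r + 1) ∧
      ∃ e ∈ owned (P.grp cls) (P.owner ann cls) (P.grp cls v u) v,
        P.sample ι ann cls ω e = 1 ∧ (e = (v, u) ∨ e = (u, v)) := by
  simp only [reveal, Finset.mem_filter, Finset.mem_univ, true_and, owned_local hcls,
    grp_congr (P := P) (localClasses_row cls v u)]
  rw [sum_owned_congr (fun u => sample_congr ι (localClasses_row cls v u) ω)
    (fun u => sample_congr ι (localClasses_col hcls v u) ω)]
  refine and_congr_right fun _ => and_congr_right fun _ => exists_congr fun e =>
    and_congr_right fun _ => ?_
  constructor
  · rintro ⟨h, rfl | rfl⟩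
    · exact ⟨(sample_congr ι (localClasses_row cls v u) ω).symm.trans h, Or.inl rfl⟩
    · exact ⟨(sample_congr ι (localClasses_col hcls v u) ω).symm.trans h, Or.inr rfl⟩
  · rintro ⟨h, rfl | rfl⟩
    · exact ⟨(sample_congr ι (localClasses_row cls v u) ω).trans h, Or.inl rfl⟩
    · exact ⟨(sample_congr ι (localClasses_col hcls v u) ω).trans h, Or.inr rfl⟩

end Local

theorem sample_zero_or_one (cls : Fin n → Fin n → Fin L) (ω : F × F) (e : Fin n × Fin n) :
    P.sample ι ann cls ω e = 0 ∨ P.sample ι ann cls ω e = 1 := by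
  unfold sample hashSample
  split_ifs <;> simp

theorem card_touched_le {cls : Fin n → Fin n → Fin L} {B : ℕ}
    (hB : ∀ v i, ((Finset.univ.filter fun u => cls v u = i).image (P.g i v)).card ≤ B)
    (v : Fin n) : (P.touched cls v).card ≤ L * B := by
  classical
  have hsub : P.touched cls v ⊆ (Finset.univ : Finset (Fin L)).biUnion fun i =>
      ((Finset.univ.filter fun u => cls v u = i).image (P.g i v)).image fun c => (i, c) := by
    intro γ hγ
    obtain ⟨u, -, rfl⟩ := Finset.mem_image.1 hγ
    refine Finset.mem_biUnion.2 ⟨cls v u, Finset.mem_univ _, Finset.mem_image.2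
      ⟨P.g (cls v u) v u, Finset.mem_image.2 ⟨u, by simp, rfl⟩, rfl⟩⟩
  refine (Finset.card_le_card hsub).trans (Finset.card_biUnion_le.trans ?_)
  refine (Finset.sum_le_card_nsmul _ _ B fun i _ => ?_).trans (by simp)
  exact Finset.card_image_le.trans (hB v i)

theorem card_announceMass_le {cls : Fin n → Fin n → Fin L} (hcls : ∀ u v, cls u v = cls v u)
    {B : ℕ}
    (hB : ∀ v i, ((Finset.univ.filter fun u => cls v u = i).image (P.g i v)).card ≤ B)
    (v : Fin n) : (P.announceMass (v, cls v)).card ≤ L * B := by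
  unfold announceMass
  refine Finset.card_image_le.trans ?_
  rw [touched_local hcls]
  exact P.card_touched_le hB v

/-- Each group met by the node contributes at most `2 * (r + 1)` sampled arcs, since overflowing
groups are suppressed. -/
theorem card_reveal_le {cls : Fin n → Fin n → Fin L} (hcls : ∀ u v, cls u v = cls v u)
    {B : ℕ}
    (hB : ∀ v i, ((Finset.univ.filter fun u => cls v u = i).image (P.g i v)).card ≤ B)
    (ω : F × F) (v : Fin n) :
    (P.reveal ι ann ω (v, cls v)).card ≤ L * B * (2 * (P.r + 1)) := by
  classical
  let O : Fin L × Fin n → Finset (Fin n × Fin n) := fun γ =>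
    if ∑ e ∈ owned (P.grp cls) (P.owner ann cls) γ v, P.sample ι ann cls ω e ≤ 2 * (P.r + 1) then
      (owned (P.grp cls) (P.owner ann cls) γ v).filter fun e => P.sample ι ann cls ω e = 1
    else ∅
  have hO : ∀ γ, (O γ).card ≤ 2 * (P.r + 1) := by
    intro γ
    simp only [O]
    split_ifs with h
    · have h1 : (((owned (P.grp cls) (P.owner ann cls) γ v).filter fun e =>
          P.sample ι ann cls ω e = 1).card : ℝ) ≤
          ∑ e ∈ owned (P.grp cls) (P.owner ann cls) γ v, P.sample ι ann cls ω e := by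
        rw [Finset.card_filter]
        push_cast
        refine Finset.sum_le_sum fun e _ => ?_
        rcases P.sample_zero_or_one ι ann cls ω e with h | h <;> simp [h]
      exact_mod_cast h1.trans h
    · simp
  have hsub : P.reveal ι ann ω (v, cls v) ⊆ (P.touched cls v).biUnion fun γ =>
      (O γ).image fun e => (if e.1 = v then e.2 else e.1, cls v (if e.1 = v then e.2 else e.1)) := by
    rintro ⟨u, i⟩ h
    rw [mem_reveal ι hcls] at h
    obtain ⟨rfl, h1, e, he, h2, h3⟩ := h
    refine Finset.mem_biUnion.2 ⟨P.grp cls v u, Finset.mem_image.2 ⟨u, Finset.mem_univ _, rfl⟩,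
      Finset.mem_image.2 ⟨e, ?_, ?_⟩⟩
    · simp only [O]
      rw [if_pos h1]
      exact Finset.mem_filter.2 ⟨he, h2⟩
    · rcases h3 with rfl | rfl
      · simp
      · by_cases huv : u = v
        · subst huv; simp
        · simp [huv]
  refine (Finset.card_le_card hsub).trans (Finset.card_biUnion_le.trans ?_)
  refine (Finset.sum_le_card_nsmul _ _ (2 * (P.r + 1)) fun γ _ =>
    Finset.card_image_le.trans (hO γ)).trans ?_
  rw [smul_eq_mul]
  exact Nat.mul_le_mul_right _ (P.card_touched_le hB v)

end View

end BroadcastCongestedClique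

/-! ### Accuracy of the announced masses and sampling probabilities. -/

namespace BroadcastCongestedClique

namespace View

variable {n L : ℕ} {P : View n L} {F : Type} [Field F] [Fintype F] {ι : Fin n × Fin n → F}
  {cls : Fin n → Fin n → Fin L}

theorem exponent_spec {m : ℝ} (h1 : 2 ^ (-(P.X : ℤ)) ≤ m) (h2 : m ≤ 2 ^ (P.X : ℤ)) :
    m ≤ 2 ^ ((P.exponent m : ℤ) - P.X) ∧ 2 ^ ((P.exponent m : ℤ) - P.X) ≤ 2 * m := by
  have hm : 0 < m := lt_of_lt_of_le (by positivity) h1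
  have h : ∃ j : Fin (2 * P.X + 1), m ≤ 2 ^ ((j : ℤ) - P.X) ∧ 2 ^ ((j : ℤ) - P.X) ≤ 2 * m := by
    obtain ⟨k, hk1, hk2⟩ := exists_mem_Ioc_zpow hm (one_lt_two : (1 : ℝ) < 2)
    have h3 : k < P.X := (zpow_lt_zpow_iff_right₀ (one_lt_two : (1 : ℝ) < 2)).1 (hk1.trans_le h2)
    have h4 : -(P.X : ℤ) ≤ k + 1 :=
      (zpow_le_zpow_iff_right₀ (one_lt_two : (1 : ℝ) < 2)).1 (h1.trans hk2)
    -- The mass lies in `(2 ^ k, 2 ^ (k + 1)]` and is rounded up; `k < P.X` keeps `k + 1` in the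
    -- range.
    refine ⟨⟨(k + 1 + P.X).toNat, by omega⟩, ?_⟩
    have h5 : (((k + 1 + P.X).toNat : ℕ) : ℤ) - P.X = k + 1 := by omega
    simp only [h5]
    refine ⟨hk2, ?_⟩
    rw [zpow_add_one₀ (by norm_num)]
    linarith
  unfold exponent
  rw [dif_pos h]
  exact h.choose_spec

theorem weight_pos (a b : Fin n) : 0 < P.weight cls a b := Real.exp_pos _

/-- The masses are in the range in which their logarithms can be announced. -/
def MassInRange (P : View n L) (cls : Fin n → Fin n → Fin L) : Prop :=
  ∀ v, ∀ γ ∈ P.touched cls v, 2 ^ (-(P.X : ℤ)) ≤ mass (P.grp cls) (P.weight cls) γ v ∧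
    mass (P.grp cls) (P.weight cls) γ v ≤ 2 ^ (P.X : ℤ)

theorem massInRange_of_slope_le {A : ℝ} (hA : ∀ a b, |P.η * ((P.Y b - P.Y a) / P.W (cls a b))| ≤ A)
    (hX : Real.exp A * (2 * n) ≤ 2 ^ P.X) : P.MassInRange cls := by
  intro v γ hγ
  obtain ⟨u, -, rfl⟩ := Finset.mem_image.1 hγ
  have hn : (1 : ℝ) ≤ n := by
    have : 0 < n := Nat.pos_of_ne_zero fun h => by subst h; exact u.elim0
    exact_mod_cast this
  have h1 : ∀ a b, P.weight cls a b ≤ Real.exp A := fun a b =>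
    Real.exp_le_exp.2 (abs_le.1 (hA a b)).2
  have h2 : ∀ a b, Real.exp (-A) ≤ P.weight cls a b := fun a b =>
    Real.exp_le_exp.2 (abs_le.1 (hA a b)).1
  have hexp : Real.exp A ≤ 2 ^ P.X := by
    have := Real.exp_pos A
    nlinarith
  constructor
  · rw [zpow_neg, zpow_natCast]
    have h3 : ((2 : ℝ) ^ P.X)⁻¹ ≤ Real.exp (-A) := by
      rw [Real.exp_neg]
      exact inv_anti₀ (Real.exp_pos A) hexp
    refine h3.trans ((h2 v u).trans ?_)
    refine le_trans (le_add_of_nonneg_right (weight_pos u v).le)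
      (Finset.single_le_sum (f := fun u => P.weight cls v u + P.weight cls u v)
        (fun w _ => (add_pos (weight_pos v w) (weight_pos w v)).le) ?_)
    simp
  · rw [zpow_natCast]
    refine le_trans ?_ hX
    unfold mass
    calc _ ≤ ∑ u with P.grp cls v u = P.grp cls v u, (Real.exp A + Real.exp A) := by
          refine Finset.sum_le_sum_of_subset_of_nonneg (fun w _ => by simp)
            (fun w _ _ => (add_pos (weight_pos v w) (weight_pos w v)).le) |>.trans
            (Finset.sum_le_sum fun w _ => add_le_add (h1 _ _) (h1 _ _))
      _ = Real.exp A * (2 * n) := by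
          simp; ring

variable {ann : Fin n → Finset ((Fin L × Fin n) × Fin (2 * P.X + 1))}

section Estimates

variable (hcls : ∀ u v, cls u v = cls v u) (hX : P.MassInRange cls)
  (hann : ∀ v, ann v = P.announceMass (v, cls v))
include hcls hX hann

omit hX in
theorem announced_eq (v : Fin n) : ann v = (P.touched cls v).image fun γ =>
    (γ, P.exponent (mass (P.grp cls) (P.weight cls) γ v)) := by
  rw [hann]
  unfold announceMass
  simp only [touched_local hcls, mass_local hcls]

theorem estMass_spec {v : Fin n} {γ : Fin L × Fin n} (hγ : γ ∈ P.touched cls v) :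
    mass (P.grp cls) (P.weight cls) γ v ≤ P.estMass ann γ v ∧
      P.estMass ann γ v ≤ 2 * mass (P.grp cls) (P.weight cls) γ v := by
  have hmem : ∀ j, (γ, j) ∈ ann v → j = P.exponent (mass (P.grp cls) (P.weight cls) γ v) := by
    intro j hj
    rw [announced_eq hcls hann] at hj
    obtain ⟨γ', -, h⟩ := Finset.mem_image.1 hj
    obtain ⟨rfl, rfl⟩ := Prod.mk.inj h
    rfl
  have hex : ∃ j, (γ, j) ∈ ann v := by
    refine ⟨P.exponent (mass (P.grp cls) (P.weight cls) γ v), ?_⟩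
    rw [announced_eq hcls hann]
    exact Finset.mem_image.2 ⟨γ, hγ, rfl⟩
  unfold estMass
  rw [dif_pos hex, hmem _ hex.choose_spec]
  exact exponent_spec (hX v γ hγ).1 (hX v γ hγ).2

omit hcls hX hann in
theorem estMass_pos (γ : Fin L × Fin n) (v : Fin n) : 0 < P.estMass ann γ v := by
  unfold estMass
  split_ifs <;> positivity

omit hcls hX hann in
theorem mem_touched (v u : Fin n) : P.grp cls v u ∈ P.touched cls v :=
  Finset.mem_image.2 ⟨u, Finset.mem_univ _, rfl⟩

omit hcls hX hann in
theorem mass_eq_zero {v : Fin n} {γ : Fin L × Fin n} (hγ : γ ∉ P.touched cls v) :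
    mass (P.grp cls) (P.weight cls) γ v = 0 := by
  refine Finset.sum_eq_zero fun u hu => absurd ?_ hγ
  obtain rfl : P.grp cls v u = γ := by simpa using hu
  exact mem_touched v u

/-- Every arc is counted at its head and at its tail, and rounding up loses at most another factor
of 2. -/
theorem estTotal_spec :
    2 * ∑ a, ∑ b, P.weight cls a b ≤ P.estTotal ann ∧
      P.estTotal ann ≤ 4 * ∑ a, ∑ b, P.weight cls a b := by
  have h1 : P.estTotal ann = ∑ v, ∑ γ ∈ P.touched cls v,
      (2 : ℝ) ^ ((P.exponent (mass (P.grp cls) (P.weight cls) γ v) : ℤ) - P.X) := by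
    refine Finset.sum_congr rfl fun v _ => ?_
    rw [announced_eq hcls hann, Finset.sum_image]
    intro a _ b _ h
    exact (Prod.mk.inj h).1
  have h2 : ∑ v, ∑ γ ∈ P.touched cls v, mass (P.grp cls) (P.weight cls) γ v =
      2 * ∑ a, ∑ b, P.weight cls a b := by
    rw [← sum_mass (grp := P.grp cls)]
    refine Finset.sum_congr rfl fun v _ => ?_
    refine Finset.sum_subset (Finset.subset_univ _) fun γ _ hγ => mass_eq_zero hγ
  have h3 : ∀ v, ∀ γ ∈ P.touched cls v, mass (P.grp cls) (P.weight cls) γ v ≤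
      (2 : ℝ) ^ ((P.exponent (mass (P.grp cls) (P.weight cls) γ v) : ℤ) - P.X) ∧
      (2 : ℝ) ^ ((P.exponent (mass (P.grp cls) (P.weight cls) γ v) : ℤ) - P.X) ≤
      2 * mass (P.grp cls) (P.weight cls) γ v :=
    fun v γ hγ => exponent_spec (hX v γ hγ).1 (hX v γ hγ).2
  rw [h1, ← h2]
  refine ⟨Finset.sum_le_sum fun v _ => Finset.sum_le_sum fun γ hγ => (h3 v γ hγ).1, ?_⟩
  have h4 : ∑ v, ∑ γ ∈ P.touched cls v,
      (2 : ℝ) ^ ((P.exponent (mass (P.grp cls) (P.weight cls) γ v) : ℤ) - P.X) ≤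
      ∑ v, ∑ γ ∈ P.touched cls v, 2 * mass (P.grp cls) (P.weight cls) γ v :=
    Finset.sum_le_sum fun v _ => Finset.sum_le_sum fun γ hγ => (h3 v γ hγ).2
  simp only [← Finset.mul_sum, h2] at h4
  linarith

variable (hr : 0 < P.r) (hg : ∀ a b, P.grp cls a b = P.grp cls b a)
include hr

omit hcls hX hann in
theorem threshold_pos {q : ℕ} (hq : 0 < q) (a b : Fin n) : 0 < P.threshold ann q cls a b := by
  refine Nat.ceil_pos.2 (mul_pos (by exact_mod_cast hq) (lt_min one_pos ?_))
  have h1 := estMass_pos (ann := ann) (P.grp cls a b) a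
  have h2 := estMass_pos (ann := ann) (P.grp cls a b) b
  exact div_pos (mul_pos (by exact_mod_cast hr) (weight_pos a b)) (lt_min h1 h2)

omit hcls hX hann hr in
theorem threshold_le {q : ℕ} (a b : Fin n) : P.threshold ann q cls a b ≤ q := by
  refine Nat.ceil_le.2 ?_
  calc (q : ℝ) * _ ≤ q * 1 := mul_le_mul_of_nonneg_left (min_le_left _ _) (by positivity)
    _ = q := mul_one _

-- Taking the ceiling only increases the probability, so the estimate of an arc with probability
-- below 1 stays bounded.
omit hcls hX hann in
theorem threshold_spec {q : ℕ} (hq : 0 < q) (a b : Fin n) :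
    (P.threshold ann q cls a b : ℝ) / q = 1 ∨
      P.weight cls a b ≤ (P.threshold ann q cls a b : ℝ) / q *
        (min (P.estMass ann (P.grp cls a b) a) (P.estMass ann (P.grp cls a b) b) / P.r) := by
  have hq' : (0 : ℝ) < q := by exact_mod_cast hq
  have hr' : (0 : ℝ) < P.r := by exact_mod_cast hr
  have hm : 0 < min (P.estMass ann (P.grp cls a b) a) (P.estMass ann (P.grp cls a b) b) :=
    lt_min (estMass_pos _ _) (estMass_pos _ _)
  set m := min (P.estMass ann (P.grp cls a b) a) (P.estMass ann (P.grp cls a b) b) with hmdef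
  have hle : min 1 (P.r * P.weight cls a b / m) ≤ (P.threshold ann q cls a b : ℝ) / q := by
    rw [le_div_iff₀ hq', mul_comm]
    exact Nat.le_ceil _
  rcases min_choice 1 (P.r * P.weight cls a b / m) with h | h
  · left
    have h1 : (P.threshold ann q cls a b : ℝ) / q ≤ 1 := by
      rw [div_le_one hq']
      exact_mod_cast threshold_le a b
    rw [h] at hle
    exact le_antisymm h1 hle
  · right
    rw [h] at hle
    have h2 : P.weight cls a b = P.r * P.weight cls a b / m * (m / P.r) := by field_simp
    calc P.weight cls a b = P.r * P.weight cls a b / m * (m / P.r) := h2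
      _ ≤ _ := mul_le_mul_of_nonneg_right hle (by positivity)

include hg

omit hg in
theorem threshold_spec_left {q : ℕ} (hq : 0 < q) (a b : Fin n) :
    (P.threshold ann q cls a b : ℝ) / q = 1 ∨
      P.weight cls a b ≤ (P.threshold ann q cls a b : ℝ) / q *
        (2 * mass (P.grp cls) (P.weight cls) (P.grp cls a b) a / P.r) := by
  refine (threshold_spec hr hq a b).imp_right fun h => h.trans ?_
  gcongr
  exact (min_le_left _ _).trans (estMass_spec hcls hX hann (mem_touched a b)).2

theorem threshold_spec_right {q : ℕ} (hq : 0 < q) (a b : Fin n) :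
    (P.threshold ann q cls a b : ℝ) / q = 1 ∨
      P.weight cls a b ≤ (P.threshold ann q cls a b : ℝ) / q *
        (2 * mass (P.grp cls) (P.weight cls) (P.grp cls a b) b / P.r) := by
  refine (threshold_spec hr hq a b).imp_right fun h => h.trans ?_
  gcongr
  refine (min_le_right _ _).trans ?_
  rw [hg a b]
  exact (estMass_spec hcls hX hann (mem_touched b a)).2

/-- The owner attains the minimum in the sampling probability. Its owned arcs are therefore sampled
relative to its own mass, which gives at most `r` in expectation. Rounding adds at most `1 / q` for
each of at most `2 * n` arcs. -/
theorem sum_owned_threshold_le {q : ℕ} (hq : 2 * n ≤ q) (hq0 : 0 < q) (γ : Fin L × Fin n)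
    (u : Fin n) :
    ∑ e ∈ owned (P.grp cls) (P.owner ann cls) γ u,
      (P.threshold ann q cls e.1 e.2 : ℝ) / q ≤ P.r + 1 := by
  have hq' : (0 : ℝ) < q := by exact_mod_cast hq0
  have hm := estMass_pos (ann := ann) γ u
  have h1 : ∀ e ∈ owned (P.grp cls) (P.owner ann cls) γ u,
      (P.threshold ann q cls e.1 e.2 : ℝ) / q ≤
        P.r * P.weight cls e.1 e.2 / P.estMass ann γ u + 1 / q := by
    rintro ⟨a, b⟩ he
    simp only [owned, Finset.mem_filter, Finset.mem_univ, true_and] at he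
    obtain ⟨hab, rfl, hu⟩ := he
    have hmin : min (P.estMass ann (P.grp cls a b) a) (P.estMass ann (P.grp cls a b) b) =
        P.estMass ann (P.grp cls a b) u := by
      unfold owner at hu
      split_ifs at hu with h
      · subst hu; exact min_eq_left h
      · subst hu; exact min_eq_right (not_le.1 h).le
    have h2 : (P.threshold ann q cls a b : ℝ) ≤
        q * (P.r * P.weight cls a b / P.estMass ann (P.grp cls a b) u) + 1 := by
      unfold threshold
      rw [hmin]
      have hw := (weight_pos (P := P) (cls := cls) a b).le
      refine (Nat.ceil_lt_add_one (mul_nonneg hq'.le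
        (le_min zero_le_one (div_nonneg (mul_nonneg (by positivity) hw) hm.le)))).le.trans ?_
      gcongr
      exact min_le_right _ _
    simp only
    rw [div_le_iff₀ hq', add_mul, one_div_mul_cancel hq'.ne']
    linarith
  refine (Finset.sum_le_sum h1).trans ?_
  refine (sum_owned_le (f := fun e => P.r * P.weight cls e.1 e.2 / P.estMass ann γ u + 1 / q) hg
    (fun e => ?_) γ u).trans ?_
  · have hw := (weight_pos (P := P) (cls := cls) e.1 e.2).le
    positivity
  · have h3 : ∑ b with P.grp cls u b = γ, (P.r * P.weight cls u b / P.estMass ann γ u + 1 / q +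
        (P.r * P.weight cls b u / P.estMass ann γ u + 1 / (q : ℝ))) =
        P.r * (mass (P.grp cls) (P.weight cls) γ u / P.estMass ann γ u) +
        (Finset.univ.filter fun b => P.grp cls u b = γ).card * (2 / q) := by
      rw [mass, Finset.sum_div, Finset.mul_sum, ← nsmul_eq_mul, ← Finset.sum_const,
        ← Finset.sum_add_distrib]
      refine Finset.sum_congr rfl fun b _ => ?_
      ring
    simp only [h3]
    have h4 : mass (P.grp cls) (P.weight cls) γ u / P.estMass ann γ u ≤ 1 := by
      rw [div_le_one hm]
      by_cases hγ : γ ∈ P.touched cls u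
      · exact (estMass_spec hcls hX hann hγ).1
      · rw [mass_eq_zero hγ]; exact hm.le
    have h5 : ((Finset.univ.filter fun b => P.grp cls u b = γ).card : ℝ) * (2 / q) ≤ 1 := by
      rw [mul_div_assoc', div_le_one hq']
      have : (Finset.univ.filter fun b => P.grp cls u b = γ).card ≤ n := by
        simpa using Finset.card_le_univ (Finset.univ.filter fun b => P.grp cls u b = γ)
      have h6 : (Finset.univ.filter fun b => P.grp cls u b = γ).card * 2 ≤ q := by omega
      exact_mod_cast h6
    have h7 : (P.r : ℝ) * (mass (P.grp cls) (P.weight cls) γ u / P.estMass ann γ u) ≤ P.r * 1 :=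
      mul_le_mul_of_nonneg_left h4 (by positivity)
    linarith

end Estimates

end View

end BroadcastCongestedClique

/-! ### One iteration: derandomised sparsification. -/

namespace BroadcastCongestedClique

set_option linter.unusedSectionVars false

namespace View

variable {n L : ℕ} {F : Type} [Field F] [Fintype F]

/-- One iteration: the masses of the groups are announced, a seed with small total sampling cost is
determined, and the sampled edges are announced. -/
noncomputable def sparsify (P : View n L) (ι : Fin n × Fin n → F) {M Bd : ℕ}
    (h1 : Fintype.card (Option ((Fin L × Fin n) × Fin (2 * P.X + 1))) ≤ M)
    (h2 : Fintype.card (Fin (Bd + 1)) ≤ M) (h3 : Fintype.card (Option (Fin n × Fin L)) ≤ M)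
    (B₁ k B₂ : ℕ) : Prot (RowInput n L) n (Fin M) (Fin n → Finset (Fin n × Fin L)) :=
  (Prot.askSet h1 B₁ P.announceMass).bind fun ann =>
  (Prot.search h2 (P.natCost ι ann) k Finset.univ).bind fun ω =>
  Prot.askSet h3 B₂ (P.reveal ι ann ω)

theorem within_sparsify (P : View n L) (ι : Fin n × Fin n → F) {M Bd : ℕ}
    (h1 : Fintype.card (Option ((Fin L × Fin n) × Fin (2 * P.X + 1))) ≤ M)
    (h2 : Fintype.card (Fin (Bd + 1)) ≤ M) (h3 : Fintype.card (Option (Fin n × Fin L)) ≤ M)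
    (B₁ k B₂ : ℕ) : (P.sparsify ι h1 h2 h3 B₁ k B₂).Within (B₁ + (2 * k + B₂)) :=
  (Prot.within_askSet h1 B₁ _).bind fun _ => (Prot.within_search h2 _ k _).bind fun _ =>
    Prot.within_askSet h3 B₂ _

variable {P : View n L} {ι : Fin n × Fin n → F} {cls : Fin n → Fin n → Fin L}
  {ann : Fin n → Finset ((Fin L × Fin n) × Fin (2 * P.X + 1))}

section Cost

variable (hcls : ∀ u v, cls u v = cls v u) (hX : P.MassInRange cls)
  (hann : ∀ v, ann v = P.announceMass (v, cls v)) (hr : 0 < P.r) (hQ : 0 < P.Q)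
  (hg : ∀ a b, P.grp cls a b = P.grp cls b a)
include hcls hX hann hr hQ hg

theorem natCost_le (hn : 0 < n) (ω : F × F) (v : Fin n) :
    P.natCost ι ann (v, cls v) ω ≤ 3 * Fintype.card F * n * P.Q := by
  have hq : 0 < Fintype.card F := Fintype.card_pos
  have hq1 : (1 : ℝ) ≤ Fintype.card F := by exact_mod_cast hq
  unfold natCost
  rw [nodeCost_local ι hcls]
  refine Nat.floor_le_of_le ?_
  have hM : 0 < ∑ a, ∑ b, P.weight cls a b :=
    Finset.sum_pos (fun a _ => Finset.sum_pos (fun b _ => weight_pos a b) ⟨v, Finset.mem_univ _⟩)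
      ⟨v, Finset.mem_univ _⟩
  have hT := (estTotal_spec hcls hX hann).1
  have hT0 : 0 < P.estTotal ann := by linarith
  have hn' : (0 : ℝ) < n := by exact_mod_cast hn
  have hQ' : (0 : ℝ) < P.Q := by exact_mod_cast hQ
  have hcost : P.nodeCost ι ann cls ω v ≤
      3 * Fintype.card F * (2 * ∑ a, ∑ b, P.weight cls a b) := by
    refine cost_le hq1 hg (fun a b => (weight_pos a b).le) (fun a b => ?_)
      (P.sample_zero_or_one ι ann cls ω) _ v
    have := threshold_pos (cls := cls) (ann := ann) hr hq a b
    gcongr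
    exact_mod_cast this
  rw [div_le_iff₀ (by positivity)]
  push_cast
  have h4 : (3 * Fintype.card F * n * P.Q : ℝ) * (P.estTotal ann / (n * P.Q)) =
      3 * Fintype.card F * P.estTotal ann := by field_simp
  rw [h4]
  refine hcost.trans ?_
  gcongr

/-- The chosen seed is at most average for the rounded costs. Rounding loses one unit per node, in
total `estTotal / Q`, which is the term `4 / Q`. -/
theorem sum_nodeCost_le (hn : 0 < n) {θ : ℝ} (hθ : 0 < θ)
    (hrθ : 2 ≤ P.r * θ ^ 2) (hι : Function.Injective ι) (hq : 2 * n ≤ Fintype.card F) {ω : F × F}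
    (hω : Fintype.card (F × F) * ∑ v, P.natCost ι ann (v, cls v) ω ≤
      ∑ ω, ∑ v, P.natCost ι ann (v, cls v) ω) :
    ∑ v, P.nodeCost ι ann cls ω v ≤
      ((2 * θ + 5 / P.r) * 2 + 4 / P.Q) * ∑ a, ∑ b, P.weight cls a b := by
  have hq0 : 0 < Fintype.card F := Fintype.card_pos
  have hr' : (0 : ℝ) < P.r := by exact_mod_cast hr
  have hn' : (0 : ℝ) < n := by exact_mod_cast hn
  have hQ' : (0 : ℝ) < P.Q := by exact_mod_cast hQ
  have hM : 0 < ∑ a, ∑ b, P.weight cls a b :=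
    Finset.sum_pos (fun a _ => Finset.sum_pos (fun b _ => weight_pos a b)
      ⟨⟨0, hn⟩, Finset.mem_univ _⟩) ⟨⟨0, hn⟩, Finset.mem_univ _⟩
  obtain ⟨hT1, hT2⟩ := estTotal_spec hcls hX hann
  have hT0 : 0 < P.estTotal ann := by linarith
  set unit := P.estTotal ann / (n * P.Q) with hunit
  have hu0 : 0 < unit := by positivity
  have hp : ∀ a b, (0 : ℝ) < (P.threshold ann (Fintype.card F) cls a b : ℝ) / Fintype.card F :=
    fun a b => div_pos (by exact_mod_cast threshold_pos (ann := ann) hr hq0 a b)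
      (by exact_mod_cast hq0)
  have hpair : PairwiseSample (P.sample ι ann cls)
      fun e => (P.threshold ann (Fintype.card F) cls e.1 e.2 : ℝ) / Fintype.card F :=
    pairwiseSample_hash hι fun e => threshold_le e.1 e.2
  have hexp := sum_cost_le hpair hg weight_pos hp hr' hθ hrθ
    (threshold_spec_left hcls hX hann hr hq0) (threshold_spec_right hcls hX hann hr hg hq0)
    (sum_owned_threshold_le hcls hX hann hr hg hq hq0)
  have hcost0 : ∀ ω v, 0 ≤ P.nodeCost ι ann cls ω v := fun ω v =>
    cost_nonneg (fun a b => (weight_pos a b).le) hp (fun e => hpair.nonneg ω e) _ v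
  have hnat : ∀ ω v, (P.natCost ι ann (v, cls v) ω : ℝ) * unit ≤ P.nodeCost ι ann cls ω v ∧
      P.nodeCost ι ann cls ω v ≤ (P.natCost ι ann (v, cls v) ω + 1) * unit := by
    intro ω v
    unfold natCost
    rw [nodeCost_local ι hcls]
    rw [← le_div_iff₀ hu0, ← div_le_iff₀ hu0]
    exact ⟨Nat.floor_le (div_nonneg (hcost0 ω v) hu0.le), (Nat.lt_floor_add_one _).le⟩
  have hN : (0 : ℝ) < Fintype.card (F × F) := by exact_mod_cast Fintype.card_pos
  have h1 : (Fintype.card (F × F) : ℝ) * (∑ v, (P.natCost ι ann (v, cls v) ω : ℝ) * unit) ≤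
      Fintype.card (F × F) * ((2 * θ + 5 / P.r) * (2 * ∑ a, ∑ b, P.weight cls a b)) := by
    refine le_trans ?_ hexp
    have hω' : (Fintype.card (F × F) : ℝ) * ∑ v, (P.natCost ι ann (v, cls v) ω : ℝ) ≤
        ∑ ω, ∑ v, (P.natCost ι ann (v, cls v) ω : ℝ) := by exact_mod_cast hω
    calc _ = (Fintype.card (F × F) : ℝ) * (∑ v, (P.natCost ι ann (v, cls v) ω : ℝ)) * unit := by
          rw [← Finset.sum_mul]; ring
      _ ≤ (∑ ω, ∑ v, (P.natCost ι ann (v, cls v) ω : ℝ)) * unit :=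
          mul_le_mul_of_nonneg_right hω' hu0.le
      _ ≤ _ := by
          rw [Finset.sum_mul]
          refine Finset.sum_le_sum fun ω _ => ?_
          rw [Finset.sum_mul]
          exact Finset.sum_le_sum fun v _ => (hnat ω v).1
  have h2 := le_of_mul_le_mul_left h1 hN
  have h3 : n * unit ≤ 4 / P.Q * ∑ a, ∑ b, P.weight cls a b := by
    have : n * unit = P.estTotal ann / P.Q := by rw [hunit]; field_simp
    rw [this, div_mul_eq_mul_div]
    gcongr
  calc ∑ v, P.nodeCost ι ann cls ω v
      ≤ ∑ v, (P.natCost ι ann (v, cls v) ω + 1 : ℝ) * unit :=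
        Finset.sum_le_sum fun v _ => (hnat ω v).2
    _ = ∑ v, (P.natCost ι ann (v, cls v) ω : ℝ) * unit + n * unit := by
        simp [add_mul, Finset.sum_add_distrib]
    _ ≤ (2 * θ + 5 / P.r) * (2 * ∑ a, ∑ b, P.weight cls a b) +
          4 / P.Q * ∑ a, ∑ b, P.weight cls a b := add_le_add h2 h3
    _ = _ := by ring

end Cost

/-- After an iteration, the average slope of every function that is Lipschitz on the known edges
is small. -/
theorem run_sparsify_spec {M Bd : ℕ}
    (h1 : Fintype.card (Option ((Fin L × Fin n) × Fin (2 * P.X + 1))) ≤ M)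
    (h2 : Fintype.card (Fin (Bd + 1)) ≤ M) (h3 : Fintype.card (Option (Fin n × Fin L)) ≤ M)
    {k B D : ℕ} (hcls : ∀ u v, cls u v = cls v u) (hX : P.MassInRange cls) (hr : 0 < P.r)
    (hQ : 0 < P.Q) (hW : ∀ i, 0 < P.W i) {E : Set (Fin n × Fin n × Fin L)}
    (hdec : IsDecomposition cls P.W D B E P.g) (hD : 1 ≤ D) (hn : 0 < n) {θ : ℝ} (hθ : 0 < θ)
    (hrθ : 2 ≤ P.r * θ ^ 2) (hι : Function.Injective ι) (hq : 2 * n ≤ Fintype.card F)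
    (hk : Fintype.card (F × F) = 2 ^ k)
    (hBd : Fintype.card (F × F) * (3 * Fintype.card F * n * P.Q) ≤ Bd)
    {R : Fin n → Finset (Fin n × Fin L)}
    (hR : R = (P.sparsify ι h1 h2 h3 (L * B) k (L * B * (2 * (P.r + 1)))).run
      fun v => (v, cls v)) :
    (∀ v u i, (u, i) ∈ R v → cls v u = i) ∧
    ∀ y, LipOn P.W E y → (∀ v u i, (u, i) ∈ R v → |y u - y v| ≤ P.W i) →
      ∑ a, ∑ b, P.weight cls a b * ((y b - y a) / P.W (cls a b)) ≤
        (1 + 3 * D * ((2 * θ + 5 / P.r) * 2 + 4 / P.Q)) * ∑ a, ∑ b, P.weight cls a b := by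
  have hg : ∀ a b, P.grp cls a b = P.grp cls b a := by
    intro a b
    unfold grp
    rw [hdec.symm a b, hcls a b]
  have hq0 : 0 < Fintype.card F := Fintype.card_pos
  simp only [sparsify, Prot.run_bind] at hR
  rw [Prot.run_askSet h1 _ _ _ (P.card_announceMass_le hcls hdec.card_le)] at hR
  set ann : Fin n → Finset ((Fin L × Fin n) × Fin (2 * P.X + 1)) :=
    fun v => P.announceMass (v, cls v) with hann
  have hann' : ∀ v, ann v = P.announceMass (v, cls v) := fun v => rfl
  have hsearch := Prot.run_search h2 (P.natCost ι ann) (fun v => (v, cls v)) k Finset.univ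
    (by rw [Finset.card_univ, hk]) (fun v => by
      refine le_trans (Finset.sum_le_card_nsmul _ _ _ fun ω _ =>
        natCost_le hcls hX hann' hr hQ hg hn ω v) ?_
      rw [Finset.card_univ, smul_eq_mul]
      exact hBd)
  set ω := (Prot.search h2 (P.natCost ι ann) k Finset.univ).run fun v => (v, cls v)
  rw [Prot.run_askSet h3 _ _ _ (P.card_reveal_le ι ann hcls hdec.card_le ω)] at hR
  rw [← hk] at hsearch
  subst hR
  constructor
  · intro v u i h
    rw [mem_reveal ι hcls] at h
    exact h.1.symm
  · intro y hy hyR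
    have hcost := sum_nodeCost_le hcls hX hann' hr hQ hg hn hθ hrθ hι hq hsearch
    have hslope := sum_slope_le (grp := P.grp cls) (own := P.owner ann cls)
      (x := P.weight cls) (p := fun a b => (P.threshold ann (Fintype.card F) cls a b : ℝ) /
        Fintype.card F) (ζ := P.sample ι ann cls ω) (len := fun γ => P.W γ.1)
      (ctr := fun γ => γ.2) (y := y) (D := D) (lim := 2 * (P.r + 1)) hg ?_
      (fun a b => (weight_pos a b).le)
      (fun a b => div_pos (by exact_mod_cast threshold_pos (ann := ann) hr hq0 a b)
        (by exact_mod_cast hq0)) (P.sample_zero_or_one ι ann cls ω) (fun γ => hW γ.1)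
      (by exact_mod_cast hD) (hdec.dist_le y hy) ?_
    · refine hslope.trans ?_
      have : (3 * D * ∑ v, cost (P.grp cls) (P.owner ann cls) (P.weight cls)
          (fun a b => (P.threshold ann (Fintype.card F) cls a b : ℝ) / Fintype.card F)
          (P.sample ι ann cls ω) (2 * (P.r + 1)) v : ℝ) ≤
          3 * D * (((2 * θ + 5 / P.r) * 2 + 4 / P.Q) * ∑ a, ∑ b, P.weight cls a b) :=
        mul_le_mul_of_nonneg_left hcost (by positivity)
      linarith
    · intro a b
      unfold owner
      split_ifs <;> simp
    · intro a b hz hlim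
      have ho : P.owner ann cls a b = a ∨ P.owner ann cls a b = b := by
        unfold owner
        split_ifs <;> simp
      change y b - y a ≤ P.W (cls a b)
      -- Whichever endpoint owns a sampled arc announces it, since its group does not overflow
      -- there.
      rcases ho with ho | ho
      · have hmem : (b, cls a b) ∈ P.reveal ι ann ω (a, cls a) := by
          rw [mem_reveal ι hcls]
          rw [ho] at hlim
          refine ⟨rfl, hlim, (a, b), ?_, hz, Or.inl rfl⟩
          simp [owned, ho]
        exact (le_abs_self _).trans (hyR a b _ hmem)
      · have hmem : (a, cls b a) ∈ P.reveal ι ann ω (b, cls b) := by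
          rw [mem_reveal ι hcls]
          rw [ho, hg a b] at hlim
          refine ⟨rfl, hlim, (a, b), ?_, hz, Or.inr rfl⟩
          simp [owned, ho, hg a b]
        have := hyR b a _ hmem
        rw [hcls a b]
        rw [abs_sub_comm] at this
        exact (le_abs_self _).trans this

end View

end BroadcastCongestedClique

/-! ### The main protocol and its parameters. -/

namespace BroadcastCongestedClique

namespace Approx

variable {n L : ℕ}

/-- Number of clustering steps, and the diameter bound of the groups. -/
def diam (n : ℕ) : ℕ := Nat.clog 2 n + 1

/-- Bound for the number of groups of one class at a node. -/
def groupBound (n : ℕ) : ℕ := (Nat.clog 2 n + 2 + 1) * diam n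

/-- Number of iterations. -/
def iterations (n k : ℕ) : ℕ := 72 * k ^ 2 * diam n ^ 2 * Nat.clog 2 n

/-- Number of samples. -/
def samples (n k : ℕ) : ℕ := 23328 * k ^ 2 * diam n ^ 2

/-- Precision of the sampling cost. -/
def precision (n k : ℕ) : ℕ := 108 * k * diam n

/-- Bound for the absolute value of the announced exponents. -/
def exponentBound (n k : ℕ) : ℕ := 24 * k * diam n * Nat.clog 2 n + Nat.clog 2 n + 1

/-- Binary logarithm of the size of the field. -/
def fieldBits (n : ℕ) : ℕ := 2 * Nat.clog 2 n + 1

/-- Bound for the sums that are announced in the search for a seed. -/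
def searchBound (n k : ℕ) : ℕ :=
  (2 ^ fieldBits n) ^ 2 * (3 * 2 ^ fieldBits n * n * precision n k)

/-- The public data at the beginning of an iteration. -/
noncomputable def view (W : Fin L → ℝ) (k : ℕ) (st : Clustering n L) (Y : Fin n → ℝ) :
    View n L where
  W := W
  g := fun i u v => (st.g i u v).getD u
  η := 1 / (12 * k * diam n ^ 2)
  Y := Y
  X := exponentBound n k
  r := samples n k
  Q := precision n k

noncomputable instance : Fintype (GaloisField 2 (fieldBits n)) := Fintype.ofFinite _

theorem card_field : Fintype.card (GaloisField 2 (fieldBits n)) = 2 ^ fieldBits n := by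
  rw [← Nat.card_eq_fintype_card]
  exact GaloisField.card 2 _ (by unfold fieldBits; omega)

theorem le_two_pow_clog (n : ℕ) : n ≤ 2 ^ Nat.clog 2 n := Nat.le_pow_clog (by norm_num) n

theorem exists_embedding : ∃ ι : Fin n × Fin n → GaloisField 2 (fieldBits n),
    Function.Injective ι := by
  have h : Fintype.card (Fin n × Fin n) ≤ Fintype.card (GaloisField 2 (fieldBits n)) := by
    rw [card_field, Fintype.card_prod, Fintype.card_fin, fieldBits, pow_succ, two_mul, pow_add]
    have := Nat.mul_le_mul (le_two_pow_clog n) (le_two_pow_clog n)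
    omega
  obtain ⟨e⟩ := Function.Embedding.nonempty_of_card_le h
  exact ⟨e, e.injective⟩

/-- The hash keys of the arcs. -/
noncomputable def key (n : ℕ) : Fin n × Fin n → GaloisField 2 (fieldBits n) :=
  (exists_embedding (n := n)).choose

theorem key_injective : Function.Injective (key n) := (exists_embedding (n := n)).choose_spec

section Protocol

variable (W : Fin L → ℝ) (k : ℕ) (s : Fin n) {M : ℕ}
  (h1 : Fintype.card (Option ((Fin L × Fin n) × Fin (2 * exponentBound n k + 1))) ≤ M)
  (h2 : Fintype.card (Fin (searchBound n k + 1)) ≤ M)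
  (h3 : Fintype.card (Option (Fin n × Fin L)) ≤ M)

/-- One iteration: some edges are announced, and the distances to `s` with respect to the known
edges are added to the accumulated potentials. -/
noncomputable def iteration (st : Clustering n L)
    (a : Set (Fin n × Fin n × Fin L) × (Fin n → ℝ)) :
    Prot (RowInput n L) n (Fin M) (Set (Fin n × Fin n × Fin L) × (Fin n → ℝ)) :=
  ((view W k st a.2).sparsify (key n) h1 h2 h3 (L * groupBound n) (2 * fieldBits n)
    (L * groupBound n * (2 * (samples n k + 1)))).bind fun R =>
  Prot.ret (a.1 ∪ {p | (p.2.1, p.2.2) ∈ R p.1},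
    a.2 + maxLip W (a.1 ∪ {p | (p.2.1, p.2.2) ∈ R p.1}) s)

/-- The main protocol. -/
noncomputable def protocol : Prot (RowInput n L) n (Fin M) (Fin n → ℝ) :=
  (Clustering.protocol h3 (Nat.clog 2 n + 2) (diam n)).bind fun st =>
  (Prot.iter (fun _ => iteration W k s h1 h2 h3 st) (iterations n k) (st.E, 0)).bind fun a =>
  Prot.ret (maxLip W a.1 s)

/-- Number of rounds of the main protocol. -/
def rounds (n L k : ℕ) : ℕ :=
  diam n * (L * (Nat.clog 2 n + 2)) + iterations n k * (L * groupBound n +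
    (2 * (2 * fieldBits n) + L * groupBound n * (2 * (samples n k + 1))))

theorem within_protocol : (protocol W k s h1 h2 h3).Within (rounds n L k) :=
  (Clustering.within_protocol h3 _ _).bind fun _ =>
    (Prot.within_iter (fun _ _ => (View.within_sparsify _ _ _ _ _ _ _ _).bind (R' := 0)
      fun _ => Prot.within_ret _ _) _ _).bind (R' := 0) fun _ => Prot.within_ret _ _

end Protocol

section Correctness

variable {W : Fin L → ℝ} {k : ℕ} {s : Fin n} {M : ℕ}
  {h1 : Fintype.card (Option ((Fin L × Fin n) × Fin (2 * exponentBound n k + 1))) ≤ M}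
  {h2 : Fintype.card (Fin (searchBound n k + 1)) ≤ M}
  {h3 : Fintype.card (Option (Fin n × Fin L)) ≤ M} {cls : Fin n → Fin n → Fin L}
  {st : Clustering n L} {B : ℕ}

theorem IsDecomposition.slope_le {D : ℕ} {E : Set (Fin n × Fin n × Fin L)}
    {g : Fin L → Fin n → Fin n → Fin n} (hdec : IsDecomposition cls W D B E g)
    (hcls : ∀ u v, cls u v = cls v u) {z : Fin n → ℝ} (hz : LipOn W E z) (a b : Fin n) :
    |z b - z a| ≤ 2 * D * W (cls a b) := by
  have h1 := abs_le.1 (hdec.dist_le z hz a b)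
  have h2 := abs_le.1 (hdec.dist_le z hz b a)
  rw [hcls b a, hcls a b, ← hdec.symm b a, hcls b a] at *
  rw [abs_le]
  constructor <;> linarith [h1.1, h1.2, h2.1, h2.2]

/-- The edges announced during clustering already connect all nodes, so `maxLip` is a genuine
maximum from the start. -/
theorem exists_bound {D : ℕ} {E : Set (Fin n × Fin n × Fin L)}
    {g : Fin L → Fin n → Fin n → Fin n} (hdec : IsDecomposition cls W D B E g)
    (hcls : ∀ u v, cls u v = cls v u) (hW : ∀ i, 0 < W i) :
    ∃ b, ∀ z, LipOn W E z → ∀ u v, |z u - z v| ≤ b := by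
  refine ⟨2 * D * ∑ i, W i, fun z hz u v => (IsDecomposition.slope_le hdec hcls hz v u).trans ?_⟩
  refine mul_le_mul_of_nonneg_left ?_ (by positivity)
  exact Finset.single_le_sum (fun i _ => (hW i).le) (Finset.mem_univ _)

theorem exp_le_two_pow (m : ℕ) : Real.exp m ≤ 2 ^ (2 * m) := by
  rw [pow_mul, ← mul_one (m : ℝ), Real.exp_nat_mul]
  refine pow_le_pow_left₀ (Real.exp_pos _).le ?_ m
  have := Real.exp_one_lt_d9
  norm_num at this ⊢
  linarith

variable (hcls : ∀ u v, cls u v = cls v u) (hW : ∀ i, 0 < W i) (hk : 0 < k) (hn : 2 ≤ n)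
include hcls hW hk hn

-- After all iterations the accumulated slopes are at most `2 * D * T`. Multiplied by `η` this is
-- `12 * k * D * Nat.clog 2 n`, so all exponents remain announceable.
omit hcls in
theorem massInRange {Y : Fin n → ℝ}
    (hY : ∀ a b, |Y b - Y a| ≤ iterations n k * (2 * diam n * W (cls a b))) :
    (view W k st Y).MassInRange cls := by
  have hD : (0 : ℝ) < diam n := by unfold diam; positivity
  have hk' : (0 : ℝ) < k := by exact_mod_cast hk
  refine View.massInRange_of_slope_le (A := ((12 * k * diam n * Nat.clog 2 n : ℕ) : ℝ)) ?_ ?_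
  · intro a b
    simp only [view]
    have hw := hW (cls a b)
    rw [abs_mul, abs_of_pos (by positivity : (0 : ℝ) < 1 / (12 * k * diam n ^ 2)), abs_div,
      abs_of_pos hw, div_mul_div_comm, one_mul, div_le_iff₀ (by positivity)]
    refine (hY a b).trans (le_of_eq ?_)
    unfold iterations
    push_cast
    ring
  · have h1 := exp_le_two_pow (12 * k * diam n * Nat.clog 2 n)
    have h2 : (n : ℝ) ≤ 2 ^ Nat.clog 2 n := by exact_mod_cast le_two_pow_clog n
    calc _ ≤ (2 : ℝ) ^ (2 * (12 * k * diam n * Nat.clog 2 n)) * (2 * 2 ^ Nat.clog 2 n) := by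
          gcongr
      _ = 2 ^ exponentBound n k := by
          rw [← pow_succ', ← pow_add]
          congr 1
          unfold exponentBound
          ring

theorem run_iteration_spec (hst : IsDecomposition cls W (diam n) (groupBound n) st.E
      fun i u v => (st.g i u v).getD u)
    {a : Set (Fin n × Fin n × Fin L) × (Fin n → ℝ)} (hE : st.E ⊆ a.1)
    (hEc : ∀ u v i, (u, v, i) ∈ a.1 → cls u v = i)
    (hY : ∀ u v, |a.2 v - a.2 u| ≤ iterations n k * (2 * diam n * W (cls u v))) :
    ∃ E', ((iteration W k s h1 h2 h3 st a).run fun v => (v, cls v)) = (E', a.2 + maxLip W E' s) ∧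
      a.1 ⊆ E' ∧ (∀ u v i, (u, v, i) ∈ E' → cls u v = i) ∧
      ∀ y, LipOn W E' y → ∑ u, ∑ v, (view W k st a.2).weight cls u v *
        ((y v - y u) / W (cls u v)) ≤
        (1 + 1 / (3 * k)) * ∑ u, ∑ v, (view W k st a.2).weight cls u v := by
  have hD : (1 : ℝ) ≤ diam n := by unfold diam; push_cast; linarith [Nat.cast_nonneg (α := ℝ) (Nat.clog 2 n)]
  have hD0 : (0 : ℝ) < diam n := by linarith
  have hk' : (1 : ℝ) ≤ k := by exact_mod_cast hk
  have hk0 : (0 : ℝ) < k := by linarith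
  have hDn : 0 < diam n := by unfold diam; omega
  -- With this `θ` the number of samples satisfies `r * θ ^ 2 = 2`. Each of `4 * θ`, `4 / Q` and `10
  -- / r` is at most `1 / (27 * k * D)`, so `3 * D` times their sum is at most `1 / (3 * k)`.
  have hspec := View.run_sparsify_spec (P := view W k st a.2) (ι := key n) (cls := cls)
    (D := diam n) (B := groupBound n) (E := st.E) (k := 2 * fieldBits n) h1 h2 h3 hcls
    (massInRange hW hk hn hY)
    (by simp only [view, samples]; positivity) (by simp only [view, precision]; positivity) hW hst
    hDn (by omega) (θ := 1 / (108 * k * diam n)) (by positivity)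
    (by simp only [view, samples]; push_cast; field_simp; norm_num)
    key_injective
    (by
      have h4 : 2 ^ fieldBits n = 2 ^ Nat.clog 2 n * 2 ^ Nat.clog 2 n * 2 := by
        unfold fieldBits; ring
      rw [card_field, h4]
      nlinarith [le_two_pow_clog n])
    (by rw [Fintype.card_prod, card_field, ← sq, ← pow_mul, mul_comm])
    (by
      simp only [view]
      rw [Fintype.card_prod, card_field, searchBound, sq]) rfl
  obtain ⟨hs1, hs2⟩ := hspec
  refine ⟨_, by simp only [iteration, Prot.run_bind, Prot.run_ret]; rfl, Set.subset_union_left,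
    ?_, ?_⟩
  · rintro u v i (h | h)
    · exact hEc u v i h
    · exact hs1 u v i h
  · intro y hy
    refine (hs2 y ((hy.mono Set.subset_union_left).mono hE)
      (fun v u i h => hy v u i (Or.inr h))).trans ?_
    refine mul_le_mul_of_nonneg_right ?_ (Finset.sum_nonneg fun u _ =>
      Finset.sum_nonneg fun v _ => (View.weight_pos u v).le)
    simp only [view, samples, precision]
    push_cast
    have hx : (1 : ℝ) ≤ k * diam n := by nlinarith
    have h5 : 10 / (23328 * (k : ℝ) ^ 2 * diam n ^ 2) ≤ 1 / (27 * (k * diam n)) := by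
      rw [div_le_div_iff₀ (by positivity) (by positivity)]
      nlinarith
    have h6 : 3 * (diam n : ℝ) * ((2 * (1 / (108 * k * diam n)) +
        5 / (23328 * (k : ℝ) ^ 2 * diam n ^ 2)) * 2 + 4 / (108 * k * diam n)) =
        3 * diam n * (4 * (1 / (108 * k * diam n)) + 4 / (108 * k * diam n) +
          10 / (23328 * (k : ℝ) ^ 2 * diam n ^ 2)) := by ring
    rw [h6]
    have h7 : 3 * (diam n : ℝ) * (4 * (1 / (108 * k * diam n)) + 4 / (108 * k * diam n) +
          10 / (23328 * (k : ℝ) ^ 2 * diam n ^ 2)) ≤ 3 * (diam n : ℝ) *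
          (4 * (1 / (108 * k * diam n)) + 4 / (108 * k * diam n) + 1 / (27 * (k * diam n))) := by
      gcongr
    have h8 : 3 * (diam n : ℝ) *
          (4 * (1 / (108 * k * diam n)) + 4 / (108 * k * diam n) + 1 / (27 * (k * diam n))) =
          1 / (3 * k) := by field_simp; norm_num
    linarith

/-- The result of the main protocol dominates all Lipschitz functions and is at most `1 + 1 / k`
times a Lipschitz function. -/
theorem run_protocol_spec :
    (∀ z : Fin n → ℝ, (∀ a b, |z b - z a| ≤ W (cls a b)) → z s = 0 →
      ∀ v, z v ≤ (protocol W k s h1 h2 h3).run (fun v => (v, cls v)) v) ∧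
    ∃ z : Fin n → ℝ, (∀ a b, |z b - z a| ≤ W (cls a b)) ∧ z s = 0 ∧
      ∀ v, (protocol W k s h1 h2 h3).run (fun v => (v, cls v)) v ≤ (1 + 1 / k) * z v := by
  simp only [protocol, Prot.run_bind, Prot.run_ret]
  set st := (Clustering.protocol h3 (Nat.clog 2 n + 2) (diam n)).run fun v => (v, cls v) with hst0
  have hst : IsDecomposition cls W (diam n) (groupBound n) st.E
      fun i u v => (st.g i u v).getD u := by
    -- The exponent `Nat.clog 2 n + 2` gives `2 * n < 2 ^ K`, and `diam n` steps exhaust all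
    -- centres.
    refine (Clustering.valid_run_protocol h3 _ _ (fun i => (hW i).le) hcls ?_).isDecomposition ?_
    · have := le_two_pow_clog n
      rw [pow_add]; omega
    · have := le_two_pow_clog n
      rw [diam, pow_succ]; omega
  let σ : ℕ → Set (Fin n × Fin n × Fin L) × (Fin n → ℝ) := fun t =>
    (Prot.iter (fun _ => iteration W k s h1 h2 h3 st) t (st.E, 0)).run fun v => (v, cls v)
  have hσ : ∀ t, σ (t + 1) = (iteration W k s h1 h2 h3 st (σ t)).run fun v => (v, cls v) :=
    fun t => by simp only [σ, Prot.iter, Prot.run_bind]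
  -- The potential of iteration `t` already uses the edges revealed in it, so the average slope
  -- bound for the weights built from earlier potentials applies to it.
  let u : ℕ → Fin n → ℝ := fun t => maxLip W (σ (t + 1)).1 s
  have hbd : ∀ E, st.E ⊆ E → ∃ b, ∀ z, LipOn W E z → ∀ u v, |z u - z v| ≤ b := fun E hE => by
    obtain ⟨b, hb⟩ := exists_bound hst hcls hW
    exact ⟨b, fun z hz => hb z (hz.mono hE)⟩
  have hslope : ∀ E, st.E ⊆ E → ∀ a b, |maxLip W E s b - maxLip W E s a| ≤
      2 * diam n * W (cls a b) := fun E hE a b =>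
    IsDecomposition.slope_le hst hcls ((lipOn_maxLip (fun i => (hW i).le) (hbd E hE)).mono hE) a b
  have hinv : ∀ t ≤ iterations n k, st.E ⊆ (σ t).1 ∧
      (∀ u v i, (u, v, i) ∈ (σ t).1 → cls u v = i) ∧
      (∀ a b, |(σ t).2 b - (σ t).2 a| ≤ t * (2 * diam n * W (cls a b))) ∧
      ∀ v, (σ t).2 v = ∑ i ∈ Finset.range t, u i v := by
    intro t
    induction t with
    | zero =>
      intro _
      exact ⟨subset_rfl, hst.cls_eq, fun a b => by simp [σ, Prot.iter], fun v => by
        simp [σ, Prot.iter]⟩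
    | succ t ih =>
      intro ht
      obtain ⟨i1, i2, i3, i4⟩ := ih (by omega)
      obtain ⟨E', e1, e2, e3, -⟩ := run_iteration_spec (s := s) (h1 := h1) (h2 := h2) (h3 := h3)
        hcls hW hk hn hst i1 i2 fun a b => (i3 a b).trans (by
          have := (hW (cls a b)).le
          have : (t : ℝ) ≤ iterations n k := by exact_mod_cast (by omega)
          gcongr)
      rw [← hσ] at e1
      have hE' : E' = (σ (t + 1)).1 := by rw [e1]
      have hY' : (σ (t + 1)).2 = (σ t).2 + u t := by
        simp only [u]
        rw [← hE', e1]
      rw [hE'] at e2 e3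
      refine ⟨i1.trans e2, e3, fun a b => ?_, fun v => ?_⟩
      · have h4 := abs_le.1 (i3 a b)
        have h5 := abs_le.1 (hslope _ (i1.trans e2) a b)
        rw [hY']
        simp only [Pi.add_apply, u]
        push_cast
        rw [abs_le]
        constructor <;> linarith [h4.1, h4.2, h5.1, h5.2]
      · rw [hY', Finset.sum_range_succ, ← i4]; rfl
  have hstep : ∀ t < iterations n k, (σ t).1 ⊆ (σ (t + 1)).1 ∧
      ∀ y, LipOn W (σ (t + 1)).1 y → ∑ a, ∑ b, (view W k st (σ t).2).weight cls a b *
        ((y b - y a) / W (cls a b)) ≤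
        (1 + 1 / (3 * k)) * ∑ a, ∑ b, (view W k st (σ t).2).weight cls a b := by
    intro t ht
    obtain ⟨i1, i2, i3, i4⟩ := hinv t ht.le
    obtain ⟨E', e1, e2, e3, e4⟩ := run_iteration_spec (s := s) (h1 := h1) (h2 := h2) (h3 := h3)
        hcls hW hk hn hst i1 i2 fun a b => (i3 a b).trans (by
          have := (hW (cls a b)).le
          have : (t : ℝ) ≤ iterations n k := by exact_mod_cast ht.le
          gcongr)
    rw [← hσ] at e1
    have hE' : E' = (σ (t + 1)).1 := by rw [e1]
    rw [hE'] at e2 e4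
    exact ⟨e2, e4⟩
  have hmono : ∀ t ≤ iterations n k, ∀ j ≤ t, (σ j).1 ⊆ (σ t).1 := by
    intro t
    induction t with
    | zero => intro _ j hj; obtain rfl : j = 0 := by omega
              rfl
    | succ t ih =>
      intro ht j hj
      rcases Nat.lt_or_ge j (t + 1) with h | h
      · exact (ih (by omega) j (by omega)).trans (hstep t (by omega)).1
      · obtain rfl : j = t + 1 := by omega
        rfl
  set T := iterations n k with hT
  have hlg : 1 ≤ Nat.clog 2 n := Nat.clog_pos (by norm_num) hn
  have hT0 : 0 < T := by
    rw [hT, iterations]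
    have : 0 < diam n := by unfold diam; omega
    positivity
  have hT0' : (0 : ℝ) < T := by exact_mod_cast hT0
  have hk0 : (0 : ℝ) < k := by exact_mod_cast hk
  have hD0 : (0 : ℝ) < diam n := by unfold diam; positivity
  have hc0 : (0 : ℝ) < 1 + 1 / k := by positivity
  have hW0 : ∀ i, 0 ≤ W i := fun i => (hW i).le
  have hfin := hinv T le_rfl
  change (∀ z : Fin n → ℝ, _ → z s = 0 → ∀ v, z v ≤ maxLip W (σ T).1 s v) ∧
    ∃ z : Fin n → ℝ, _ ∧ z s = 0 ∧ ∀ v, maxLip W (σ T).1 s v ≤ (1 + 1 / k) * z v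
  constructor
  · intro z hz hzs v
    refine le_maxLip (hbd _ hfin.1) (fun a b i hab => ?_) hzs v
    rw [← hfin.2.1 a b i hab]
    exact hz a b
  -- The gains are the slopes of the potentials on all ordered pairs. With `α = 2 * D` the choice of
  -- `η` makes `η * α ^ 2 = 1 / (3 * k)`.
  · have : Nonempty (Fin n × Fin n) := ⟨(s, s)⟩
    have hmw := multiplicative_weights (A := Fin n × Fin n)
      (s := fun t e => (u t e.2 - u t e.1) / W (cls e.1 e.2)) (α := 2 * diam n)
      (η := 1 / (12 * k * diam n ^ 2)) (c := 1 + 1 / (3 * k)) (T := T) (by positivity)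
      (by
        have hD1 : (1 : ℝ) ≤ diam n := by
          have : 1 ≤ diam n := by unfold diam; omega
          exact_mod_cast this
        have hk1 : (1 : ℝ) ≤ k := by exact_mod_cast hk
        rw [div_mul_eq_mul_div, div_le_one (by positivity)]
        have : (1 : ℝ) ≤ k * diam n := by nlinarith
        nlinarith)
      (by
        intro t ht e
        rw [abs_div, abs_of_pos (hW _), div_le_iff₀ (hW _)]
        exact hslope _ (hinv (t + 1) (by omega)).1 e.1 e.2)
      (by
        intro t ht
        have h4 := (hstep t ht).2 (u t) (lipOn_maxLip hW0 (hbd _ (hinv (t + 1) (by omega)).1))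
        have h5 : ∀ a b, (view W k st (σ t).2).weight cls a b = Real.exp (1 / (12 * k * diam n ^ 2) *
            ∑ i ∈ Finset.range t, (u i b - u i a) / W (cls a b)) := by
          intro a b
          rw [View.weight, ← Finset.sum_div, Finset.sum_sub_distrib, ← (hinv t ht.le).2.2.2,
            ← (hinv t ht.le).2.2.2]
          rfl
        simp only [h5] at h4
        rw [Fintype.sum_prod_type, Fintype.sum_prod_type]
        exact h4)
    -- This determines the number of iterations: the logarithmic term, divided by `T`, must also be
    -- at most `1 / (3 * k)`.
    have hlog : Real.log (Fintype.card (Fin n × Fin n)) / (1 / (12 * k * diam n ^ 2)) ≤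
        T * (1 / (3 * k)) := by
      have h4 : Real.log n ≤ Nat.clog 2 n := by
        have h5 : (n : ℝ) ≤ 2 ^ Nat.clog 2 n := by exact_mod_cast le_two_pow_clog n
        have h6 := Real.log_le_log (by exact_mod_cast (by omega : 0 < n)) h5
        rw [Real.log_pow] at h6
        have h7 : Real.log 2 ≤ 1 := by
          have := Real.log_two_lt_d9
          linarith
        refine h6.trans ?_
        have : (0 : ℝ) ≤ Nat.clog 2 n := by positivity
        nlinarith
      rw [Fintype.card_prod, Fintype.card_fin]
      push_cast
      have hn0 : (n : ℝ) ≠ 0 := by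
        have : n ≠ 0 := by omega
        exact_mod_cast this
      rw [Real.log_mul hn0 hn0, div_div_eq_mul_div, div_one, hT, iterations]
      push_cast
      calc (Real.log n + Real.log n) * (12 * k * diam n ^ 2) ≤
          (Nat.clog 2 n + Nat.clog 2 n) * (12 * k * diam n ^ 2) := by gcongr
        _ = _ := by field_simp; ring
    have hslopeY : ∀ a b, (σ T).2 b - (σ T).2 a ≤ T * (1 + 1 / k) * W (cls a b) := by
      intro a b
      have h4 := hmw (a, b)
      simp only at h4
      rw [← Finset.sum_div, Finset.sum_sub_distrib, ← hfin.2.2.2, ← hfin.2.2.2] at h4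
      rw [← div_le_iff₀ (hW _)]
      have h5 : (1 / (12 * k * diam n ^ 2) * (2 * diam n) ^ 2 : ℝ) = 1 / (3 * k) := by
        field_simp; norm_num
      rw [h5] at h4
      have h6 : (1 / k : ℝ) = 1 / (3 * k) + 1 / (3 * k) + 1 / (3 * k) := by
        field_simp; norm_num
      rw [h6]
      linarith
    -- The mean potential, scaled down to slopes at most 1 on all pairs.
    refine ⟨fun v => (σ T).2 v / (T * (1 + 1 / k)), fun a b => ?_, ?_, fun v => ?_⟩
    · rw [← sub_div, abs_div, abs_of_pos (mul_pos hT0' hc0), div_le_iff₀ (mul_pos hT0' hc0),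
        mul_comm, abs_le]
      have h4 := hslopeY a b
      have h5 := hslopeY b a
      rw [hcls b a] at h5
      constructor <;> linarith
    · have : (σ T).2 s = 0 := by
        rw [hfin.2.2.2]
        exact Finset.sum_eq_zero fun i hi => maxLip_self hW0
          (hbd _ (hinv (i + 1) (by simpa using hi)).1)
      simp [this]
    -- Known edges only accumulate, so the final distance is at most every earlier potential.
    · have h4 : T * maxLip W (σ T).1 s v ≤ (σ T).2 v := by
        rw [hfin.2.2.2, ← nsmul_eq_mul]
        have := Finset.card_nsmul_le_sum (Finset.range T) (fun i => u i v) (maxLip W (σ T).1 s v) ?_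
        · simpa using this
        · intro i hi
          have hi : i < T := by simpa using hi
          exact maxLip_anti hW0 (hbd _ (hinv (i + 1) hi).1) (hmono T le_rfl _ hi) v
      have h5 : (1 + 1 / k) * ((σ T).2 v / (T * (1 + 1 / k))) = (σ T).2 v / T := by field_simp
      rw [h5, le_div_iff₀ hT0', mul_comm]
      exact h4

end Correctness

end Approx

end BroadcastCongestedClique

/-! ### Weighted distances and rounding of the weights. -/

namespace BroadcastCongestedClique

section WeightedDist

variable {n : ℕ} {G : SimpleGraph (Fin n)} {w : Sym2 (Fin n) → ℕ} {s : Fin n}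

theorem weightedDist_le {V : Type*} {G : SimpleGraph V} {w : Sym2 V → ℕ} {s v : V}
    (p : G.Walk s v) : weightedDist G w s v ≤ ((p.edges.map w).sum : ℕ) :=
  iInf_le _ p

theorem weightedDist_self {V : Type*} (G : SimpleGraph V) (w : Sym2 V → ℕ) (s : V) :
    weightedDist G w s s = 0 :=
  le_antisymm ((weightedDist_le .nil).trans_eq (by simp)) bot_le

theorem weightedDist_le_add {V : Type*} {G : SimpleGraph V} {w : Sym2 V → ℕ} {s a b : V}
    (h : G.Adj a b) : weightedDist G w s b ≤ weightedDist G w s a + w s(a, b) := by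
  unfold weightedDist
  rw [ENNReal.iInf_add]
  refine le_iInf fun p => (iInf_le _ (p.concat h)).trans_eq ?_
  rw [SimpleGraph.Walk.edges_concat]
  simp

theorem weightedDist_congr {V : Type*} {G : SimpleGraph V} {w w' : Sym2 V → ℕ}
    (h : ∀ e ∈ G.edgeSet, w e = w' e) (s v : V) :
    weightedDist G w s v = weightedDist G w' s v := by
  unfold weightedDist
  congr 1
  funext p
  congr 2
  exact List.map_congr_left fun e he => h e (p.edges_subset_edgeSet he)

theorem sum_bypass_le {V : Type*} [DecidableEq V] {G : SimpleGraph V} (w : Sym2 V → ℕ) {s v : V}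
    (p : G.Walk s v) : (p.bypass.edges.map w).sum ≤ (p.edges.map w).sum := by
  have h : (p.bypass.edges : Multiset (Sym2 V)) ≤ p.edges :=
    (Multiset.le_iff_subset (Multiset.coe_nodup.2 p.bypass_isPath.isTrail.edges_nodup)).2
      fun _ he => p.edges_bypass_subset_edges he
  obtain ⟨t, ht⟩ := Multiset.le_iff_exists_add.1 h
  have h2 := congrArg (fun m => (m.map w).sum) ht
  simp only [Multiset.map_add, Multiset.sum_add, Multiset.map_coe, Multiset.sum_coe] at h2
  omega

/-- A finite distance is attained by a path. -/
theorem exists_path_weightedDist {V : Type*} {G : SimpleGraph V} {w : Sym2 V → ℕ} {s v : V}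
    (h : weightedDist G w s v ≠ ⊤) : ∃ p : G.Walk s v, p.IsPath ∧
      weightedDist G w s v = ((p.edges.map w).sum : ℕ) := by
  classical
  have hne : Nonempty (G.Walk s v) := by
    by_contra hcon
    rw [not_nonempty_iff] at hcon
    exact h (iInf_of_empty _)
  obtain ⟨p, hp⟩ := exists_minimal_of_wellFoundedLT (P := fun m : ℕ => ∃ p : G.Walk s v,
    (p.edges.map w).sum = m) ⟨_, hne.some, rfl⟩
  obtain ⟨⟨q, rfl⟩, hq⟩ := hp
  refine ⟨q.bypass, q.bypass_isPath, le_antisymm (weightedDist_le _) (le_iInf fun r => ?_)⟩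
  refine Nat.cast_le.2 ((sum_bypass_le w q).trans ?_)
  rcases le_total (r.edges.map w).sum (q.edges.map w).sum with hr | hr
  · exact hq ⟨r, rfl⟩ hr
  · exact hr

theorem sum_le_of_isPath {B : ℕ} (hw : ∀ e ∈ G.edgeSet, w e ≤ B) {v : Fin n} {p : G.Walk s v}
    (hp : p.IsPath) : (p.edges.map w).sum ≤ n * B := by
  have h1 := List.sum_le_card_nsmul (p.edges.map w) B (by
    intro x hx
    obtain ⟨e, he, rfl⟩ := List.mem_map.1 hx
    exact hw e (p.edges_subset_edgeSet he))
  rw [List.length_map, SimpleGraph.Walk.length_edges] at h1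
  have h2 := hp.length_lt
  rw [Fintype.card_fin] at h2
  exact h1.trans (Nat.mul_le_mul h2.le le_rfl)

theorem sub_le_of_walk {V : Type*} {G : SimpleGraph V} {w : Sym2 V → ℕ} {z : V → ℝ} {α N : ℝ}
    (hz : ∀ a b, G.Adj a b → z b - z a ≤ α * (N * w s(a, b) + 1)) {s v : V} (p : G.Walk s v) :
    z v - z s ≤ α * (N * (p.edges.map w).sum + p.length) := by
  induction p with
  | nil => simp
  | cons h p ih =>
    have := hz _ _ h
    simp only [SimpleGraph.Walk.edges_cons, List.map_cons, List.sum_cons,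
      SimpleGraph.Walk.length_cons, Nat.cast_add, Nat.cast_one]
    linarith

end WeightedDist

/-- The least power of `1 + 1 / k` that is at least `x`. -/
noncomputable def level (k : ℕ) (x : ℝ) : ℕ := sInf {i : ℕ | x ≤ (1 + 1 / k) ^ i}

/-- Bernoulli's inequality: `(1 + 1 / k) ^ k` is at least 2. -/
theorem two_pow_le_pow {k : ℕ} (hk : 0 < k) (m : ℕ) : (2 : ℝ) ^ m ≤ (1 + 1 / k) ^ (k * m) := by
  have hk' : (0 : ℝ) < k := by exact_mod_cast hk
  rw [pow_mul]
  refine pow_le_pow_left₀ (by norm_num) ?_ m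
  have h := one_add_mul_le_pow (a := (1 / k : ℝ)) (by
    have : (0 : ℝ) ≤ 1 / k := by positivity
    linarith) k
  have h2 : (1 : ℝ) + k * (1 / k) = 2 := by field_simp; norm_num
  linarith

theorem level_le {k m : ℕ} (hk : 0 < k) {x : ℝ} (hx : x ≤ 2 ^ m) : level k x ≤ k * m :=
  Nat.sInf_le (hx.trans (two_pow_le_pow hk m))

theorem le_pow_level {k m : ℕ} (hk : 0 < k) {x : ℝ} (hx : x ≤ 2 ^ m) :
    x ≤ (1 + 1 / k) ^ level k x :=
  Nat.sInf_mem (s := {i : ℕ | x ≤ (1 + 1 / k) ^ i}) ⟨k * m, hx.trans (two_pow_le_pow hk m)⟩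

theorem pow_level_le (k : ℕ) {x : ℝ} (hx : 1 ≤ x) :
    (1 + 1 / k : ℝ) ^ level k x ≤ (1 + 1 / k) * x := by
  have h0 : (0 : ℝ) ≤ 1 / k := by positivity
  rcases h : level k x with _ | i
  · rw [pow_zero]
    nlinarith
  · have h1 : i ∉ {i : ℕ | x ≤ (1 + 1 / k) ^ i} := Nat.notMem_of_lt_sInf (by
      rw [level] at h
      omega)
    have h2 : (1 + 1 / k : ℝ) ^ i < x := not_le.1 h1
    rw [pow_succ, mul_comm]
    exact mul_le_mul_of_nonneg_left h2.le (by linarith)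

namespace Approx

/-- The factor by which the weights are scaled. -/
def scale (n k : ℕ) : ℕ := n * k

/-- A strict bound for all finite approximate distances. -/
def distBound (c n : ℕ) : ℕ := 8 * n ^ (c + 1) + 1

/-- The scaled length of an arc. -/
def scaledLength (c n k : ℕ) (o : Option ℕ) : ℕ :=
  o.elim (scale n k * distBound c n) fun a => scale n k * a + 1

/-- The number of weight classes, minus one. -/
def topClass (c n k : ℕ) : ℕ := k * ((c + 10) * Nat.clog 2 n)

/-- The length of the arcs of a class. -/
noncomputable def classLength (c n k : ℕ) (i : Fin (topClass c n k + 1)) : ℝ :=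
  (1 + 1 / k) ^ i.1

/-- The class of an arc. -/
noncomputable def arcClass (c n k : ℕ) (o : Option ℕ) : Fin (topClass c n k + 1) :=
  Fin.ofNat _ (level k (scaledLength c n k o))

/-- The output for the result `u` of the main protocol. -/
noncomputable def outputDist (c n k : ℕ) (u : ℝ) : ℝ≥0∞ :=
  if u < scale n k then 0
  else if (scale n k * distBound c n : ℕ) ≤ u then ⊤
  else ENNReal.ofReal (u / (scale n k * (1 + 1 / k) ^ 3))

variable {c n k : ℕ}

theorem distBound_le (hn : 2 ≤ n) : distBound c n ≤ n ^ (c + 5) := by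
  have h1 : 2 ^ 3 ≤ n ^ 3 := Nat.pow_le_pow_left hn 3
  have h2 : n ^ (c + 5) = n ^ (c + 1) * n ^ 3 * n := by ring
  have h3 : 1 ≤ n ^ (c + 1) := Nat.one_le_pow _ _ (by omega)
  have h4 : n ^ (c + 1) * n ^ 3 * 2 ≤ n ^ (c + 5) := by rw [h2]; gcongr
  have h5 : n ^ (c + 1) * 2 ^ 3 ≤ n ^ (c + 1) * n ^ 3 := by gcongr
  unfold distBound
  omega

theorem scaledLength_le (hn : 2 ≤ n) (hk : k ≤ 8 * n) {o : Option ℕ}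
    (ho : ∀ a ∈ o, a ≤ n ^ c) (hk0 : 0 < k) :
    (scaledLength c n k o : ℝ) ≤ 2 ^ ((c + 10) * Nat.clog 2 n) := by
  have h1 : scaledLength c n k o ≤ scale n k * distBound c n := by
    cases o with
    | none => exact le_rfl
    | some a =>
      have h2 : a + 1 ≤ distBound c n := by
        have := ho a rfl
        have h3 : n ^ c ≤ n ^ (c + 1) := Nat.pow_le_pow_right (by omega) (by omega)
        unfold distBound
        omega
      calc scale n k * a + 1 ≤ scale n k * a + scale n k := by
            have : 0 < scale n k := Nat.mul_pos (by omega) hk0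
            omega
        _ = scale n k * (a + 1) := by ring
        _ ≤ _ := Nat.mul_le_mul le_rfl h2
  have h2 : scale n k ≤ n ^ 5 := by
    have h1 : 2 ^ 3 ≤ n ^ 3 := Nat.pow_le_pow_left hn 3
    calc n * k ≤ n * (n ^ 3 * n) := by gcongr; exact hk.trans (Nat.mul_le_mul h1 le_rfl)
      _ = n ^ 5 := by ring
  have h3 : scaledLength c n k o ≤ (2 ^ Nat.clog 2 n) ^ (c + 10) :=
    calc _ ≤ n ^ 5 * n ^ (c + 5) := h1.trans (Nat.mul_le_mul h2 (distBound_le hn))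
      _ = n ^ (c + 10) := by ring
      _ ≤ _ := Nat.pow_le_pow_left (le_two_pow_clog n) _
  rw [mul_comm, pow_mul]
  exact_mod_cast h3

/-- The size bound excludes wrap-around in `Fin.ofNat`. The summand 1 in `scaledLength` keeps
lengths positive for edges of weight 0, as rounding to powers requires. -/
theorem classLength_arcClass (hn : 2 ≤ n) (hk : k ≤ 8 * n) {o : Option ℕ}
    (ho : ∀ a ∈ o, a ≤ n ^ c) (hk0 : 0 < k) :
    (scaledLength c n k o : ℝ) ≤ classLength c n k (arcClass c n k o) ∧
      classLength c n k (arcClass c n k o) ≤ (1 + 1 / k) * scaledLength c n k o := by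
  have h1 := scaledLength_le hn hk ho hk0
  have h2 : classLength c n k (arcClass c n k o) = (1 + 1 / k) ^ level k (scaledLength c n k o) := by
    have h3 : level k (scaledLength c n k o) < topClass c n k + 1 :=
      Nat.lt_succ_of_le (level_le hk0 h1)
    rw [classLength, arcClass, Fin.val_ofNat, Nat.mod_eq_of_lt h3]
  rw [h2]
  refine ⟨le_pow_level hk0 h1, pow_level_le k ?_⟩
  have : 0 < scaledLength c n k o := by
    cases o with
    | none => exact Nat.mul_pos (Nat.mul_pos (by omega) hk0) (Nat.succ_pos _)
    | some a => exact Nat.succ_pos _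
  exact_mod_cast this

theorem classLength_pos (i : Fin (topClass c n k + 1)) : 0 < classLength c n k i := by
  unfold classLength
  positivity

section Rounding

variable {G : SimpleGraph (Fin n)} {w : Sym2 (Fin n) → ℕ} {s : Fin n} (hn : 2 ≤ n)
  (hk : k ≤ 8 * n) (hk5 : 5 ≤ k) (hw : ∀ e ∈ G.edgeSet, w e ≤ n ^ c) {u : Fin n → ℝ}

theorem weightRow_le (hw : ∀ e ∈ G.edgeSet, w e ≤ n ^ c) (a b : Fin n) :
    ∀ x ∈ weightRow G w a b, x ≤ n ^ c := by
  intro x hx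
  unfold weightRow at hx
  split_ifs at hx with h
  · obtain rfl : w s(a, b) = x := by simpa using hx
    exact hw _ h
  · simp at hx

theorem weightRow_symm (a b : Fin n) : weightRow G w a b = weightRow G w b a := by
  unfold weightRow
  rw [G.adj_comm, Sym2.eq_swap]

include hn hk hk5 hw

/-- The truncated distance, scaled, is an admissible Lipschitz function. Truncation at `distBound`
is what makes it Lipschitz on the artificial arcs for non-edges. -/
theorem scale_mul_min_le (h : ∀ z : Fin n → ℝ, (∀ a b, |z b - z a| ≤
      classLength c n k (arcClass c n k (weightRow G w a b))) → z s = 0 → ∀ v, z v ≤ u v)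
    (v : Fin n) :
    scale n k * (min (weightedDist G w s v) (distBound c n)).toReal ≤ u v := by
  have hfin : ∀ v, min (weightedDist G w s v) (distBound c n) ≠ ⊤ := fun v =>
    ne_top_of_le_ne_top (ENNReal.natCast_ne_top _) (min_le_right _ _)
  have hle : ∀ v, (min (weightedDist G w s v) (distBound c n)).toReal ≤ distBound c n := fun v =>
    (ENNReal.toReal_mono (ENNReal.natCast_ne_top _) (min_le_right _ _)).trans_eq
      (ENNReal.toReal_natCast _)
  have h0 : ∀ v, 0 ≤ (min (weightedDist G w s v) (distBound c n)).toReal := fun v =>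
    ENNReal.toReal_nonneg
  refine h (fun v => scale n k * (min (weightedDist G w s v) (distBound c n)).toReal) ?_
    (by simp [weightedDist_self]) v
  intro a b
  refine le_trans ?_ (classLength_arcClass hn hk (weightRow_le hw a b) (by omega)).1
  rw [← mul_sub, abs_mul, abs_of_nonneg (Nat.cast_nonneg _)]
  by_cases hab : G.Adj a b
  · have hrow : weightRow G w a b = some (w s(a, b)) := if_pos hab
    have key : ∀ a b, G.Adj a b → (min (weightedDist G w s b) (distBound c n)).toReal ≤
        (min (weightedDist G w s a) (distBound c n)).toReal + w s(a, b) := by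
      intro a b hab
      rw [← ENNReal.toReal_natCast (w s(a, b)), ← ENNReal.toReal_add (hfin a)
        (ENNReal.natCast_ne_top _)]
      refine ENNReal.toReal_mono (ENNReal.add_ne_top.2 ⟨hfin a, ENNReal.natCast_ne_top _⟩) ?_
      rw [min_add]
      exact min_le_min (weightedDist_le_add hab) le_self_add
    have h1 := key a b hab
    have h2 := key b a hab.symm
    rw [Sym2.eq_swap] at h2
    rw [hrow]
    simp only [scaledLength, Option.elim_some]
    push_cast
    have h3 : |(min (weightedDist G w s b) (distBound c n)).toReal -
        (min (weightedDist G w s a) (distBound c n)).toReal| ≤ w s(a, b) := by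
      rw [abs_le]; constructor <;> linarith
    have := mul_le_mul_of_nonneg_left h3 (Nat.cast_nonneg (α := ℝ) (scale n k))
    linarith
  · have hrow : weightRow G w a b = none := if_neg hab
    rw [hrow]
    simp only [scaledLength, Option.elim_none]
    push_cast
    refine mul_le_mul_of_nonneg_left ?_ (Nat.cast_nonneg _)
    rw [abs_le]
    constructor <;> linarith [h0 a, h0 b, hle a, hle b]

theorem le_of_walk (h : ∃ z : Fin n → ℝ, (∀ a b, |z b - z a| ≤
      classLength c n k (arcClass c n k (weightRow G w a b))) ∧ z s = 0 ∧
      ∀ v, u v ≤ (1 + 1 / k) * z v) {v : Fin n} {p : G.Walk s v} (hp : p.IsPath) :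
    u v ≤ (1 + 1 / k) ^ 2 * (scale n k * (p.edges.map w).sum + n) := by
  obtain ⟨z, hz, hzs, hu⟩ := h
  have h1 := sub_le_of_walk (G := G) (w := w) (z := z) (α := 1 + 1 / k) (N := scale n k)
    (fun a b hab => by
      have hrow : weightRow G w a b = some (w s(a, b)) := if_pos hab
      have h1 := (classLength_arcClass hn hk (weightRow_le hw a b) (by omega)).2
      refine (le_abs_self _).trans ((hz a b).trans (h1.trans_eq ?_))
      rw [hrow]
      simp [scaledLength]) p
  rw [hzs, sub_zero] at h1
  have h2 : (p.length : ℝ) ≤ n := by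
    have := hp.length_lt
    rw [Fintype.card_fin] at this
    exact_mod_cast this.le
  have h3 : (0 : ℝ) ≤ 1 + 1 / k := by positivity
  calc u v ≤ (1 + 1 / k) * z v := hu v
    _ ≤ (1 + 1 / k) * ((1 + 1 / k) * (scale n k * (p.edges.map w).sum + p.length)) := by gcongr
    _ ≤ (1 + 1 / k) * ((1 + 1 / k) * (scale n k * (p.edges.map w).sum + n)) := by gcongr
    _ = _ := by ring

theorem isApprox_outputDist {ε : ℝ} (hε : (1 + 1 / k : ℝ) ^ 3 ≤ 1 + ε)
    (h1 : ∀ z : Fin n → ℝ, (∀ a b, |z b - z a| ≤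
      classLength c n k (arcClass c n k (weightRow G w a b))) → z s = 0 → ∀ v, z v ≤ u v)
    (h2 : ∃ z : Fin n → ℝ, (∀ a b, |z b - z a| ≤
      classLength c n k (arcClass c n k (weightRow G w a b))) ∧ z s = 0 ∧
      ∀ v, u v ≤ (1 + 1 / k) * z v) (v : Fin n) :
    IsApprox ε (weightedDist G w s v) (outputDist c n k (u v)) := by
  have hlow := scale_mul_min_le hn hk hk5 hw h1 v
  have hk5' : (5 : ℝ) ≤ k := by exact_mod_cast hk5
  have hk0 : (0 : ℝ) < k := by linarith
  have hn0 : (0 : ℝ) < n := by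
    have : 0 < n := by omega
    exact_mod_cast this
  have hN : (0 : ℝ) < scale n k := by
    unfold scale; push_cast; positivity
  have hMx : (1 : ℝ) ≤ distBound c n := by
    unfold distBound; push_cast
    have : (0 : ℝ) ≤ 8 * n ^ (c + 1) := by positivity
    linarith
  have hk1 : (1 / k : ℝ) ≤ 1 / 5 := one_div_le_one_div_of_le (by norm_num) hk5'
  have hk2 : (0 : ℝ) < 1 / k := by positivity
  by_cases htop : weightedDist G w s v = ⊤
  · rw [htop, min_eq_right le_top, ENNReal.toReal_natCast] at hlow
    have h3 : ¬ u v < scale n k := by nlinarith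
    have h4 : ((scale n k * distBound c n : ℕ) : ℝ) ≤ u v := by exact_mod_cast hlow
    rw [outputDist, if_neg h3, if_pos h4, htop]
    exact ⟨le_top, le_top⟩
  · obtain ⟨p, hp, hd⟩ := exists_path_weightedDist htop
    have hup := le_of_walk hn hk hk5 hw h2 hp
    have hsum := sum_le_of_isPath hw hp
    set d := (p.edges.map w).sum with hd0
    have hd1 : d ≤ n ^ (c + 1) := hsum.trans_eq (by ring)
    have hd2 : d ≤ distBound c n := by unfold distBound; omega
    rw [hd, min_eq_left (Nat.cast_le.2 hd2), ENNReal.toReal_natCast] at hlow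
    rw [hd]
    rcases Nat.eq_zero_or_pos d with h0 | h0
    -- At distance 0 only the additive errors remain, at most `2 * n`, which is below `n * k` as `k`
    -- is at least 5.
    · have h3 : u v < scale n k := by
        refine hup.trans_lt ?_
        rw [h0]
        unfold scale
        push_cast
        have : (1 + 1 / k : ℝ) ^ 2 ≤ 2 := by nlinarith
        nlinarith
      rw [outputDist, if_pos h3, h0]
      simp [IsApprox]
    · have hd3 : (1 : ℝ) ≤ d := by exact_mod_cast h0
      have h3 : ¬ u v < scale n k := by nlinarith
      have hup2 : u v ≤ scale n k * (1 + 1 / k) ^ 3 * d := by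
        refine hup.trans ?_
        -- For positive distance the additive error `n` is a `1 / k` fraction of the scaled
        -- distance; it costs the third factor `1 + 1 / k`.
        have : (n : ℝ) ≤ 1 / k * (scale n k * d) := by
          unfold scale
          push_cast
          have : (1 / k * (n * k * d) : ℝ) = n * d := by field_simp
          rw [this]
          nlinarith
        calc (1 + 1 / k : ℝ) ^ 2 * (scale n k * d + n) ≤
            (1 + 1 / k : ℝ) ^ 2 * (scale n k * d + 1 / k * (scale n k * d)) := by gcongr
          _ = _ := by ring
      -- The constant 8 in `distBound` dominates the cubed error factor, so finite and infinite
      -- distances are separated.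
      have h4 : ¬ ((scale n k * distBound c n : ℕ) : ℝ) ≤ u v := by
        rw [not_le]
        have h5 : (d : ℝ) ≤ n ^ (c + 1) := by exact_mod_cast hd1
        have h6 : (1 + 1 / k : ℝ) ^ 3 ≤ 8 := by
          have : (1 + 1 / k : ℝ) ^ 3 ≤ 2 ^ 3 := by gcongr; linarith
          linarith
        calc u v ≤ scale n k * (1 + 1 / k) ^ 3 * d := hup2
          _ ≤ scale n k * 8 * n ^ (c + 1) := by gcongr
          _ < _ := by
            unfold distBound
            push_cast
            nlinarith
      have h5 : (0 : ℝ) < scale n k * (1 + 1 / k) ^ 3 := by positivity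
      rw [outputDist, if_neg h3, if_neg h4]
      constructor
      · have h6 : (d : ℝ≥0∞) = ENNReal.ofReal d := (ENNReal.ofReal_natCast d).symm
        have h7 : (0 : ℝ) < 1 + ε := lt_of_lt_of_le (by positivity) hε
        rw [h6, ← ENNReal.ofReal_div_of_pos h7]
        refine ENNReal.ofReal_le_ofReal ?_
        rw [div_le_div_iff₀ h7 h5]
        calc d * (scale n k * (1 + 1 / k : ℝ) ^ 3) = scale n k * d * (1 + 1 / k : ℝ) ^ 3 := by ring
          _ ≤ u v * (1 + ε) := by
            have : (0 : ℝ) ≤ scale n k * d := by positivity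
            gcongr
            linarith
      · refine ENNReal.ofReal_le_of_le_toReal ?_
        rw [ENNReal.toReal_natCast, div_le_iff₀ h5]
        linarith

end Rounding

end Approx

end BroadcastCongestedClique

/-! ### Exact protocol for tiny `ε`, message size, number of rounds, and conclusion. -/

namespace BroadcastCongestedClique

theorem isApprox_self {ε : ℝ} (hε : 0 ≤ ε) (d : ℝ≥0∞) : IsApprox ε d d := by
  refine ⟨ENNReal.div_le_of_le_mul ?_, le_rfl⟩
  refine le_mul_of_one_le_right' ?_
  rw [← ENNReal.ofReal_one]
  exact ENNReal.ofReal_le_ofReal (by linarith)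

namespace Exact

variable {n c M : ℕ}

/-- The distances in the graph with the given weight matrix. -/
noncomputable def distOfMatrix (s : Fin n) (f : Fin n → Fin n → Option (Fin (n ^ c + 1)))
    (v : Fin n) : ℝ≥0∞ :=
  weightedDist (SimpleGraph.fromRel fun a b => (f a b).isSome)
    (fun e => ((f e.out.1 e.out.2).map Fin.val).getD 0) s v

/-- Every node broadcasts all its incident edges. -/
noncomputable def protocol (h : Fintype.card (Option (Fin (n ^ c + 1))) ≤ M) (s : Fin n) :
    Prot (Fin n × (Fin n → Option ℕ)) n (Fin M) (Fin n → ℝ≥0∞) :=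
  (Prot.askFun h n fun x j => (x.2 j).map (Fin.ofNat (n ^ c + 1))).bind fun f =>
    Prot.ret (distOfMatrix s f)

theorem within_protocol (h : Fintype.card (Option (Fin (n ^ c + 1))) ≤ M) (s : Fin n) :
    (protocol h s).Within n :=
  (Prot.within_askFun h n _).bind (R' := 0) fun _ => Prot.within_ret _ _

theorem run_protocol (h : Fintype.card (Option (Fin (n ^ c + 1))) ≤ M) (s : Fin n)
    {G : SimpleGraph (Fin n)} {w : Sym2 (Fin n) → ℕ} (hw : ∀ e ∈ G.edgeSet, w e ≤ n ^ c) :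
    (protocol h s).run (fun v => (v, weightRow G w v)) = weightedDist G w s := by
  rw [protocol, Prot.run_bind, Prot.run_askFun, Prot.run_ret]
  funext v
  have hG : (SimpleGraph.fromRel fun a b =>
      ((weightRow G w a b).map (Fin.ofNat (n ^ c + 1))).isSome) = G := by
    ext a b
    simp only [SimpleGraph.fromRel_adj, Option.isSome_map, weightRow_isSome]
    exact ⟨fun ⟨_, h⟩ => h.elim id SimpleGraph.Adj.symm, fun h => ⟨h.ne, Or.inl h⟩⟩
  rw [distOfMatrix]
  simp only [hG]
  refine weightedDist_congr (fun e he => ?_) s v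
  have he2 : s(e.out.1, e.out.2) = e := Quot.out_eq e
  have hadj : G.Adj e.out.1 e.out.2 := by rw [← SimpleGraph.mem_edgeSet, he2]; exact he
  have hrow : weightRow G w e.out.1 e.out.2 = some (w e) := by
    rw [weightRow, if_pos hadj, he2]
  rw [hrow]
  simp only [Option.map_some, Option.getD_some, Fin.val_ofNat]
  exact Nat.mod_eq_of_lt (Nat.lt_succ_of_le (hw e he))

end Exact

namespace Approx

variable {n c k M : ℕ}

/-- Approximate shortest paths with the main protocol. -/
noncomputable def distProtocol (c k : ℕ) (s : Fin n)
    (h1 : Fintype.card (Option ((Fin (topClass c n k + 1) × Fin n) ×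
      Fin (2 * exponentBound n k + 1))) ≤ M)
    (h2 : Fintype.card (Fin (searchBound n k + 1)) ≤ M)
    (h3 : Fintype.card (Option (Fin n × Fin (topClass c n k + 1))) ≤ M) :
    Prot (Fin n × (Fin n → Option ℕ)) n (Fin M) (Fin n → ℝ≥0∞) :=
  ((protocol (classLength c n k) k s h1 h2 h3).contramap fun x =>
    (x.1, fun j => arcClass c n k (x.2 j))).bind fun u =>
  Prot.ret fun v => outputDist c n k (u v)

theorem within_distProtocol (s : Fin n)
    (h1 : Fintype.card (Option ((Fin (topClass c n k + 1) × Fin n) ×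
      Fin (2 * exponentBound n k + 1))) ≤ M)
    (h2 : Fintype.card (Fin (searchBound n k + 1)) ≤ M)
    (h3 : Fintype.card (Option (Fin n × Fin (topClass c n k + 1))) ≤ M) :
    (distProtocol c k s h1 h2 h3).Within (rounds n (topClass c n k + 1) k) :=
  ((within_protocol _ _ _ _ _ _).contramap _).bind (R' := 0) fun _ => Prot.within_ret _ _

theorem isApprox_run_distProtocol (s : Fin n)
    (h1 : Fintype.card (Option ((Fin (topClass c n k + 1) × Fin n) ×
      Fin (2 * exponentBound n k + 1))) ≤ M)
    (h2 : Fintype.card (Fin (searchBound n k + 1)) ≤ M)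
    (h3 : Fintype.card (Option (Fin n × Fin (topClass c n k + 1))) ≤ M) (hn : 2 ≤ n)
    (hk : k ≤ 8 * n) (hk5 : 5 ≤ k) {ε : ℝ} (hε : (1 + 1 / k : ℝ) ^ 3 ≤ 1 + ε)
    {G : SimpleGraph (Fin n)} {w : Sym2 (Fin n) → ℕ} (hw : ∀ e ∈ G.edgeSet, w e ≤ n ^ c)
    (v : Fin n) : IsApprox ε (weightedDist G w s v)
      ((distProtocol c k s h1 h2 h3).run (fun v => (v, weightRow G w v)) v) := by
  rw [distProtocol, Prot.run_bind, Prot.run_contramap, Prot.run_ret]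
  have hspec := run_protocol_spec (W := classLength c n k) (k := k) (s := s) (h1 := h1) (h2 := h2)
    (h3 := h3) (cls := fun a b => arcClass c n k (weightRow G w a b))
    (fun a b => by rw [weightRow_symm]) classLength_pos (by omega) hn
  exact isApprox_outputDist hn hk hk5 hw hε hspec.1 hspec.2 v

section Bounds

variable (hn : 2 ≤ n)
include hn

/-- The assumption `k ≤ 8 * n` makes every quantity polynomial in `n`. Numerical constants are
absorbed into powers of `Q = 2 ^ Nat.clog 2 n`, which is at least 2. -/
theorem card_messages_le (hk : k ≤ 8 * n) (c : ℕ) :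
    Fintype.card (Option ((Fin (topClass c n k + 1) × Fin n) ×
      Fin (2 * exponentBound n k + 1))) ≤ 2 ^ ((c + 40) * Nat.clog 2 n) ∧
    Fintype.card (Fin (searchBound n k + 1)) ≤ 2 ^ ((c + 40) * Nat.clog 2 n) ∧
    Fintype.card (Option (Fin n × Fin (topClass c n k + 1))) ≤ 2 ^ ((c + 40) * Nat.clog 2 n) := by
  rw [mul_comm (c + 40), pow_mul]
  have hlg : 1 ≤ Nat.clog 2 n := Nat.clog_pos (by norm_num) hn
  have hlgQ : Nat.clog 2 n ≤ 2 ^ Nat.clog 2 n := Nat.lt_two_pow_self.le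
  have hnQ := le_two_pow_clog n
  have hF : 2 ^ fieldBits n = 2 ^ Nat.clog 2 n * 2 ^ Nat.clog 2 n * 2 := by
    unfold fieldBits; ring
  unfold topClass exponentBound searchBound precision diam
  rw [hF]
  generalize 2 ^ Nat.clog 2 n = Q at *
  generalize Nat.clog 2 n = l at *
  have h2Q : 2 ≤ Q := hn.trans hnQ
  have hpow : ∀ j, 2 ^ j ≤ Q ^ j := fun j => Nat.pow_le_pow_left h2Q j
  have hmono : ∀ {i j}, i ≤ j → Q ^ i ≤ Q ^ j := fun h => Nat.pow_le_pow_right (by omega) h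
  have hsucc : ∀ j, Q ^ j + 1 ≤ Q ^ (j + 1) := fun j => by
    have : 1 ≤ Q ^ j := Nat.one_le_pow _ _ (by omega)
    rw [pow_succ]
    nlinarith
  have hkQ : k ≤ Q ^ 4 := by
    have := hpow 3
    calc k ≤ 2 ^ 3 * n := hk
      _ ≤ Q ^ 3 * Q := by gcongr
      _ = Q ^ 4 := by ring
  have hcQ : c + 10 ≤ Q ^ (c + 10) := Nat.lt_two_pow_self.le.trans (hpow _)
  have hL : k * ((c + 10) * l) + 1 ≤ Q ^ (c + 16) :=
    calc k * ((c + 10) * l) + 1 ≤ Q ^ 4 * (Q ^ (c + 10) * Q) + 1 := by gcongr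
      _ = Q ^ (c + 15) + 1 := by ring
      _ ≤ _ := hsucc _
  have hl1 : l + 1 ≤ Q ^ 2 := by
    nlinarith
  have hX : 2 * (24 * k * (l + 1) * l + l + 1) + 1 ≤ Q ^ 16 := by
    have h5 := hpow 5
    have h6 : 24 * k * (l + 1) * l ≤ Q ^ 12 :=
      calc 24 * k * (l + 1) * l ≤ Q ^ 5 * Q ^ 4 * Q ^ 2 * Q := by gcongr; omega
        _ = Q ^ 12 := by ring
    have h7 : Q ^ 2 ≤ Q ^ 12 := hmono (by norm_num)
    have h8 : 2 * (24 * k * (l + 1) * l + l + 1) ≤ Q ^ 15 :=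
      calc 2 * (24 * k * (l + 1) * l + l + 1) ≤ 2 ^ 2 * Q ^ 12 := by omega
        _ ≤ Q ^ 2 * Q ^ 12 := Nat.mul_le_mul (hpow 2) le_rfl
        _ = Q ^ 14 := by ring
        _ ≤ Q ^ 15 := hmono (by norm_num)
    exact (Nat.add_le_add_right h8 1).trans (hsucc _)
  refine ⟨?_, ?_, ?_⟩
  · simp only [Fintype.card_option, Fintype.card_prod, Fintype.card_fin]
    calc (k * ((c + 10) * l) + 1) * n * (2 * (24 * k * (l + 1) * l + l + 1) + 1) + 1 ≤
        Q ^ (c + 16) * Q * Q ^ 16 + 1 := by gcongr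
      _ = Q ^ (c + 33) + 1 := by ring
      _ ≤ Q ^ (c + 34) := hsucc _
      _ ≤ _ := hmono (by omega)
  · rw [Fintype.card_fin]
    have h2 : 108 ≤ Q ^ 7 := le_trans (by norm_num) (hpow 7)
    have h3 : 3 ≤ Q ^ 2 := le_trans (by norm_num) (hpow 2)
    calc (Q * Q * 2) ^ 2 * (3 * (Q * Q * 2) * n * (108 * k * (l + 1))) + 1 ≤
        (Q * Q * Q) ^ 2 * (Q ^ 2 * (Q * Q * Q) * Q * (Q ^ 7 * Q ^ 4 * Q ^ 2)) + 1 := by gcongr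
      _ = Q ^ 25 + 1 := by ring
      _ ≤ Q ^ 26 := hsucc _
      _ ≤ _ := hmono (by omega)
  · simp only [Fintype.card_option, Fintype.card_prod, Fintype.card_fin]
    calc n * (k * ((c + 10) * l) + 1) + 1 ≤ Q * Q ^ (c + 16) + 1 := by gcongr
      _ = Q ^ (c + 17) + 1 := by ring
      _ ≤ Q ^ (c + 18) := hsucc _
      _ ≤ _ := hmono (by omega)

theorem card_row_le (c : ℕ) :
    Fintype.card (Option (Fin (n ^ c + 1))) ≤ 2 ^ ((c + 40) * Nat.clog 2 n) := by
  rw [mul_comm (c + 40), pow_mul]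
  have hnQ := le_two_pow_clog n
  set Q := 2 ^ Nat.clog 2 n
  have h2Q : 2 ≤ Q := hn.trans hnQ
  have h1 : n ^ c ≤ Q ^ c := Nat.pow_le_pow_left hnQ c
  have h2 : 1 ≤ Q ^ c := Nat.one_le_pow _ _ (by omega)
  rw [Fintype.card_option, Fintype.card_fin]
  calc n ^ c + 1 + 1 ≤ 2 ^ 2 * Q ^ c := by omega
    _ ≤ Q ^ 2 * Q ^ c := Nat.mul_le_mul (Nat.pow_le_pow_left h2Q 2) le_rfl
    _ = Q ^ (c + 2) := by ring
    _ ≤ _ := Nat.pow_le_pow_right (by omega) (by omega)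

end Bounds

/-- With `l = Nat.clog 2 n` there are of order `k ^ 2 * l ^ 3` iterations. Each takes of order `k ^
3 * l ^ 5` rounds: `k * l` classes, `l ^ 2` groups per class, `k ^ 2 * l ^ 2` samples per group. -/
theorem rounds_le (hn : 2 ≤ n) (hk : 0 < k) (c : ℕ) :
    rounds n (topClass c n k + 1) k ≤ 10 ^ 9 * (c + 11) * k ^ 5 * Nat.clog 2 n ^ 8 := by
  have hlg : 1 ≤ Nat.clog 2 n := Nat.clog_pos (by norm_num) hn
  unfold rounds topClass iterations groupBound samples fieldBits diam
  set l := Nat.clog 2 n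
  have hkl : 1 ≤ k * l := Nat.mul_pos hk hlg
  have hL : k * ((c + 10) * l) + 1 ≤ (c + 11) * (k * l) := by nlinarith
  have hl1 : l + 1 ≤ 2 * l := by omega
  have hl3 : l + 2 + 1 ≤ 4 * l := by omega
  have hl2 : l + 2 ≤ 3 * l := by omega
  have hS : 23328 * k ^ 2 * (l + 1) ^ 2 + 1 ≤ 93313 * (k * l) ^ 2 := by
    have h1 : 1 ≤ (k * l) ^ 2 := Nat.one_le_pow _ _ hkl
    calc 23328 * k ^ 2 * (l + 1) ^ 2 + 1 ≤ 23328 * k ^ 2 * (2 * l) ^ 2 + (k * l) ^ 2 := by gcongr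
      _ = _ := by ring
  have h1 : (l + 1) * ((k * ((c + 10) * l) + 1) * (l + 2)) ≤ 6 * (c + 11) * (k ^ 5 * l ^ 8) :=
    calc _ ≤ 2 * l * ((c + 11) * (k * l) * (3 * l)) := by gcongr
      _ = 6 * (c + 11) * (k ^ 1 * l ^ 3) := by ring
      _ ≤ _ := by gcongr <;> omega
  have h2 : (k * ((c + 10) * l) + 1) * ((l + 2 + 1) * (l + 1)) ≤ 8 * (c + 11) * (k * l ^ 3) :=
    calc _ ≤ (c + 11) * (k * l) * ((4 * l) * (2 * l)) := by gcongr
      _ = _ := by ring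
  have h3 : 72 * k ^ 2 * (l + 1) ^ 2 * l ≤ 288 * k ^ 2 * l ^ 3 :=
    calc _ ≤ 72 * k ^ 2 * (2 * l) ^ 2 * l := by gcongr
      _ = _ := by ring
  have h4 : (k * ((c + 10) * l) + 1) * ((l + 2 + 1) * (l + 1)) +
      (2 * (2 * (2 * l + 1)) + (k * ((c + 10) * l) + 1) * ((l + 2 + 1) * (l + 1)) *
        (2 * (23328 * k ^ 2 * (l + 1) ^ 2 + 1))) ≤ 1500000 * (c + 11) * (k ^ 3 * l ^ 5) :=
    calc _ ≤ 8 * (c + 11) * (k * l ^ 3) + (12 * (c + 11) * (k * l) + 8 * (c + 11) * (k * l ^ 3) *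
          (2 * (93313 * (k * l) ^ 2))) := by
          have h5 : 2 * (2 * (2 * l + 1)) ≤ 12 * (c + 11) * (k * l) := by nlinarith
          gcongr
      _ = 8 * (c + 11) * (k ^ 1 * l ^ 3) + 12 * (c + 11) * (k ^ 1 * l ^ 1) +
          1493008 * (c + 11) * (k ^ 3 * l ^ 5) := by ring
      _ ≤ 8 * (c + 11) * (k ^ 3 * l ^ 5) + 12 * (c + 11) * (k ^ 3 * l ^ 5) +
          1493008 * (c + 11) * (k ^ 3 * l ^ 5) := by gcongr <;> omega
      _ = 1493028 * ((c + 11) * (k ^ 3 * l ^ 5)) := by ring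
      _ ≤ 1500000 * ((c + 11) * (k ^ 3 * l ^ 5)) := by gcongr; norm_num
      _ = _ := by ring
  calc _ ≤ 6 * (c + 11) * (k ^ 5 * l ^ 8) + 288 * k ^ 2 * l ^ 3 *
        (1500000 * (c + 11) * (k ^ 3 * l ^ 5)) := by gcongr
    _ = 432000006 * ((c + 11) * (k ^ 5 * l ^ 8)) := by ring
    _ ≤ 10 ^ 9 * ((c + 11) * (k ^ 5 * l ^ 8)) := by gcongr; norm_num
    _ = _ := by ring

end Approx

/-- The accuracy parameter of the approximate protocol. -/
noncomputable def accuracy (ε : ℝ) : ℕ := ⌈7 / ε⌉₊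

section Accuracy

variable {ε : ℝ} (h0 : 0 < ε) (h1 : ε ≤ 1)
include h0 h1

theorem seven_le_accuracy : 7 ≤ accuracy ε := by
  have : (7 : ℝ) ≤ accuracy ε := le_trans (by rw [le_div_iff₀ h0]; linarith) (Nat.le_ceil _)
  exact_mod_cast this

theorem accuracy_le : (accuracy ε : ℝ) ≤ 8 * (1 / ε) := by
  have h2 := (Nat.ceil_lt_add_one (a := 7 / ε) (by positivity)).le
  have h3 : 1 ≤ 1 / ε := by rw [le_div_iff₀ h0]; linarith
  have h4 : 7 / ε = 7 * (1 / ε) := by ring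
  unfold accuracy
  linarith

/-- Three factors accumulate: rounding to classes, the main protocol, and the additive errors of
zero weights. -/
theorem one_add_pow_le : (1 + 1 / accuracy ε : ℝ) ^ 3 ≤ 1 + ε := by
  have h2 : 7 / ε ≤ accuracy ε := Nat.le_ceil _
  have h3 : (1 / accuracy ε : ℝ) ≤ ε / 7 := by
    have h4 := one_div_le_one_div_of_le (by positivity) h2
    rwa [one_div_div] at h4
  calc (1 + 1 / accuracy ε : ℝ) ^ 3 ≤ (1 + ε / 7) ^ 3 := by gcongr
    _ ≤ 1 + ε := by nlinarith [mul_pos h0 h0, mul_pos (mul_pos h0 h0) h0, mul_le_mul h1 h1 h0.le zero_le_one]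

end Accuracy

theorem clog_le_log {n : ℕ} (hn : 2 ≤ n) : (Nat.clog 2 n : ℝ) ≤ 3 * Real.log (n + 1) := by
  have hlg : 1 ≤ Nat.clog 2 n := Nat.clog_pos (by norm_num) hn
  have h1 : 2 ^ (Nat.clog 2 n - 1) < n := Nat.pow_pred_clog_lt_self (by norm_num) (by omega)
  have h2 : (2 : ℝ) ^ (Nat.clog 2 n - 1) ≤ n + 1 := by
    have : (2 : ℝ) ^ (Nat.clog 2 n - 1) < n := by exact_mod_cast h1
    linarith
  have h3 := Real.log_le_log (by positivity) h2
  rw [Real.log_pow, Nat.cast_sub hlg, Nat.cast_one] at h3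
  have h4 : Real.log 2 ≤ Real.log (n + 1) :=
    Real.log_le_log (by norm_num) (by have : (2 : ℝ) ≤ n := by exact_mod_cast hn
                                      linarith)
  have h5 := Real.log_two_gt_d9
  have h6 : (1 : ℝ) ≤ Nat.clog 2 n := by exact_mod_cast hlg
  nlinarith

open Classical in
/-- The protocol for approximate shortest paths. -/
noncomputable def ssspProtocol (c n : ℕ) (ε : ℝ) (s : Fin n) : GraphProt (c + 40) n :=
  if h : 2 ≤ n ∧ accuracy ε ≤ 8 * n then
    Approx.distProtocol c (accuracy ε) s (Approx.card_messages_le h.1 h.2 c).1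
      (Approx.card_messages_le h.1 h.2 c).2.1 (Approx.card_messages_le h.1 h.2 c).2.2
  else if h : 2 ≤ n then Exact.protocol (Approx.card_row_le h c) s
  else .ret fun _ => 0

theorem ssspProtocol_spec (c : ℕ) {n : ℕ} (hn : 2 ≤ n) {ε : ℝ} (h0 : 0 < ε) (h1 : ε ≤ 1)
    {G : SimpleGraph (Fin n)} {w : Sym2 (Fin n) → ℕ} (hw : ∀ e ∈ G.edgeSet, w e ≤ n ^ c)
    (s : Fin n) : ∃ R : ℕ, (ssspProtocol c n ε s).Within R ∧
      (R : ℝ) + 1 ≤ 10 ^ 19 * (c + 11) * (1 / ε) ^ 5 * Real.log (n + 1) ^ 8 ∧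
      ∀ v, IsApprox ε (weightedDist G w s v)
        ((ssspProtocol c n ε s).run (fun v => (v, weightRow G w v)) v) := by
  have hlog := clog_le_log hn
  have hlg : (1 : ℝ) ≤ Nat.clog 2 n := by exact_mod_cast Nat.clog_pos (by norm_num) hn
  have hk7 := seven_le_accuracy h0 h1
  have hkε := accuracy_le h0 h1
  have hbound : ∀ R : ℕ, R ≤ 10 ^ 9 * (c + 11) * accuracy ε ^ 5 * Nat.clog 2 n ^ 8 →
      (R : ℝ) + 1 ≤ 10 ^ 19 * (c + 11) * (1 / ε) ^ 5 * Real.log (n + 1) ^ 8 := by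
    intro R hR
    have hR' : (R : ℝ) ≤ 10 ^ 9 * (c + 11) * accuracy ε ^ 5 * Nat.clog 2 n ^ 8 := by
      exact_mod_cast hR
    have hk1 : (1 : ℝ) ≤ accuracy ε := by exact_mod_cast (by omega : 1 ≤ accuracy ε)
    have hone : (1 : ℝ) ≤ (c + 11) * accuracy ε ^ 5 * Nat.clog 2 n ^ 8 := by
      have e1 : (1 : ℝ) ≤ accuracy ε ^ 5 := one_le_pow₀ hk1
      have e2 : (1 : ℝ) ≤ (Nat.clog 2 n : ℝ) ^ 8 := one_le_pow₀ hlg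
      have e3 : (1 : ℝ) ≤ c + 11 := by
        have : (0 : ℝ) ≤ c := Nat.cast_nonneg c
        linarith
      exact one_le_mul_of_one_le_of_one_le (one_le_mul_of_one_le_of_one_le e3 e1) e2
    calc (R : ℝ) + 1 ≤ (10 ^ 9 + 1) * ((c + 11) * accuracy ε ^ 5 * Nat.clog 2 n ^ 8) := by
          linarith
      _ ≤ (10 ^ 9 + 1) * ((c + 11) * (8 * (1 / ε)) ^ 5 * (3 * Real.log (n + 1)) ^ 8) := by gcongr
      _ = (10 ^ 9 + 1) * 8 ^ 5 * 3 ^ 8 * ((c + 11) * (1 / ε) ^ 5 * Real.log (n + 1) ^ 8) := by ring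
      _ ≤ 10 ^ 19 * ((c + 11) * (1 / ε) ^ 5 * Real.log (n + 1) ^ 8) := by
          have e1 : (0 : ℝ) ≤ Real.log (n + 1) := by linarith
          gcongr
          norm_num
      _ = _ := by ring
  -- Otherwise `n` rounds are fewer than `accuracy ε`, and the exact protocol meets the same bound.
  by_cases hk : accuracy ε ≤ 8 * n
  · rw [ssspProtocol, dif_pos ⟨hn, hk⟩]
    exact ⟨_, Approx.within_distProtocol _ _ _ _,
      hbound _ (Approx.rounds_le hn (by omega) c),
      Approx.isApprox_run_distProtocol _ _ _ _ hn hk (by omega) (one_add_pow_le h0 h1) hw⟩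
  · rw [ssspProtocol, dif_neg (fun h => hk h.2), dif_pos hn]
    refine ⟨n, Exact.within_protocol _ _, hbound _ ?_, fun v => ?_⟩
    · have e1 : 1 ≤ Nat.clog 2 n ^ 8 := Nat.one_le_pow _ _ (Nat.clog_pos (by norm_num) hn)
      calc n ≤ accuracy ε := by omega
        _ = 1 * 1 * accuracy ε ^ 1 * 1 := by ring
        _ ≤ _ := by gcongr <;> omega
    · rw [Exact.run_protocol _ _ hw]
      exact isApprox_self h0.le _

end BroadcastCongestedClique

open BroadcastCongestedClique in
theorem mainTheorem7 :
    ∃ a b : ℕ, ∀ c : ℕ, ∃ (κ : ℕ) (C : ℝ)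
      (A : BroadcastCongestedClique.Algorithm BroadcastCongestedClique.SSSPInput ℝ≥0∞),
      ∀ (n : ℕ) (ε : ℝ), 0 < ε → ε ≤ 1 →
      ∀ (ident : Fin n → ℕ), Function.Injective ident → (∀ v, ident v ≤ n ^ c) →
      ∀ (G : SimpleGraph (Fin n)) (w : Sym2 (Fin n) → ℕ), (∀ e ∈ G.edgeSet, w e ≤ n ^ c) →
      ∀ s : Fin n,
        A.MessagesBounded ident
          (BroadcastCongestedClique.localInput ε ident G w s) (κ * Nat.clog 2 n) ∧
        ∃ T : ℕ, (T : ℝ) ≤ C * (1 / ε) ^ a * Real.log (n + 1) ^ b ∧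
          ∀ v : Fin n, ∃ y : ℝ≥0∞,
            A.output (A.stateAfter ident
              (BroadcastCongestedClique.localInput ε ident G w s) T v) = some y ∧
            BroadcastCongestedClique.IsApprox ε
              (BroadcastCongestedClique.weightedDist G w s v) y := by
  refine ⟨5, 8, fun c => ⟨c + 40, 10 ^ 19 * (c + 11), compile (ssspProtocol c), ?_⟩⟩
  intro n ε h0 h1 ident hid _ G w hw s
  -- For `n ≤ 1` no bits may be sent, as `Nat.clog 2 n = 0`; the only node is the source and outputs
  -- 0 at once.
  rcases Nat.lt_or_ge n 2 with hn | hn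
  · have hout : ∀ t v, (compile (ssspProtocol c)).output ((compile (ssspProtocol c)).stateAfter
        ident (localInput ε ident G w s) t v) = some 0 := output_compile_of_le_one _ (by omega)
    refine ⟨fun t v hv => ?_, 0, ?_, fun v => ⟨0, hout 0 v, ?_⟩⟩
    · rw [hout] at hv; cases hv
    · have : 0 ≤ Real.log (n + 1) := Real.log_nonneg (by
        have : (0 : ℝ) ≤ n := Nat.cast_nonneg n
        linarith)
      rw [Nat.cast_zero]
      positivity
    · obtain rfl : v = s := by
        have := v.2
        have := s.2
        exact Fin.ext (by omega)
      rw [weightedDist_self]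
      exact isApprox_self h0.le _
  · obtain ⟨σ, hm, hrun⟩ := compile_spec (G := G) (w := w) (s := s) (ε := ε) (ssspProtocol c)
      (by omega) hn hid
    have hrow : ∀ i, (fun j => weightRow G w (σ.symm i) (σ.symm j)) =
        weightRow (G.comap σ.symm) (fun x => w (x.map σ.symm)) i := fun i => by
      funext j
      simp only [weightRow, Sym2.map_mk]
      rfl
    obtain ⟨R, hR, hRb, happ⟩ := ssspProtocol_spec c hn h0 h1 (G := G.comap σ.symm)
      (w := fun x => w (x.map σ.symm)) (by
        intro e he
        induction e using Sym2.ind with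
        | _ a b => exact hw _ he) (σ s)
    -- The additional round is the initial exchange of identifiers.
    refine ⟨hm, R + 1, by exact_mod_cast hRb, fun v => ⟨_, hrun R hR v, ?_⟩⟩
    have := happ (σ v)
    rw [weightedDist_relabel] at this
    simpa only [hrow] using this
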